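/- \textbf{Notation.} Let $\mathbb H_{\mathbb R}$ be the algebra of split quaternions $$X=\begin{pmatrix} z_{11}&z_{12}\\ z_{21}&z_{22}\end{pmatrix}=\begin{pmatrix} x^0-ix^3 & x^1+ix^2\\ x^1-ix^2& x^0+ix^3\end{pmatrix},\qquad x^0,\dots,x^3\in\mathbb R,$$ with $N(X)=\det X=(x^0)^2-(x^1)^2-(x^2)^2+(x^3)^2$ and $\|X\|^2=\sum_i (x^i)^2$. Put $\mathbb H_{\mathbb R}^+=\{N(X)>0\}$ and, for $R>0$, $H_R=\{N(X)=R^2\}$, with Euclidean surface measure $dS$. Let $\deg=1+\sum_i x^i\,\partial/\partial x^i$ and $\square_{2,2}=\partial_0^2-\partial_1^2-\partial_2^2+\partial_3^2$. The Schwartz space $\mathcal S(\mathbb H_{\mathbb R}^+)$ consists of the smooth functions $f:\mathbb H_{\mathbb R}^+\to\mathbb C$ for which all the seminorms $$\mu_{a,k,\rho}(f)=\sup_{\rho^{-2}\le N(X)\le \rho^2}|(a\cdot f)(X)|\,\|X\|\,(1+|\log\|X\||)^k$$ are finite, where $k\in\mathbb N$, $\rho>1$, and $a$ runs over the monomials (which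 span) in the universal enveloping algebra of $\mathfrak{gl}(2,\mathbb R)\times\mathfrak{gl}(2,\mathbb R)$ acting by differentiation of $f(X)\mapsto f(g^{-1}Xh)$. Let $\mathcal H(\mathbb H_{\mathbb R}^+)=\{\phi\in\mathcal S(\mathbb H_{\mathbb R}^+):\square_{2,2}\phi=0\}$. For half-integers $l,n,m$ with $l-m,\ l+m,\ n-l\in\mathbb Z$ let $$t^l_{n\,\underline m}(Z)=\frac1{2\pi i}\oint_{|s|=1}(sz_{11}+z_{21})^{l-m}(sz_{12}+z_{22})^{l+m}s^{-l+n}\,\frac{ds}s .$$ Call $(l,n,m)$ a discrete series index if $l\in\{-1,-\tfrac32,-2,\dots\}$, $m,n\in\mathbb Z+l$, and either $m,n\ge -l$ or $m,n\le l$. The discrete series component of $\mathcal H(\mathbb H_{\mathbb R}^+)$ is the closure in $\mathcal H(\mathbb H_{\mathbb R}^+)$, in the topology of the above seminorms, of the linear span of the functions $t^l_{n\,\underline m}(Z)$ and $N(Z)^{-2l-1}t^l_{n\,\underline m}(Z)$ over all discrete series indices. The regularized Poisson operators are $$(I_R^{\pm}\phi)(W)=\lim_{\epsilon\to0^+}\frac1{2\pi^2}\int_{X\in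 H_R}\frac{(\deg\phi)(X)}{N(X-W)\pm i\epsilon}\,\frac{dS}{\|X\|},\qquad W\in\mathbb H_{\mathbb R}^+ .$$ \textbf{Theorem.} Let $R>0$. (1) For every $\phi$ in the discrete series component of $\mathcal H(\mathbb H_{\mathbb R}^+)$ and every $W\in\mathbb H_{\mathbb R}^+$, the integrals defining $(I_R^{\pm}\phi)(W)$ converge absolutely for each $\epsilon>0$, the limits exist, and $(I^+_R\phi)(W)=(I^-_R\phi)(W)$. (2) For every discrete series index $(l,n,m)$, every choice of the sign $\pm$ and every $W\in\mathbb H_{\mathbb R}^+$, the same convergence holds for the two functions below, and the value at $W$ of the image under $I^\pm_R$ is $$N(Z)^{-2l-1}\,t^l_{n\,\underline m}(Z)\ \mapsto\ \begin{cases}-N(W)^{-2l-1}\,t^l_{n\,\underline m}(W)&\text{if }N(W)\le R^2,\\ -R^{-2(2l+1)}\,t^l_{n\,\underline m}(W)&\text{if }N(W)\ge R^2,\end{cases}$$ $$t^l_{n\,\underline m}(Z)\ \mapsto\ \begin{cases}R^{2(2l+1)}\,N(W)^{-2l-1}\,t^l_{n\,\underline m}(W)&\text{if }N(W)\le R^2,\\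 t^l_{n\,\underline m}(W)&\text{if }N(W)\ge R^2.\end{cases}$$ -/

import Mathlib

open MeasureTheory Filter Topology
open scoped ContDiff ENNReal

namespace SplitQuat

noncomputable section

/-! ### The split quaternions -/

/-- The split quaternions `x⁰ e₀ + x¹ ẽ₁ + x² ẽ₂ + x³ e₃`, with the Euclidean norm for which
`e₀, ẽ₁, ẽ₂, e₃` is an orthonormal basis. -/
abbrev HR : Type := EuclideanSpace ℝ (Fin 4)

/-- The matrix entry `z₁₁ = x⁰ - i x³`. -/
def z11 (X : HR) : ℂ := ⟨X 0, -X 3⟩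

/-- The matrix entry `z₁₂ = x¹ + i x²`. -/
def z12 (X : HR) : ℂ := ⟨X 1, X 2⟩

/-- The matrix entry `z₂₁ = x¹ - i x²`. -/
def z21 (X : HR) : ℂ := ⟨X 1, -X 2⟩

/-- The matrix entry `z₂₂ = x⁰ + i x³`. -/
def z22 (X : HR) : ℂ := ⟨X 0, X 3⟩

/-- The standard matrix realization of the split quaternions. -/
def toMat (X : HR) : Matrix (Fin 2) (Fin 2) ℂ := !![z11 X, z12 X; z21 X, z22 X]

/-- The multiplication of split quaternions; `toMat_mul` below says that it is the
multiplication of matrices. -/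
def mul (X Y : HR) : HR :=
  !₂[(z11 X * z11 Y + z12 X * z21 Y).re, (z11 X * z12 Y + z12 X * z22 Y).re,
    (z11 X * z12 Y + z12 X * z22 Y).im, -(z11 X * z11 Y + z12 X * z21 Y).im]

/-- The quadratic form `N(X) = (x⁰)² - (x¹)² - (x²)² + (x³)²`. -/
def N (X : HR) : ℝ := X 0 ^ 2 - X 1 ^ 2 - X 2 ^ 2 + X 3 ^ 2

theorem toMat_mul (X Y : HR) : toMat (mul X Y) = toMat X * toMat Y := by
  ext i j
  fin_cases i <;> fin_cases j <;>
    simp [toMat, mul, z11, z12, z21, z22, Complex.ext_iff] <;> (constructor <;> ring)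

theorem det_toMat (X : HR) : (toMat X).det = (N X : ℂ) := by
  rw [toMat, Matrix.det_fin_two_of]
  apply Complex.ext <;> simp [z11, z12, z21, z22, N, pow_two] <;> ring

/-- The open set of split quaternions with `N(X) > 0`. -/
def HRplus : Set HR := {X | 0 < N X}

/-- The hyperboloid `N(X) = R²`. -/
def hyperboloid (R : ℝ) : Set HR := {X | N X = R ^ 2}

/-! ### The Schwartz space, harmonic functions

Functions on `HRplus` are represented by functions on `HR` of which only the values on the open
set `HRplus` matter. -/

/-- The infinitesimal action of `(A, B) ∈ gl(2,ℝ) × gl(2,ℝ)` on functions, obtained by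
differentiating `f(X) ↦ f(a⁻¹ X b)` at the identity. -/
def lieAct (A B : HR) (f : HR → ℂ) : HR → ℂ :=
  fun X => fderiv ℝ f X (mul X B - mul A X)

/-- The action of a monomial of the universal enveloping algebra of `gl(2,ℝ) × gl(2,ℝ)`,
i.e. of the composition of the operators `lieAct A B` for `(A, B)` in the list. Such monomials
span the universal enveloping algebra. -/
def wordAct (w : List (HR × HR)) (f : HR → ℂ) : HR → ℂ :=
  w.foldr (fun p g => lieAct p.1 p.2 g) f

/-- The seminorm `sup |a · f(X)| ‖X‖ (1 + |log ‖X‖|)^n` over `ρ⁻² ≤ N(X) ≤ ρ²`, where `a` is the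
monomial given by the list `w`. -/
def schwartzSeminorm (w : List (HR × HR)) (n : ℕ) (ρ : ℝ) (f : HR → ℂ) : ℝ≥0∞ :=
  ⨆ X ∈ {X : HR | (ρ ^ 2)⁻¹ ≤ N X ∧ N X ≤ ρ ^ 2},
    ENNReal.ofReal (‖wordAct w f X‖ * ‖X‖ * (1 + |Real.log ‖X‖|) ^ n)

/-- Membership in the (Harish-Chandra type) Schwartz space of `HRplus`. -/
def IsSchwartz (f : HR → ℂ) : Prop :=
  ContDiffOn ℝ ∞ f HRplus ∧
    ∀ (w : List (HR × HR)) (n : ℕ) (ρ : ℝ), 1 < ρ → schwartzSeminorm w n ρ f < ⊤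

/-- The second partial derivative in the direction of the `i`-th basis vector. -/
def secondPartial (i : Fin 4) (f : HR → ℂ) (X : HR) : ℂ :=
  iteratedFDeriv ℝ 2 f X (fun _ => EuclideanSpace.single i 1)

/-- The ultrahyperbolic wave operator. -/
def box22 (f : HR → ℂ) (X : HR) : ℂ :=
  secondPartial 0 f X - secondPartial 1 f X - secondPartial 2 f X + secondPartial 3 f X

/-- The space of harmonic functions in the Schwartz space of `HRplus`. -/
def harmonicSpace : Set (HR → ℂ) := {f | IsSchwartz f ∧ ∀ X ∈ HRplus, box22 f X = 0}

/-! ### Matrix coefficients of the discrete series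

The half-integers `l, n, m` are encoded by the integers `l2 = 2l`, `n2 = 2n`, `m2 = 2m`. -/

/-- `(l, n, m)` is an index of the discrete series: `l ∈ {-1, -3/2, -2, …}`, `m, n ∈ ℤ + l`, and
either `m, n ≥ -l` (holomorphic) or `m, n ≤ l` (antiholomorphic). -/
def IsDiscreteIndex (l2 n2 m2 : ℤ) : Prop :=
  l2 ≤ -2 ∧ Even (n2 - l2) ∧ Even (m2 - l2) ∧
    ((-l2 ≤ m2 ∧ -l2 ≤ n2) ∨ (m2 ≤ l2 ∧ n2 ≤ l2))

/-- The matrix coefficient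
`t^l_{n m}(Z) = (2πi)⁻¹ ∮ (s z₁₁ + z₂₁)^(l-m) (s z₁₂ + z₂₂)^(l+m) s^(-l+n) ds/s`
over the unit circle, for half-integers with `l - m`, `l + m`, `n - l` integral. -/
def matCoeff (l2 n2 m2 : ℤ) (Z : HR) : ℂ :=
  (2 * Real.pi * Complex.I)⁻¹ * ∮ s in C(0, 1),
    (s * z11 Z + z21 Z) ^ ((l2 - m2) / 2) * (s * z12 Z + z22 Z) ^ ((l2 + m2) / 2) *
      s ^ ((n2 - l2) / 2) * s⁻¹

/-- The function `N(Z)^(-2l-1) t^l_{n m}(Z)`. -/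
def matCoeffInv (l2 n2 m2 : ℤ) (Z : HR) : ℂ :=
  (N Z : ℂ) ^ (-l2 - 1) * matCoeff l2 n2 m2 Z

/-- The linear span of the functions `t^l_{n m}` and `N^(-2l-1) t^l_{n m}` of the (holomorphic and
antiholomorphic) discrete series. -/
def discreteSpan : Submodule ℂ (HR → ℂ) :=
  Submodule.span ℂ {f | ∃ l2 n2 m2 : ℤ, IsDiscreteIndex l2 n2 m2 ∧
    (f = matCoeff l2 n2 m2 ∨ f = matCoeffInv l2 n2 m2)}

/-- The discrete series component of `harmonicSpace`: the closure of `discreteSpan` in it, for the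
topology defined by the Schwartz seminorms. -/
def discreteSeriesComponent : Set (HR → ℂ) :=
  {f | f ∈ harmonicSpace ∧
    ∀ (F : Finset (List (HR × HR) × ℕ × ℝ)), (∀ i ∈ F, 1 < i.2.2) → ∀ δ : ℝ≥0∞, 0 < δ →
      ∃ g ∈ discreteSpan, ∀ i ∈ F, schwartzSeminorm i.1 i.2.1 i.2.2 (f - g) < δ}

/-! ### The Euclidean surface measure of the hyperboloid -/

/-- The chart of the hyperboloid `N(X) = R²` with `z₁₁ = R cosh r · e^{iα}` and
`z₁₂ = R sinh r · e^{iβ}`. -/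
def chart (R α r β : ℝ) : HR :=
  !₂[R * Real.cosh r * Real.cos α, R * Real.sinh r * Real.cos β,
    R * Real.sinh r * Real.sin β, -(R * Real.cosh r * Real.sin α)]

/-- The parameter domain `0 ≤ α < 2π`, `r > 0`, `0 ≤ β < 2π`. -/
def chartDomain : Set (ℝ × ℝ × ℝ) :=
  Set.Ico 0 (2 * Real.pi) ×ˢ Set.Ioi 0 ×ˢ Set.Ico 0 (2 * Real.pi)

/-- The three partial derivatives of the chart. -/
def chartTangent (R : ℝ) (p : ℝ × ℝ × ℝ) : Fin 3 → HR :=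
  ![deriv (fun α => chart R α p.2.1 p.2.2) p.1,
    deriv (fun r => chart R p.1 r p.2.2) p.2.1,
    deriv (fun β => chart R p.1 p.2.1 β) p.2.2]

/-- The Euclidean surface measure `dS` of the hyperboloid: the image under the chart of Lebesgue
measure times the square root of the Gram determinant. The chart is a bijection of its domain onto
the hyperboloid without the circle `z₁₂ = 0`; see `chart_bijOn`. -/
def surfaceMeasure (R : ℝ) : Measure HR :=
  Measure.map (fun p : ℝ × ℝ × ℝ => chart R p.1 p.2.1 p.2.2)
    ((volume.restrict chartDomain).withDensity
      fun p => ENNReal.ofReal (Real.sqrt (Matrix.gram ℝ (chartTangent R p)).det))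

theorem exists_angle {x y ρ : ℝ} (hρ : 0 < ρ) (h : x ^ 2 + y ^ 2 = ρ ^ 2) :
    ∃ a ∈ Set.Ico 0 (2 * Real.pi), ρ * Real.cos a = x ∧ ρ * Real.sin a = y := by
  have hz : ‖(⟨x, y⟩ : ℂ)‖ = ρ := by
    rw [Complex.norm_def, Complex.normSq_mk, ← Real.sqrt_sq hρ.le, ← h]
    congr 1
    ring
  refine ⟨toIcoMod Real.two_pi_pos 0 (Complex.arg ⟨x, y⟩), ?_, ?_, ?_⟩
  · simpa using toIcoMod_mem_Ico Real.two_pi_pos 0 (Complex.arg ⟨x, y⟩)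
  · rw [toIcoMod, zsmul_eq_mul, Real.cos_sub_int_mul_two_pi]
    have := Complex.norm_mul_cos_arg (⟨x, y⟩ : ℂ)
    rwa [hz] at this
  · rw [toIcoMod, zsmul_eq_mul, Real.sin_sub_int_mul_two_pi]
    have := Complex.norm_mul_sin_arg (⟨x, y⟩ : ℂ)
    rwa [hz] at this

theorem angle_unique {a b : ℝ} (ha : a ∈ Set.Ico 0 (2 * Real.pi))
    (hb : b ∈ Set.Ico 0 (2 * Real.pi)) (hc : Real.cos a = Real.cos b)
    (hs : Real.sin a = Real.sin b) : a = b := by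
  obtain ⟨k, hk⟩ := Real.Angle.angle_eq_iff_two_pi_dvd_sub.1 (Real.Angle.cos_sin_inj hc hs)
  have hp := Real.pi_pos
  have h1 : (k : ℝ) < 1 := by
    by_contra! h
    nlinarith [ha.1, ha.2, hb.1, hb.2]
  have h2 : (-1 : ℝ) < k := by
    by_contra! h
    nlinarith [ha.1, ha.2, hb.1, hb.2]
  have h3 : k < 1 := by exact_mod_cast h1
  have h4 : -1 < k := by exact_mod_cast h2
  have h5 : k = 0 := by omega
  rw [h5] at hk
  simp at hk
  linarith

theorem chart_bijOn (R : ℝ) (hR : 0 < R) :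
    Set.BijOn (fun p : ℝ × ℝ × ℝ => chart R p.1 p.2.1 p.2.2) chartDomain
      (hyperboloid R \ {X | z12 X = 0}) := by
  refine ⟨?_, ?_, ?_⟩
  · rintro ⟨α, r, β⟩ ⟨-, hr, -⟩
    have hr' : 0 < Real.sinh r := Real.sinh_pos_iff.2 hr
    refine ⟨?_, ?_⟩
    · have h1 := Real.cosh_sq r
      have h2 := Real.sin_sq_add_cos_sq α
      have h3 := Real.sin_sq_add_cos_sq β
      simp only [hyperboloid, Set.mem_ofPred_eq, N, chart]
      simp
      linear_combination R ^ 2 * Real.cosh r ^ 2 * h2 - R ^ 2 * Real.sinh r ^ 2 * h3 +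
        R ^ 2 * h1
    · intro h
      have h1 : R * Real.sinh r * Real.cos β = 0 := by
        simpa [chart, z12] using congrArg Complex.re h
      have h2 : R * Real.sinh r * Real.sin β = 0 := by
        simpa [chart, z12] using congrArg Complex.im h
      have h3 := Real.sin_sq_add_cos_sq β
      have h4 : R * Real.sinh r ≠ 0 := (mul_pos hR hr').ne'
      have h5 : Real.cos β = 0 := by simpa [h4] using h1
      have h6 : Real.sin β = 0 := by simpa [h4] using h2
      rw [h5, h6] at h3
      norm_num at h3
  · rintro ⟨α, r, β⟩ ⟨hα, hr, hβ⟩ ⟨α', r', β'⟩ ⟨hα', hr', hβ'⟩ h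
    have hs : 0 < Real.sinh r := Real.sinh_pos_iff.2 hr
    have hs' : 0 < Real.sinh r' := Real.sinh_pos_iff.2 hr'
    have e0 : R * Real.cosh r * Real.cos α = R * Real.cosh r' * Real.cos α' := by
      simpa [chart] using congrArg (fun X : HR => X 0) h
    have e1 : R * Real.sinh r * Real.cos β = R * Real.sinh r' * Real.cos β' := by
      simpa [chart] using congrArg (fun X : HR => X 1) h
    have e2 : R * Real.sinh r * Real.sin β = R * Real.sinh r' * Real.sin β' := by
      simpa [chart] using congrArg (fun X : HR => X 2) h
    have e3 : R * Real.cosh r * Real.sin α = R * Real.cosh r' * Real.sin α' := by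
      simpa [chart] using congrArg (fun X : HR => X 3) h
    have hsq : (R * Real.sinh r) ^ 2 = (R * Real.sinh r') ^ 2 := by
      have t1 := Real.sin_sq_add_cos_sq β
      have t2 := Real.sin_sq_add_cos_sq β'
      calc (R * Real.sinh r) ^ 2
          = (R * Real.sinh r * Real.cos β) ^ 2 + (R * Real.sinh r * Real.sin β) ^ 2 := by
            linear_combination -(R * Real.sinh r) ^ 2 * t1
        _ = (R * Real.sinh r' * Real.cos β') ^ 2 + (R * Real.sinh r' * Real.sin β') ^ 2 := by
            rw [e1, e2]
        _ = (R * Real.sinh r') ^ 2 := by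
            linear_combination (R * Real.sinh r') ^ 2 * t2
    have hse : Real.sinh r = Real.sinh r' :=
      mul_left_cancel₀ hR.ne'
        ((sq_eq_sq₀ (mul_pos hR hs).le (mul_pos hR hs').le).1 hsq)
    have hrr : r = r' := Real.sinh_injective hse
    subst hrr
    have n1 : R * Real.sinh r ≠ 0 := (mul_pos hR hs).ne'
    have n2 : R * Real.cosh r ≠ 0 := (mul_pos hR (Real.cosh_pos r)).ne'
    have hαα : α = α' := angle_unique hα hα' (mul_left_cancel₀ n2 e0) (mul_left_cancel₀ n2 e3)
    have hββ : β = β' := angle_unique hβ hβ' (mul_left_cancel₀ n1 e1) (mul_left_cancel₀ n1 e2)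
    rw [hαα, hββ]
  · rintro X ⟨hX, hX0⟩
    have hX' : X 0 ^ 2 - X 1 ^ 2 - X 2 ^ 2 + X 3 ^ 2 = R ^ 2 := hX
    have hpos : 0 < X 1 ^ 2 + X 2 ^ 2 := by
      by_contra! h
      have a1 : X 1 = 0 := by nlinarith [sq_nonneg (X 1), sq_nonneg (X 2)]
      have a2 : X 2 = 0 := by nlinarith [sq_nonneg (X 1), sq_nonneg (X 2)]
      exact hX0 (by simp [z12, a1, a2, Complex.ext_iff])
    set q := Real.sqrt (X 1 ^ 2 + X 2 ^ 2) with hq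
    have hq0 : 0 < q := Real.sqrt_pos.2 hpos
    have hqs : q ^ 2 = X 1 ^ 2 + X 2 ^ 2 := Real.sq_sqrt hpos.le
    set r := Real.arsinh (q / R) with hr
    have hs : R * Real.sinh r = q := by
      rw [hr, Real.sinh_arsinh]
      field_simp
    have hr0 : 0 < r := Real.arsinh_pos_iff.2 (div_pos hq0 hR)
    obtain ⟨β, hβ, b1, b2⟩ := exists_angle hq0 hqs.symm
    obtain ⟨α, hα, a1, a2⟩ := exists_angle (mul_pos hR (Real.cosh_pos r))
      (x := X 0) (y := -X 3) (by
        have := Real.cosh_sq r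
        have h2 : (R * Real.sinh r) ^ 2 = X 1 ^ 2 + X 2 ^ 2 := by rw [hs, hqs]
        linear_combination hX' - R ^ 2 * this - h2)
    refine ⟨(α, r, β), ⟨hα, hr0, hβ⟩, ?_⟩
    ext i
    fin_cases i
    · simpa [chart] using a1
    · simpa [chart, hs] using b1
    · simpa [chart, hs] using b2
    · simp [chart, a2]

/-! ### The regularized Poisson operators -/

/-- The shifted degree operator `1 + ∑ xⁱ ∂/∂xⁱ`. -/
def degOp (f : HR → ℂ) : HR → ℂ := fun X => f X + fderiv ℝ f X X

/-- The integrand `(deg φ)(X) / (N(X - W) ± iε) · 1 / ‖X‖`. -/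
def poissonIntegrand (σ : ℤˣ) (φ : HR → ℂ) (W : HR) (ε : ℝ) (X : HR) : ℂ :=
  degOp φ X / ((N (X - W) : ℂ) + ((σ : ℤ) : ℂ) * Complex.I * ε) * ((‖X‖⁻¹ : ℝ) : ℂ)

/-- The integral `(2π²)⁻¹ ∫ (deg φ)(X) / (N(X - W) ± iε) dS / ‖X‖` over the hyperboloid. -/
def poissonIntegral (σ : ℤˣ) (R : ℝ) (φ : HR → ℂ) (W : HR) (ε : ℝ) : ℂ :=
  (2 * (Real.pi : ℂ) ^ 2)⁻¹ * ∫ X, poissonIntegrand σ φ W ε X ∂(surfaceMeasure R)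

/-- The integrals that define `(I^±_R φ)(W)` converge absolutely for each `ε > 0`, and they have a
limit as `ε → 0⁺`. -/
def PoissonConverges (σ : ℤˣ) (R : ℝ) (φ : HR → ℂ) (W : HR) : Prop :=
  (∀ ε : ℝ, 0 < ε → Integrable (poissonIntegrand σ φ W ε) (surfaceMeasure R)) ∧
    ∃ c : ℂ, Tendsto (poissonIntegral σ R φ W) (𝓝[>] 0) (𝓝 c)

/-- The regularized Poisson operators: `poissonOp 1 R` is `I^+_R`, `poissonOp (-1) R` is `I^-_R`. -/
def poissonOp (σ : ℤˣ) (R : ℝ) (φ : HR → ℂ) (W : HR) : ℂ :=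
  limUnder (𝓝[>] (0 : ℝ)) (poissonIntegral σ R φ W)

end

end SplitQuat

open SplitQuat

/-!
# The Poisson operators on the discrete series of the split quaternions

A point `X` of the split quaternions is the pair `a = z₁₁`, `b = z₁₂` of complex numbers, with
`N(X) = |a|² - |b|²`. On the hyperboloid `N(X) = R²` the measure `dS / ‖X‖` is `R²` times the image
of `d²a dβ`, `β = arg b`, on the unit hyperboloid (`surfaceMeasure_withDensity`), which is a copy
of the group `SU(1, 1)`, and the latter measure is invariant under left translations
(`lintegral_leftMul`). Writing `W = ρ w` with `N(w) = 1` and translating by `w`, one has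
`N(X - W) = R² + ρ² - 2 R ρ Re a` (`N_sub_smul`), so that the Poisson kernel becomes a function of
`x = Re a` alone (`poissonIntegral_eq`).

**Values.** Both generators are homogeneous, and on the hyperboloid `deg` takes both of them, up to
constants, to the same matrix coefficient `t`. If a left translate of `t` by `w` is averaged over
`β`, the result is `t(w)` times a diagonal coefficient of `a` (`integral_phase_matCoeff`). The
integral of a diagonal coefficient along the line `Re a = x` depends only on `L = 2 l`: two
consecutive ones differ by the derivative of a function that vanishes on `|a| = 1`
(`orbital_diagPoly`). The line integral vanishes for `1 ≤ |x|` and is `-2 sin((L + 1) θ) / (L + 1)`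
at `x = cos θ` (`orbital_cos`). This support is the reason why the two signs agree:
`R² + ρ² - 2 R ρ x` is nonnegative for `|x| ≤ 1`, so the limit `ε → 0` is a case of dominated
convergence and does not see the sign (`tendsto_integral_regKernel`). What remains is the integral
of `sin κθ sin θ / (1 + r² - 2 r cos θ)` with `r = min(R, ρ) / max(R, ρ)`, which is
`(π / 2) r^(κ - 1)` by a recursion in `κ` (`radialIntegral_eq`); the minimum and the maximum
account for the two cases of the formula. The antiholomorphic series follows by complex
conjugation.

**Closure.** For a general function the integrals are singular at `x = (R² + ρ²) / (2 R ρ)` in the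
limit. They are nevertheless bounded, uniformly in `ε`, by four of the seminorms
(`exists_norm_poissonIntegral_le`). To see this, integrate first over the circles `a = c e^{iα}`.
On a continuously differentiable function of `α` the kernel costs at most a factor of order
`|c - x₀|^(-1/2)`, with `x₀` the singular value of `x` (`norm_integral_mul_inv_sub_cos_le`), and
this is integrable in `c`. The derivative in `α` is the action of an element of the Lie algebra
(`hasDerivAt_degOp_translate`), hence controlled by a seminorm. The convergence for both signs, and
the equality of the limits, pass with this bound from the span of the matrix coefficients to its
closure (`poisson_discreteSeriesComponent`).
-/

namespace SplitQuat

open Complex ComplexConjugate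

/-! ### Split quaternions as pairs of complex numbers -/

/-- The split quaternion with `z₁₁ = a` and `z₁₂ = b`; on real points `z₂₁ = conj b` and
`z₂₂ = conj a`, so these two entries determine it. -/
noncomputable def ofPair (a b : ℂ) : HR := !₂[a.re, b.re, b.im, -a.im]

@[simp] theorem z11_ofPair (a b : ℂ) : z11 (ofPair a b) = a := by
  apply Complex.ext <;> simp [z11, ofPair]

@[simp] theorem z12_ofPair (a b : ℂ) : z12 (ofPair a b) = b := by
  apply Complex.ext <;> simp [z12, ofPair]

theorem z21_eq (X : HR) : z21 X = conj (z12 X) := by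
  apply Complex.ext <;> simp [z12, z21]

theorem z22_eq (X : HR) : z22 X = conj (z11 X) := by
  apply Complex.ext <;> simp [z11, z22]

@[simp] theorem ofPair_z (X : HR) : ofPair (z11 X) (z12 X) = X := by
  ext i; fin_cases i <;> simp [z11, z12, ofPair]

theorem HR_ext {X Y : HR} (h1 : z11 X = z11 Y) (h2 : z12 X = z12 Y) : X = Y := by
  rw [← ofPair_z X, ← ofPair_z Y, h1, h2]

theorem z11_mul (X Y : HR) : z11 (mul X Y) = z11 X * z11 Y + z12 X * conj (z12 Y) := by
  apply Complex.ext <;> simp [mul, z11, z12, z21, z22]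

theorem z12_mul (X Y : HR) : z12 (mul X Y) = z11 X * z12 Y + z12 X * conj (z11 Y) := by
  apply Complex.ext <;> simp [mul, z11, z12, z21, z22]

theorem mul_eq_ofPair (X Y : HR) :
    mul X Y = ofPair (z11 X * z11 Y + z12 X * conj (z12 Y))
      (z11 X * z12 Y + z12 X * conj (z11 Y)) :=
  HR_ext (by simp [z11_mul]) (by simp [z12_mul])

@[simp] theorem z11_smul (t : ℝ) (X : HR) : z11 (t • X) = t * z11 X := by
  apply Complex.ext <;> simp [z11]

@[simp] theorem z12_smul (t : ℝ) (X : HR) : z12 (t • X) = t * z12 X := by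
  apply Complex.ext <;> simp [z12]

@[simp] theorem z11_sub (X Y : HR) : z11 (X - Y) = z11 X - z11 Y := by
  apply Complex.ext <;> simp [z11]; ring

@[simp] theorem z12_sub (X Y : HR) : z12 (X - Y) = z12 X - z12 Y := by
  apply Complex.ext <;> simp [z12]

theorem mul_smul' (t : ℝ) (X Y : HR) : mul X (t • Y) = t • mul X Y := by
  apply HR_ext <;> simp [z11_mul, z12_mul] <;> ring

theorem mul_sub' (X Y Z : HR) : mul X (Y - Z) = mul X Y - mul X Z := by
  apply HR_ext <;> simp [z11_mul, z12_mul] <;> ring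

theorem N_eq (X : HR) : N X = normSq (z11 X) - normSq (z12 X) := by
  simp [N, z11, z12, normSq_apply]; ring

theorem N_eq_norm (X : HR) : N X = ‖z11 X‖ ^ 2 - ‖z12 X‖ ^ 2 := by
  rw [N_eq, normSq_eq_norm_sq, normSq_eq_norm_sq]

theorem norm_sq_eq (X : HR) : ‖X‖ ^ 2 = ‖z11 X‖ ^ 2 + ‖z12 X‖ ^ 2 := by
  rw [EuclideanSpace.norm_sq_eq, ← normSq_eq_norm_sq, ← normSq_eq_norm_sq]
  simp [Fin.sum_univ_four, z11, z12, normSq_apply]; ring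

theorem N_mul (X Y : HR) : N (mul X Y) = N X * N Y := by
  simp [N, mul, z11, z12, z21, z22]; ring

theorem N_smul (t : ℝ) (X : HR) : N (t • X) = t ^ 2 * N X := by
  simp [N]; ring

theorem continuous_z11 : Continuous z11 := by
  have : z11 = fun X : HR => (X 0 : ℂ) - X 3 * I := by
    ext X; apply Complex.ext <;> simp [z11]
  rw [this]; fun_prop

theorem continuous_z12 : Continuous z12 := by
  have : z12 = fun X : HR => (X 1 : ℂ) + X 2 * I := by
    ext X; apply Complex.ext <;> simp [z12]
  rw [this]; fun_prop

theorem continuous_N : Continuous N := by unfold N; fun_prop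

theorem isOpen_HRplus : IsOpen HRplus := isOpen_lt continuous_const continuous_N

theorem continuous_ofPair : Continuous fun p : ℂ × ℂ => ofPair p.1 p.2 := by
  refine (PiLp.continuous_toLp 2 _).comp (continuous_pi fun i => ?_)
  fin_cases i <;> simp <;> fun_prop

theorem continuous_mul_left (W : HR) : Continuous fun X => mul W X := by
  simp_rw [mul_eq_ofPair]
  have h1 := continuous_z11
  have h2 := continuous_z12
  exact continuous_ofPair.comp (by fun_prop :
    Continuous fun X => (z11 W * z11 X + z12 W * conj (z12 X), z11 W * z12 X + z12 W * conj (z11 X)))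

/-! ### Parametrization of the unit hyperboloid -/

/-- The point of the unit hyperboloid with `z₁₁ = a`, `‖a‖ ≥ 1`, and `arg z₁₂ = β`. -/
noncomputable def unitPt (p : ℂ × ℝ) : HR := ofPair p.1 (√(‖p.1‖ ^ 2 - 1) * exp (p.2 * I))

/-- The measure `d²a dβ` on the parameters `(a, β)` of `unitPt`. The circle `‖a‖ = 1`, on which the
parametrization degenerates, is a null set and is left out. -/
noncomputable def unitMeasure : Measure (ℂ × ℝ) :=
  (volume.restrict {a : ℂ | 1 < ‖a‖}).prod (volume.restrict (Set.Ico 0 (2 * Real.pi)))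

instance : SFinite unitMeasure := by unfold unitMeasure; infer_instance

theorem continuous_unitPt : Continuous unitPt := by
  unfold unitPt
  exact continuous_ofPair.comp (by fun_prop :
    Continuous fun p : ℂ × ℝ => (p.1, (√(‖p.1‖ ^ 2 - 1) : ℂ) * exp (p.2 * I)))

theorem norm_z12_unitPt {p : ℂ × ℝ} (hp : 1 < ‖p.1‖) :
    ‖z12 (unitPt p)‖ ^ 2 = ‖p.1‖ ^ 2 - 1 := by
  rw [unitPt, z12_ofPair, norm_mul, norm_exp_ofReal_mul_I, mul_one, norm_real, Real.norm_eq_abs,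
    sq_abs, Real.sq_sqrt]
  nlinarith

theorem N_unitPt {p : ℂ × ℝ} (hp : 1 < ‖p.1‖) : N (unitPt p) = 1 := by
  rw [N_eq_norm, norm_z12_unitPt hp, unitPt, z11_ofPair]; ring

theorem measurableSet_one_lt_norm : MeasurableSet {a : ℂ | 1 < ‖a‖} :=
  (isOpen_lt continuous_const continuous_norm).measurableSet

theorem ae_unitMeasure : ∀ᵐ p ∂unitMeasure, 1 < ‖p.1‖ := by
  have h := (ae_restrict_mem measurableSet_one_lt_norm (μ := (volume : Measure ℂ)))
  exact Measure.quasiMeasurePreserving_fst.ae h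

/-! ### The surface measure of the hyperboloid -/

/-- Polar coordinates on `ℂ` with the angle in `[0, 2π)`. -/
theorem lintegral_polar {f : ℂ → ℝ≥0∞} (hf : Measurable f) :
    ∫⁻ z, f z = ∫⁻ c in Set.Ioi (0 : ℝ), ENNReal.ofReal c *
      ∫⁻ θ in Set.Ico 0 (2 * Real.pi), f (c * exp (θ * I)) := by
  have h1 : ∫⁻ z, f z = ∫⁻ z, f (-z) := by
    simpa using (lintegral_neg_eq_self (μ := (volume : Measure ℂ)) f).symm
  rw [h1, ← Complex.lintegral_comp_polarCoord_symm, polarCoord_target, Measure.volume_eq_prod,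
    ← Measure.prod_restrict, lintegral_prod _ (by
      apply Measurable.aemeasurable
      simp only [Complex.polarCoord_symm_apply, smul_eq_mul]
      fun_prop)]
  refine setLIntegral_congr_fun measurableSet_Ioi fun c _ => ?_
  simp only [smul_eq_mul]
  rw [lintegral_const_mul _ (by simp only [Complex.polarCoord_symm_apply]; fun_prop)]
  congr 1
  have h2 : ∀ θ : ℝ, f (-(Complex.polarCoord.symm (c, θ))) =
      f (c * exp (((θ + Real.pi : ℝ) : ℂ) * I)) := by
    intro θ
    congr 1
    rw [Complex.polarCoord_symm_apply]
    push_cast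
    rw [add_mul, Complex.exp_add, exp_pi_mul_I, exp_mul_I]
    ring
  simp_rw [h2]
  have h3 := (measurePreserving_add_right (volume : Measure ℝ) Real.pi).setLIntegral_comp_preimage
    (s := Set.Ioo 0 (2 * Real.pi)) measurableSet_Ioo
    (f := fun θ : ℝ => f (c * exp (θ * I))) (by fun_prop)
  rw [Measure.restrict_congr_set Ico_ae_eq_Ioc, ← Measure.restrict_congr_set Ioo_ae_eq_Ioc, ← h3]
  congr 2
  ext x
  simp only [Set.mem_Ioo, Set.mem_preimage]
  constructor <;> rintro ⟨h, h'⟩ <;> constructor <;> linarith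

/-- The chart in complex coordinates: `α` is the phase of `z₁₁` and `β` that of `z₁₂`. -/
theorem chart_eq (R α r β : ℝ) : chart R α r β =
    ofPair (R * Real.cosh r * exp (α * I)) (R * Real.sinh r * exp (β * I)) := by
  ext i
  fin_cases i <;> simp [chart, ofPair, exp_ofReal_mul_I_re, exp_ofReal_mul_I_im,
    -ofReal_cosh, -ofReal_sinh]

theorem norm_chart {R α r β : ℝ} (hR : 0 < R) :
    ‖chart R α r β‖ = R * √(Real.cosh r ^ 2 + Real.sinh r ^ 2) := by
  rw [← sq_eq_sq₀ (norm_nonneg _) (by positivity), norm_sq_eq, chart_eq, z11_ofPair, z12_ofPair,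
    norm_mul, norm_mul (_ * _), norm_exp_ofReal_mul_I, norm_exp_ofReal_mul_I, ← ofReal_mul, ← ofReal_mul,
    norm_real, norm_real, mul_pow R, Real.sq_sqrt (by positivity)]
  simp only [Real.norm_eq_abs, mul_one, sq_abs]
  ring

theorem hasDerivAt_HR {f : ℝ → HR} {f' : HR} {x : ℝ}
    (h : ∀ i, HasDerivAt (fun t => f t i) (f' i) x) : HasDerivAt f f' x := by
  rw [hasDerivAt_iff_hasFDerivAt, ← hasFDerivWithinAt_univ, hasFDerivWithinAt_euclidean]
  intro i
  refine ((h i).hasFDerivAt.congr_fderiv ?_).hasFDerivWithinAt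
  ext
  simp

/-- The Gram determinant of the chart. Since `‖X‖ = R √(cosh² r + sinh² r)` (`norm_chart`), division
by `‖X‖` leaves the density `R² cosh r sinh r`. -/
theorem sqrt_gram_chartTangent {R : ℝ} (hR : 0 < R) (p : ℝ × ℝ × ℝ) (hp : 0 < p.2.1) :
    √(Matrix.gram ℝ (chartTangent R p)).det =
      R ^ 3 * (Real.cosh p.2.1 * Real.sinh p.2.1 *
        √(Real.cosh p.2.1 ^ 2 + Real.sinh p.2.1 ^ 2)) := by
  obtain ⟨α, r, β⟩ := p
  have hs : 0 < Real.sinh r := Real.sinh_pos_iff.2 hp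
  have hc := Real.cosh_pos r
  have d1 : deriv (fun α => chart R α r β) α =
      !₂[-(R * Real.cosh r * Real.sin α), 0, 0, -(R * Real.cosh r * Real.cos α)] := by
    apply HasDerivAt.deriv
    refine hasDerivAt_HR fun i => ?_
    fin_cases i
    · simpa [chart] using (Real.hasDerivAt_cos α).const_mul (R * Real.cosh r)
    · simpa [chart] using hasDerivAt_const α _
    · simpa [chart] using hasDerivAt_const α _
    · simpa [chart] using ((Real.hasDerivAt_sin α).const_mul (R * Real.cosh r)).fun_neg
  have d2 : deriv (fun r => chart R α r β) r =
      !₂[R * Real.sinh r * Real.cos α, R * Real.cosh r * Real.cos β,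
        R * Real.cosh r * Real.sin β, -(R * Real.sinh r * Real.sin α)] := by
    apply HasDerivAt.deriv
    refine hasDerivAt_HR fun i => ?_
    fin_cases i
    · simpa [chart] using ((Real.hasDerivAt_cosh r).const_mul R).mul_const (Real.cos α)
    · simpa [chart] using ((Real.hasDerivAt_sinh r).const_mul R).mul_const (Real.cos β)
    · simpa [chart] using ((Real.hasDerivAt_sinh r).const_mul R).mul_const (Real.sin β)
    · simpa [chart] using (((Real.hasDerivAt_cosh r).const_mul R).mul_const (Real.sin α)).fun_neg
  have d3 : deriv (fun β => chart R α r β) β =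
      !₂[0, -(R * Real.sinh r * Real.sin β), R * Real.sinh r * Real.cos β, 0] := by
    apply HasDerivAt.deriv
    refine hasDerivAt_HR fun i => ?_
    fin_cases i
    · simpa [chart] using hasDerivAt_const β _
    · simpa [chart] using (Real.hasDerivAt_cos β).const_mul (R * Real.sinh r)
    · simpa [chart] using (Real.hasDerivAt_sin β).const_mul (R * Real.sinh r)
    · simpa [chart] using hasDerivAt_const β _
  have hα := Real.sin_sq_add_cos_sq α
  have hβ := Real.sin_sq_add_cos_sq β
  have hdet : (Matrix.gram ℝ (chartTangent R (α, r, β))).det =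
      (R ^ 3 * (Real.cosh r * Real.sinh r)) ^ 2 * (Real.cosh r ^ 2 + Real.sinh r ^ 2) := by
    simp only [chartTangent, d1, d2, d3, Matrix.det_fin_three, Matrix.gram_apply]
    simp [PiLp.inner_apply, Fin.sum_univ_four, EuclideanSpace.norm_sq_eq]
    have e1 : Real.cos α ^ 2 = 1 - Real.sin α ^ 2 := by linarith
    have e2 : Real.cos β ^ 2 = 1 - Real.sin β ^ 2 := by linarith
    ring_nf
    rw [show Real.cos α ^ 4 = (Real.cos α ^ 2) ^ 2 by ring,
      show Real.cos β ^ 4 = (Real.cos β ^ 2) ^ 2 by ring, e1, e2]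
    ring
  simp only
  rw [hdet, Real.sqrt_mul (by positivity), Real.sqrt_sq (by positivity)]
  ring

/-- Polar coordinates on the exterior of the unit disc. -/
theorem setLIntegral_polar {f : ℂ → ℝ≥0∞} (hf : Measurable f) :
    ∫⁻ z in {z : ℂ | 1 < ‖z‖}, f z = ∫⁻ c in Set.Ioi (1 : ℝ), ENNReal.ofReal c *
      ∫⁻ θ in Set.Ico 0 (2 * Real.pi), f (c * exp (θ * I)) := by
  rw [← lintegral_indicator measurableSet_one_lt_norm,
    lintegral_polar (hf.indicator measurableSet_one_lt_norm)]
  have h1 : ∀ c ∈ Set.Ioi (0 : ℝ), (ENNReal.ofReal c * ∫⁻ θ in Set.Ico 0 (2 * Real.pi),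
      Set.indicator {z : ℂ | 1 < ‖z‖} f (c * exp (θ * I))) =
      Set.indicator (Set.Ioi 1) (fun c : ℝ => ENNReal.ofReal c *
        ∫⁻ θ in Set.Ico 0 (2 * Real.pi), f (c * exp (θ * I))) c := by
    intro c hc
    have hn : ∀ θ : ℝ, ‖(c : ℂ) * exp (θ * I)‖ = c := fun θ => by
      rw [norm_mul, norm_exp_ofReal_mul_I, norm_real, Real.norm_of_nonneg (le_of_lt hc), mul_one]
    by_cases h : 1 < c
    · rw [Set.indicator_of_mem (show c ∈ Set.Ioi 1 from h)]
      congr 1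
      refine lintegral_congr fun θ => ?_
      rw [Set.indicator_of_mem]
      simpa only [Set.mem_ofPred_eq, hn] using h
    · rw [Set.indicator_of_notMem (show c ∉ Set.Ioi 1 from h)]
      have : ∀ θ : ℝ, Set.indicator {z : ℂ | 1 < ‖z‖} f (c * exp (θ * I)) = 0 := fun θ => by
        rw [Set.indicator_of_notMem]
        simpa only [Set.mem_ofPred_eq, hn] using h
      simp [this]
  rw [setLIntegral_congr_fun measurableSet_Ioi h1, lintegral_indicator measurableSet_Ioi,
    Measure.restrict_restrict measurableSet_Ioi]
  congr 2
  ext x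
  simp only [Set.mem_inter_iff, Set.mem_Ioi]
  exact ⟨fun h => h.1, fun h => ⟨h, one_pos.trans h⟩⟩

theorem cosh_image_Ioi : Real.cosh '' Set.Ioi 0 = Set.Ioi 1 := by
  ext c
  constructor
  · rintro ⟨r, hr, rfl⟩
    exact Real.one_lt_cosh.2 (ne_of_gt hr)
  · intro hc
    exact ⟨Real.arcosh c, Real.arcosh_pos hc, Real.cosh_arcosh (le_of_lt hc)⟩

/-- The measure `d²a dβ` in the coordinates `a = cosh r · e^{iα}` of `chart`. -/
theorem lintegral_unitMeasure {u : ℂ × ℝ → ℝ≥0∞} (hu : Measurable u) :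
    ∫⁻ p, u p ∂unitMeasure = ∫⁻ p in chartDomain, ENNReal.ofReal |Real.sinh p.2.1| *
      (ENNReal.ofReal (Real.cosh p.2.1) * u (Real.cosh p.2.1 * exp (p.1 * I), p.2.2)) := by
  set h : ℂ → ℝ≥0∞ := fun a => ∫⁻ β in Set.Ico 0 (2 * Real.pi), u (a, β) with hh
  have hhm : Measurable h := Measurable.lintegral_prod_right' hu
  rw [unitMeasure, lintegral_prod _ hu.aemeasurable, setLIntegral_polar hhm, ← cosh_image_Ioi,
    lintegral_image_eq_lintegral_abs_deriv_mul measurableSet_Ioi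
      (fun x _ => (Real.hasDerivAt_cosh x).hasDerivWithinAt)
      (Real.cosh_strictMonoOn.injOn.mono Set.Ioi_subset_Ici_self),
    chartDomain, Measure.volume_eq_prod, ← Measure.prod_restrict, Measure.volume_eq_prod,
    ← Measure.prod_restrict, lintegral_prod _ (by fun_prop)]
  have e3 : ∀ α : ℝ, ∫⁻ q : ℝ × ℝ, (ENNReal.ofReal |Real.sinh q.1| *
      (ENNReal.ofReal (Real.cosh q.1) * u (Real.cosh q.1 * exp (α * I), q.2)))
        ∂((volume.restrict (Set.Ioi (0 : ℝ))).prod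
          (volume.restrict (Set.Ico (0 : ℝ) (2 * Real.pi)))) =
      ∫⁻ r in Set.Ioi (0 : ℝ), ENNReal.ofReal |Real.sinh r| * (ENNReal.ofReal (Real.cosh r) *
        h (Real.cosh r * exp (α * I))) := by
    intro α
    rw [lintegral_prod _ (by fun_prop)]
    refine lintegral_congr fun r => ?_
    simp only
    rw [lintegral_const_mul _ (by fun_prop), lintegral_const_mul _ (by fun_prop)]
  simp_rw [e3]
  rw [lintegral_lintegral_swap (by fun_prop)]
  refine lintegral_congr fun r => ?_
  rw [lintegral_const_mul _ (by fun_prop), lintegral_const_mul _ (by fun_prop)]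

/-- The measure `dS / ‖X‖` on the hyperboloid `N(X) = R²` is `R²` times the image of `d²a dβ`:
in the coordinates of `chart` both are `R² cosh r sinh r dα dr dβ`. -/
theorem surfaceMeasure_withDensity {R : ℝ} (hR : 0 < R) :
    (surfaceMeasure R).withDensity (fun X => ENNReal.ofReal ‖X‖⁻¹) =
      ENNReal.ofReal (R ^ 2) • Measure.map (fun p => R • unitPt p) unitMeasure := by
  refine Measure.ext_of_lintegral _ fun f hf => ?_
  have hm1 : Measurable fun p : ℝ × ℝ × ℝ => chart R p.1 p.2.1 p.2.2 := by
    simp_rw [chart_eq]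
    exact (continuous_ofPair.comp (by fun_prop : Continuous fun p : ℝ × ℝ × ℝ =>
      ((R * Real.cosh p.2.1 * exp (p.1 * I) : ℂ),
        (R * Real.sinh p.2.1 * exp (p.2.2 * I) : ℂ)))).measurable
  have hmd : MeasurableSet chartDomain :=
    measurableSet_Ico.prod (measurableSet_Ioi.prod measurableSet_Ico)
  have hd : (volume.restrict chartDomain).withDensity
      (fun p => ENNReal.ofReal (√(Matrix.gram ℝ (chartTangent R p)).det)) =
      (volume.restrict chartDomain).withDensity fun p => ENNReal.ofReal
        (R ^ 3 * (Real.cosh p.2.1 * Real.sinh p.2.1 *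
          √(Real.cosh p.2.1 ^ 2 + Real.sinh p.2.1 ^ 2))) := by
    refine withDensity_congr_ae ?_
    filter_upwards [ae_restrict_mem hmd] with p hp
    rw [sqrt_gram_chartTangent hR p hp.2.1]
  rw [surfaceMeasure, hd, lintegral_withDensity_eq_lintegral_mul _ (by fun_prop) hf,
    lintegral_map ((by fun_prop : Measurable fun X : HR => ENNReal.ofReal ‖X‖⁻¹).mul hf) hm1,
    lintegral_withDensity_eq_lintegral_mul _ (by fun_prop)
      (show Measurable fun p : ℝ × ℝ × ℝ => ((fun X : HR => ENNReal.ofReal ‖X‖⁻¹) * f)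
          (chart R p.1 p.2.1 p.2.2) from
        ((by fun_prop : Measurable fun X : HR => ENNReal.ofReal ‖X‖⁻¹).mul hf).comp hm1),
    lintegral_smul_measure, lintegral_map hf (by
      exact (continuous_unitPt.const_smul R).measurable)]
  have hmu : Measurable fun p => f (R • unitPt p) :=
    hf.comp (continuous_unitPt.const_smul R).measurable
  rw [lintegral_unitMeasure hmu, smul_eq_mul, ← lintegral_const_mul _ (by
    exact (by fun_prop : Measurable fun p : ℝ × ℝ × ℝ => ENNReal.ofReal |Real.sinh p.2.1|).mul
      ((by fun_prop : Measurable fun p : ℝ × ℝ × ℝ => ENNReal.ofReal (Real.cosh p.2.1)).mul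
        (hmu.comp (by fun_prop : Measurable fun p : ℝ × ℝ × ℝ =>
          ((Real.cosh p.2.1 * exp (p.1 * I) : ℂ), p.2.2)))))]
  refine setLIntegral_congr_fun hmd ?_
  rintro ⟨α, r, β⟩ ⟨-, hr, -⟩
  have hs : 0 < Real.sinh r := Real.sinh_pos_iff.2 hr
  have hc := Real.cosh_pos r
  have e2 : R • unitPt (Real.cosh r * exp (α * I), β) = chart R α r β := by
    rw [chart_eq]
    apply HR_ext
    · rw [z11_smul, unitPt, z11_ofPair, z11_ofPair]; ring
    · rw [z12_smul, unitPt, z12_ofPair, z12_ofPair, norm_mul, norm_exp_ofReal_mul_I, norm_real,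
        Real.norm_of_nonneg hc.le, mul_one, Real.cosh_sq, add_sub_cancel_right,
        Real.sqrt_sq hs.le]
      ring
  simp only [Pi.mul_apply]
  rw [e2, norm_chart hR, abs_of_pos hs, ← mul_assoc, ← ENNReal.ofReal_mul (by positivity),
    ← mul_assoc (ENNReal.ofReal (Real.sinh r)), ← ENNReal.ofReal_mul hs.le,
    ← mul_assoc (ENNReal.ofReal (R ^ 2)),
    ← ENNReal.ofReal_mul (by positivity)]
  congr 2
  have : 0 < √(Real.cosh r ^ 2 + Real.sinh r ^ 2) := by positivity
  field_simp

/-! ### Invariance under left multiplication -/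

/-- The linear map `(x, y) ↦ (c x + d y, d̄ x + c̄ y)`, which is left multiplication by `(c, d)` in
the coordinates `(z₁₁, conj z₁₂)`. -/
noncomputable def leftMulLin (w : HR) : (ℂ × ℂ) →ₗ[ℂ] ℂ × ℂ :=
  Matrix.toLin (Module.Basis.finTwoProd ℂ) (Module.Basis.finTwoProd ℂ)
    !![z11 w, z12 w; conj (z12 w), conj (z11 w)]

theorem measurePreserving_leftMulLin {w : HR} (hw : N w = 1) :
    MeasurePreserving (leftMulLin w) (volume : Measure (ℂ × ℂ)) volume := by
  have hdet : LinearMap.det ((leftMulLin w).restrictScalars ℝ) = 1 := by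
    rw [LinearMap.det_restrictScalars, leftMulLin, LinearMap.det_toLin, Matrix.det_fin_two_of,
      mul_conj, mul_conj, ← ofReal_sub, ← N_eq, hw]
    simp
  have : (volume : Measure (ℂ × ℂ)).IsAddHaarMeasure :=
    Measure.prod.instIsAddHaarMeasure (volume : Measure ℂ) (volume : Measure ℂ)
  have h := Measure.map_linearMap_addHaar_eq_smul_addHaar (volume : Measure (ℂ × ℂ))
    (f := (leftMulLin w).restrictScalars ℝ) (by rw [hdet]; exact one_ne_zero)
  rw [hdet] at h
  refine ⟨(LinearMap.continuous_of_finiteDimensional (leftMulLin w)).measurable, ?_⟩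
  simpa using h

theorem measurePreserving_conj : MeasurePreserving (conj : ℂ → ℂ) volume volume :=
  conjLIE.measurePreserving

/-- Left multiplication by an element of norm one preserves Lebesgue measure: in the coordinates
`(z₁₁, conj z₁₂)` it is complex linear with determinant `N w = 1`. -/
theorem measurePreserving_leftMul {w : HR} (hw : N w = 1) :
    MeasurePreserving (fun p : ℂ × ℂ => (z11 w * p.1 + z12 w * conj p.2,
      z11 w * p.2 + z12 w * conj p.1)) volume volume := by
  have h1 : MeasurePreserving (Prod.map id conj : ℂ × ℂ → ℂ × ℂ) volume volume :=
    (MeasurePreserving.id _).prod measurePreserving_conj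
  have h2 := h1.comp ((measurePreserving_leftMulLin hw).comp h1)
  convert h2 using 1
  ext p <;> simp [leftMulLin, Matrix.toLin_finTwoProd_apply]
  ring

theorem lintegral_real_smul {f : ℂ → ℝ≥0∞} {r : ℝ} (hr : 0 < r) :
    ∫⁻ z, f z = ENNReal.ofReal (r ^ 2) * ∫⁻ z, f (r • z) := by
  have h := Measure.map_addHaar_smul (volume : Measure ℂ) hr.ne'
  rw [Complex.finrank_real_complex] at h
  have e : MeasurableEmbedding fun z : ℂ => r • z :=
    (Homeomorph.smulOfNeZero r hr.ne').measurableEmbedding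
  rw [← e.lintegral_map, h, lintegral_smul_measure, smul_eq_mul, ← mul_assoc,
    ← ENNReal.ofReal_mul (by positivity), abs_of_pos (by positivity),
    mul_inv_cancel₀ (by positivity), ENNReal.ofReal_one, one_mul]

/-- The substitution `n = A - v²`, used with `A = ‖z₁₁‖²` and `v = ‖z₁₂‖`, so that `n` is the norm
`N`. -/
theorem ofReal_half_lintegral_Iio {g : ℝ → ℝ≥0∞} (hg : Measurable g) (A : ℝ) :
    ∫⁻ v in Set.Ioi (0 : ℝ), ENNReal.ofReal v * g (A - v ^ 2) =
      2⁻¹ * ∫⁻ n in Set.Iio A, g n := by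
  have him : (fun v : ℝ => A - v ^ 2) '' Set.Ioi 0 = Set.Iio A := by
    ext n
    constructor
    · rintro ⟨v, hv, rfl⟩
      have : 0 < v ^ 2 := pow_pos hv 2
      simpa using this
    · intro hn
      refine ⟨√(A - n), Real.sqrt_pos.2 (sub_pos.2 hn), ?_⟩
      simp only
      rw [Real.sq_sqrt (sub_pos.2 hn).le]; ring
  rw [← him, lintegral_image_eq_lintegral_abs_deriv_mul (f' := fun v => -(2 * v)) measurableSet_Ioi
    (fun x _ => by simpa using ((hasDerivAt_pow 2 x).const_sub A).hasDerivWithinAt)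
    (fun x hx y hy h => by
      have : x ^ 2 = y ^ 2 := by simpa using h
      exact (sq_eq_sq₀ (le_of_lt hx) (le_of_lt hy)).1 this),
    ← lintegral_const_mul _ (by fun_prop)]
  refine setLIntegral_congr_fun measurableSet_Ioi fun v hv => ?_
  have hv' : (0 : ℝ) < v := hv
  rw [abs_neg, abs_of_pos (by positivity), ENNReal.ofReal_mul (by positivity), ← mul_assoc,
    ← mul_assoc, ENNReal.ofReal_ofNat, ENNReal.inv_mul_cancel (by norm_num) (by norm_num), one_mul]

/-- Integration over the unit hyperboloid in terms of Lebesgue measure: the integral of a function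
of the direction `X / √N(X)` over the shell `1 < N(X) < 4`. -/
theorem lintegral_shell {F : HR → ℝ≥0∞} (hF : Measurable F) :
    ∫⁻ p : ℂ × ℂ, (Set.Ioo (1 : ℝ) 4).indicator 1 (‖p.1‖ ^ 2 - ‖p.2‖ ^ 2) *
        F ((√(‖p.1‖ ^ 2 - ‖p.2‖ ^ 2))⁻¹ • ofPair p.1 p.2) =
      2⁻¹ * (∫⁻ n in Set.Ioo (1 : ℝ) 4, ENNReal.ofReal n) * ∫⁻ p, F (unitPt p) ∂unitMeasure := by
  have hind : Measurable ((Set.Ioo (1 : ℝ) 4).indicator (1 : ℝ → ℝ≥0∞)) :=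
    measurable_one.indicator measurableSet_Ioo
  have hop : Measurable fun p : ℂ × ℂ => ofPair p.1 p.2 := continuous_ofPair.measurable
  set K : ℂ → ℝ → ℝ≥0∞ := fun a n => ∫⁻ β in Set.Ico 0 (2 * Real.pi),
    F ((√n)⁻¹ • ofPair a (√(‖a‖ ^ 2 - n) * exp (β * I))) with hK
  have hKm : Measurable fun q : ℂ × ℝ => K q.1 q.2 := by
    have : Measurable fun q : (ℂ × ℝ) × ℝ =>
        F ((√q.1.2)⁻¹ • ofPair q.1.1 (√(‖q.1.1‖ ^ 2 - q.1.2) * exp (q.2 * I))) := by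
      refine hF.comp (Measurable.smul
        (by fun_prop : Measurable fun q : (ℂ × ℝ) × ℝ => (√q.1.2)⁻¹) (hop.comp (g := fun p : ℂ × ℂ => ofPair p.1 p.2)
        (by fun_prop : Measurable fun q : (ℂ × ℝ) × ℝ =>
          (q.1.1, (√(‖q.1.1‖ ^ 2 - q.1.2) * exp (q.2 * I) : ℂ)))))
    exact this.lintegral_prod_right'
  have hinner : ∀ a : ℂ, ∫⁻ b, (Set.Ioo (1 : ℝ) 4).indicator 1 (‖a‖ ^ 2 - ‖b‖ ^ 2) *
        F ((√(‖a‖ ^ 2 - ‖b‖ ^ 2))⁻¹ • ofPair a b) =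
      2⁻¹ * ∫⁻ n in Set.Iio (‖a‖ ^ 2), (Set.Ioo (1 : ℝ) 4).indicator 1 n * K a n := by
    intro a
    rw [lintegral_polar (by
      have : Measurable fun b : ℂ => ofPair a b := hop.comp (g := fun p : ℂ × ℂ => ofPair p.1 p.2)
        (by fun_prop : Measurable fun b : ℂ => (a, b))
      fun_prop),
      ← ofReal_half_lintegral_Iio (by
        exact hind.mul (hKm.comp (by fun_prop : Measurable fun n : ℝ => (a, n))))]
    refine setLIntegral_congr_fun measurableSet_Ioi fun v hv => ?_
    have hv' : (0 : ℝ) < v := hv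
    congr 1
    have hn : ∀ θ : ℝ, ‖(v : ℂ) * exp (θ * I)‖ = v := fun θ => by
      rw [norm_mul, norm_exp_ofReal_mul_I, norm_real, Real.norm_of_nonneg hv'.le, mul_one]
    simp_rw [hn]
    rw [lintegral_const_mul _ (by
      have : Measurable fun θ : ℝ => ofPair a (v * exp (θ * I)) :=
        hop.comp (g := fun p : ℂ × ℂ => ofPair p.1 p.2)
          (by fun_prop : Measurable fun θ : ℝ => (a, (v * exp (θ * I) : ℂ)))
      fun_prop)]
    congr 1
    simp only [hK]
    rw [sub_sub_cancel, Real.sqrt_sq hv'.le]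
  rw [Measure.volume_eq_prod, lintegral_prod _ (by
    apply Measurable.aemeasurable
    refine Measurable.mul (hind.comp (by fun_prop)) (hF.comp (Measurable.smul
      (by fun_prop : Measurable fun p : ℂ × ℂ => (√(‖p.1‖ ^ 2 - ‖p.2‖ ^ 2))⁻¹) hop)))]
  simp only
  simp_rw [hinner]
  have hm2 : Measurable fun q : ℂ × ℝ => (Set.Iio (‖q.1‖ ^ 2)).indicator
      (fun n => (Set.Ioo (1 : ℝ) 4).indicator 1 n * K q.1 n) q.2 := by
    have : MeasurableSet {q : ℂ × ℝ | q.2 < ‖q.1‖ ^ 2} :=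
      measurableSet_lt (by fun_prop) (by fun_prop)
    have h2 : Measurable fun q : ℂ × ℝ => (Set.Ioo (1 : ℝ) 4).indicator 1 q.2 * K q.1 q.2 :=
      (hind.comp measurable_snd).mul hKm
    exact h2.indicator this
  simp_rw [← lintegral_indicator measurableSet_Iio]
  rw [lintegral_const_mul _ (Measurable.lintegral_prod_right' hm2), mul_assoc]
  congr 1
  rw [lintegral_lintegral_swap hm2.aemeasurable, ← lintegral_mul_const _ (by fun_prop),
    ← lintegral_indicator measurableSet_Ioo]
  refine lintegral_congr fun n => ?_
  by_cases hn : n ∈ Set.Ioo (1 : ℝ) 4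
  · have hn0 : 0 < n := one_pos.trans hn.1
    rw [Set.indicator_of_mem hn, lintegral_real_smul (Real.sqrt_pos.2 hn0), Real.sq_sqrt hn0.le,
      unitMeasure, lintegral_prod (fun p => F (unitPt p)) (hF.comp continuous_unitPt.measurable).aemeasurable,
      ← lintegral_indicator measurableSet_one_lt_norm]
    congr 1
    refine lintegral_congr fun a => ?_
    have hna : ‖√n • a‖ ^ 2 = n * ‖a‖ ^ 2 := by
      rw [norm_smul, mul_pow, Real.norm_of_nonneg (Real.sqrt_nonneg _), Real.sq_sqrt hn0.le]
    by_cases ha : 1 < ‖a‖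
    · have ha2 : 1 < ‖a‖ ^ 2 := by nlinarith
      rw [Set.indicator_of_mem (show a ∈ {a : ℂ | 1 < ‖a‖} from ha), Set.indicator_of_mem (by
        rw [hna]; exact (lt_mul_iff_one_lt_right hn0).2 ha2), Set.indicator_of_mem hn,
        Pi.one_apply, one_mul]
      simp only [hK]
      refine lintegral_congr fun β => ?_
      congr 1
      have hs : √n ≠ 0 := (Real.sqrt_pos.2 hn0).ne'
      have hs' : (√n : ℂ) ≠ 0 := by exact_mod_cast hs
      rw [hna, show n * ‖a‖ ^ 2 - n = n * (‖a‖ ^ 2 - 1) by ring, Real.sqrt_mul hn0.le]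
      apply HR_ext <;> simp [unitPt] <;> field_simp
    · rw [Set.indicator_of_notMem (show a ∉ {a : ℂ | 1 < ‖a‖} from ha), Set.indicator_of_notMem]
      rw [hna, Set.mem_Iio, not_lt]
      have : ‖a‖ ^ 2 ≤ 1 := by
        have := norm_nonneg a
        nlinarith
      nlinarith
  · rw [Set.indicator_of_notMem hn]
    refine lintegral_eq_zero_of_ae_eq_zero (ae_of_all _ fun a => ?_)
    simp [Set.indicator_apply (Set.Iio _), Set.indicator_of_notMem hn]

/-- The measure `d²a dβ` on the unit hyperboloid is invariant under left multiplication, because the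
integral over the shell `1 < N(X) < 4` of a function of the direction is. -/
theorem lintegral_leftMul {w : HR} (hw : N w = 1) {F : HR → ℝ≥0∞} (hF : Measurable F) :
    ∫⁻ p, F (mul w (unitPt p)) ∂unitMeasure = ∫⁻ p, F (unitPt p) ∂unitMeasure := by
  have h1 := lintegral_shell (hF.comp (continuous_mul_left w).measurable)
  have h2 := lintegral_shell hF
  have hm : Measurable fun p : ℂ × ℂ => (Set.Ioo (1 : ℝ) 4).indicator (1 : ℝ → ℝ≥0∞)
      (‖p.1‖ ^ 2 - ‖p.2‖ ^ 2) * F ((√(‖p.1‖ ^ 2 - ‖p.2‖ ^ 2))⁻¹ • ofPair p.1 p.2) := by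
    refine Measurable.mul ((measurable_one.indicator measurableSet_Ioo).comp (by fun_prop))
      (hF.comp (Measurable.smul
        (by fun_prop : Measurable fun p : ℂ × ℂ => (√(‖p.1‖ ^ 2 - ‖p.2‖ ^ 2))⁻¹)
        continuous_ofPair.measurable))
  have h3 := (measurePreserving_leftMul hw).lintegral_comp hm
  have e : ∀ p : ℂ × ℂ, ofPair (z11 w * p.1 + z12 w * conj p.2) (z11 w * p.2 + z12 w * conj p.1) =
      mul w (ofPair p.1 p.2) := fun p => by rw [mul_eq_ofPair]; simp
  have eN : ∀ p : ℂ × ℂ, ‖z11 w * p.1 + z12 w * conj p.2‖ ^ 2 -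
      ‖z11 w * p.2 + z12 w * conj p.1‖ ^ 2 = ‖p.1‖ ^ 2 - ‖p.2‖ ^ 2 := fun p => by
    have := N_mul w (ofPair p.1 p.2)
    rw [← e, hw, one_mul, N_eq_norm, N_eq_norm] at this
    simpa using this
  simp only [e, eN] at h3
  rw [h2] at h3
  simp only [Function.comp_apply, mul_smul'] at h1
  rw [h1] at h3
  refine (ENNReal.mul_right_inj ?_ ?_).1 h3
  -- the constant of `lintegral_shell` can be cancelled: it is neither zero nor infinite
  · refine mul_ne_zero (by norm_num) (ne_of_gt ?_)
    calc (0 : ℝ≥0∞) < ∫⁻ _ in Set.Ioo (1 : ℝ) 4, 1 := by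
          rw [setLIntegral_const, Real.volume_Ioo, one_mul]
          simp
      _ ≤ _ := setLIntegral_mono (by fun_prop) fun n hn => by
          rw [← ENNReal.ofReal_one]; exact ENNReal.ofReal_le_ofReal hn.1.le
  · refine ENNReal.mul_ne_top (by norm_num) (ne_of_lt ?_)
    calc ∫⁻ n in Set.Ioo (1 : ℝ) 4, ENNReal.ofReal n ≤ ∫⁻ _ in Set.Ioo (1 : ℝ) 4, ENNReal.ofReal 4 :=
          setLIntegral_mono (by fun_prop) fun n hn => ENNReal.ofReal_le_ofReal hn.2.le
      _ < ⊤ := by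
          rw [setLIntegral_const, Real.volume_Ioo]
          exact ENNReal.mul_lt_top ENNReal.ofReal_lt_top ENNReal.ofReal_lt_top

/-- The measure `dS / ‖X‖` in parameters centred at `w` instead of at the unit element. -/
theorem surfaceMeasure_withDensity_leftMul {R : ℝ} (hR : 0 < R) {w : HR} (hw : N w = 1) :
    (surfaceMeasure R).withDensity (fun X => ENNReal.ofReal ‖X‖⁻¹) =
      ENNReal.ofReal (R ^ 2) • Measure.map (fun p => R • mul w (unitPt p)) unitMeasure := by
  rw [surfaceMeasure_withDensity hR]
  congr 1
  refine Measure.ext_of_lintegral _ fun f hf => ?_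
  have hc : Continuous fun p => mul w (unitPt p) := (continuous_mul_left w).comp continuous_unitPt
  rw [lintegral_map hf (by exact (continuous_unitPt.const_smul R).measurable),
    lintegral_map hf (by exact (hc.const_smul R).measurable)]
  exact (lintegral_leftMul hw (F := fun X => f (R • X))
    (hf.comp (continuous_const_smul R).measurable)).symm

theorem N_smul_mul_unitPt {R : ℝ} {w : HR} (hw : N w = 1) {p : ℂ × ℝ} (hp : 1 < ‖p.1‖) :
    N (R • mul w (unitPt p)) = R ^ 2 := by
  rw [N_smul, N_mul, hw, N_unitPt hp]; ring

/-- Functions that are continuous on `HRplus` only are measurable for the image measure, which is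
concentrated there. -/
theorem aestronglyMeasurable_map {R : ℝ} (hR : 0 < R) {w : HR} (hw : N w = 1) {F : HR → ℂ}
    (hF : ContinuousOn F HRplus) :
    AEStronglyMeasurable F (Measure.map (fun p => R • mul w (unitPt p)) unitMeasure) := by
  have hc : Continuous fun p => R • mul w (unitPt p) :=
    ((continuous_mul_left w).comp continuous_unitPt).const_smul R
  have h : ∀ᵐ X ∂(Measure.map (fun p => R • mul w (unitPt p)) unitMeasure), X ∈ HRplus := by
    refine (ae_map_iff hc.aemeasurable isOpen_HRplus.measurableSet).2 ?_
    filter_upwards [ae_unitMeasure] with p hp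
    rw [N_smul_mul_unitPt hw hp]
    positivity
  rw [← Measure.restrict_eq_self_of_ae_mem h]
  exact hF.aestronglyMeasurable isOpen_HRplus.measurableSet

/-- Integrability against `dS / ‖X‖` may be tested in the parameters centred at `w`. -/
theorem integrable_surface_iff {R : ℝ} (hR : 0 < R) {w : HR} (hw : N w = 1) {F : HR → ℂ}
    (hF : ContinuousOn F HRplus) :
    Integrable (fun X => F X * ((‖X‖⁻¹ : ℝ) : ℂ)) (surfaceMeasure R) ↔
      Integrable (fun p => F (R • mul w (unitPt p))) unitMeasure := by
  have hc : Continuous fun p => R • mul w (unitPt p) :=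
    ((continuous_mul_left w).comp continuous_unitPt).const_smul R
  have h1 := integrable_withDensity_iff_integrable_smul' (μ := surfaceMeasure R)
    (f := fun X : HR => ENNReal.ofReal ‖X‖⁻¹) (by fun_prop) (ae_of_all _ fun _ => by simp) (g := F)
  rw [surfaceMeasure_withDensity_leftMul hR hw, integrable_smul_measure (by simpa using hR.ne')
    ENNReal.ofReal_ne_top,
    integrable_map_measure (aestronglyMeasurable_map hR hw hF) hc.aemeasurable] at h1
  rw [show (fun p => F (R • mul w (unitPt p))) = F ∘ fun p => R • mul w (unitPt p) from rfl, h1]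
  refine integrable_congr (ae_of_all _ fun X => ?_)
  simp only
  rw [ENNReal.toReal_ofReal (by positivity), real_smul, mul_comm]

/-- Integration against `dS / ‖X‖` in the parameters centred at `w`. -/
theorem integral_surface_eq {R : ℝ} (hR : 0 < R) {w : HR} (hw : N w = 1) {F : HR → ℂ}
    (hF : ContinuousOn F HRplus) :
    ∫ X, F X * ((‖X‖⁻¹ : ℝ) : ℂ) ∂(surfaceMeasure R) =
      R ^ 2 * ∫ p, F (R • mul w (unitPt p)) ∂unitMeasure := by
  have hc : Continuous fun p => R • mul w (unitPt p) :=
    ((continuous_mul_left w).comp continuous_unitPt).const_smul R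
  have h1 := integral_withDensity_eq_integral_toReal_smul (μ := surfaceMeasure R)
    (f := fun X : HR => ENNReal.ofReal ‖X‖⁻¹) (by fun_prop) (ae_of_all _ fun _ => by simp) F
  rw [surfaceMeasure_withDensity_leftMul hR hw, integral_smul_measure,
    integral_map hc.aemeasurable (aestronglyMeasurable_map hR hw hF),
    ENNReal.toReal_ofReal (by positivity), real_smul] at h1
  rw [ofReal_pow] at h1
  rw [h1]
  refine integral_congr_ae (ae_of_all _ fun X => ?_)
  simp only
  rw [ENNReal.toReal_ofReal (by positivity), real_smul, mul_comm]

theorem ae_surfaceMeasure {R : ℝ} (hR : 0 < R) : ∀ᵐ X ∂(surfaceMeasure R), N X = R ^ 2 := by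
  have hm : Measurable fun p : ℝ × ℝ × ℝ => chart R p.1 p.2.1 p.2.2 := by
    simp_rw [chart_eq]
    exact (continuous_ofPair.comp (by fun_prop : Continuous fun p : ℝ × ℝ × ℝ =>
      ((R * Real.cosh p.2.1 * exp (p.1 * I) : ℂ),
        (R * Real.sinh p.2.1 * exp (p.2.2 * I) : ℂ)))).measurable
  rw [surfaceMeasure, ae_map_iff hm.aemeasurable
    (measurableSet_eq_fun continuous_N.measurable measurable_const)]
  refine (withDensity_absolutelyContinuous _ _).ae_le ?_
  have hmd : MeasurableSet chartDomain :=
    measurableSet_Ico.prod (measurableSet_Ioi.prod measurableSet_Ico)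
  filter_upwards [ae_restrict_mem hmd] with p hp
  exact ((chart_bijOn R hR).mapsTo hp).1

/-! ### Fourier coefficients of powers -/

/-- The generalized binomial coefficient `p (p - 1) ⋯ (p - i + 1) / i!`. -/
noncomputable def binom (p : ℤ) : ℕ → ℂ
  | 0 => 1
  | i + 1 => p / (i + 1) * binom (p - 1) i

theorem binom_succ_right (p : ℤ) (i : ℕ) : (i + 1) * binom p (i + 1) = (p - i) * binom p i := by
  induction i generalizing p with
  | zero => simp [binom]
  | succ i ih =>
    have h := ih (p - 1)
    have h1 : ((i : ℂ) + 1) ≠ 0 := by exact_mod_cast Nat.succ_ne_zero i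
    have h2 : ((i : ℂ) + 1 + 1) ≠ 0 := by exact_mod_cast Nat.succ_ne_zero (i + 1)
    rw [show binom p (i + 1 + 1) = p / ((i + 1 : ℕ) + 1) * binom (p - 1) (i + 1) from rfl,
      show binom p (i + 1) = p / (i + 1) * binom (p - 1) i from rfl]
    push_cast at h ⊢
    field_simp
    linear_combination (p : ℂ) * h

theorem continuous_expI : Continuous fun θ : ℝ => exp (θ * I) := by fun_prop

theorem hasDerivAt_expI (θ : ℝ) : HasDerivAt (fun θ : ℝ => exp (θ * I)) (I * exp (θ * I)) θ := by
  have h := ((hasDerivAt_id θ).ofReal_comp.mul_const I).cexp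
  simpa [mul_comm] using h

theorem add_mul_ne_zero {a b z : ℂ} (h : ‖b‖ < ‖a‖) (hz : ‖z‖ ≤ 1) : a + b * z ≠ 0 := by
  intro h0
  have : ‖a‖ = ‖b‖ * ‖z‖ := by rw [← norm_mul, ← norm_neg (b * z), eq_neg_of_add_eq_zero_left h0]
  nlinarith [norm_nonneg b]

theorem differentiableOn_add_mul_zpow {a b : ℂ} (h : ‖b‖ < ‖a‖) (p : ℤ) :
    DifferentiableOn ℂ (fun z => (a + b * z) ^ p) (Metric.closedBall 0 1) := by
  intro z hz
  have hz' : ‖z‖ ≤ 1 := by simpa using hz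
  exact ((differentiableAt_zpow.2 (Or.inl (add_mul_ne_zero h hz'))).comp z
    (by fun_prop : DifferentiableAt ℂ (fun z => a + b * z) z)).differentiableWithinAt

/-- The Fourier coefficients of `θ ↦ (a + b e^{iθ})^p` of the wrong sign vanish, by the theorem of
Cauchy. -/
theorem integral_expI_pow_succ_mul {a b : ℂ} (h : ‖b‖ < ‖a‖) (p : ℤ) (j : ℕ) :
    ∫ θ in (0 : ℝ)..2 * Real.pi, exp (θ * I) ^ (j + 1) * (a + b * exp (θ * I)) ^ p = 0 := by
  have hd : DifferentiableOn ℂ (fun z => z ^ j * (a + b * z) ^ p) (Metric.closedBall 0 1) :=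
    (differentiableOn_pow j).mul (differentiableOn_add_mul_zpow h p)
  have h1 := (hd.diffContOnCl_ball (U := Metric.closedBall 0 1)
    subset_rfl).circleIntegral_eq_zero zero_le_one
  simp only [circleIntegral, deriv_circleMap, circleMap_zero, ofReal_one, one_mul,
    smul_eq_mul] at h1
  have h2 : ∀ θ : ℝ, exp (θ * I) * I * (exp (θ * I) ^ j * (a + b * exp (θ * I)) ^ p) =
      I * (exp (θ * I) ^ (j + 1) * (a + b * exp (θ * I)) ^ p) := fun θ => by ring
  simp_rw [h2] at h1
  rw [intervalIntegral.integral_const_mul] at h1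
  simpa using h1

theorem integral_add_mul_expI {a b : ℂ} (h : ‖b‖ < ‖a‖) (p : ℤ) :
    ∫ θ in (0 : ℝ)..2 * Real.pi, (a + b * exp (θ * I)) ^ p = 2 * Real.pi * a ^ p := by
  have h1 := (differentiableOn_add_mul_zpow h p).circleIntegral_sub_inv_smul
    (w := 0) (by simp)
  simp only [circleIntegral, deriv_circleMap, circleMap_zero, ofReal_one, one_mul,
    smul_eq_mul, sub_zero, mul_zero, add_zero] at h1
  have h2 : ∀ θ : ℝ, exp (θ * I) * I * ((exp (θ * I))⁻¹ * (a + b * exp (θ * I)) ^ p) =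
      I * (a + b * exp (θ * I)) ^ p := fun θ => by
    have := exp_ne_zero (θ * I)
    field_simp
  simp_rw [h2] at h1
  rw [intervalIntegral.integral_const_mul] at h1
  have : (I : ℂ) ≠ 0 := I_ne_zero
  apply mul_left_cancel₀ this
  rw [h1]; ring

theorem continuous_add_mul_zpow {a b : ℂ} (h : ‖b‖ < ‖a‖) (p : ℤ) :
    Continuous fun θ : ℝ => (a + b * exp (θ * I)) ^ p :=
  (continuous_const.add (continuous_const.mul continuous_expI)).zpow₀ p fun θ =>
    Or.inl (add_mul_ne_zero h (norm_exp_ofReal_mul_I θ).le)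

/-- The Fourier coefficients of `θ ↦ (a + b e^{iθ})^p`. -/
theorem integral_expI_inv_pow_mul {a b : ℂ} (h : ‖b‖ < ‖a‖) (p : ℤ) (i : ℕ) :
    ∫ θ in (0 : ℝ)..2 * Real.pi, (exp (θ * I) ^ i)⁻¹ * (a + b * exp (θ * I)) ^ p =
      2 * Real.pi * (binom p i * a ^ (p - i) * b ^ i) := by
  induction i generalizing p with
  | zero => simpa [binom] using integral_add_mul_expI h p
  | succ i ih =>
    have hne : ∀ θ : ℝ, exp (θ * I) ≠ 0 := fun θ => exp_ne_zero _
    -- integrate the derivative of `e^{-i(i+1)θ} (a + b e^{iθ})^p` over a period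
    have hder : ∀ θ : ℝ, HasDerivAt
        (fun θ : ℝ => (exp (θ * I) ^ (i + 1))⁻¹ * (a + b * exp (θ * I)) ^ p)
        (-((i + 1) * I) * ((exp (θ * I) ^ (i + 1))⁻¹ * (a + b * exp (θ * I)) ^ p) +
          p * b * I * ((exp (θ * I) ^ i)⁻¹ * (a + b * exp (θ * I)) ^ (p - 1))) θ := by
      intro θ
      have h1 := ((hasDerivAt_expI θ).fun_pow (i + 1)).fun_inv (pow_ne_zero _ (hne θ))
      have h2 := (hasDerivAt_zpow p _ (Or.inl (add_mul_ne_zero h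
        (norm_exp_ofReal_mul_I θ).le))).comp θ (((hasDerivAt_expI θ).const_mul b).const_add a)
      refine (h1.mul h2).congr_deriv ?_
      have := hne θ
      simp only [Function.comp, Nat.add_sub_cancel]
      push_cast
      field_simp
      ring
    have hc1 : Continuous fun θ : ℝ => (exp (θ * I) ^ (i + 1))⁻¹ * (a + b * exp (θ * I)) ^ p :=
      ((continuous_expI.pow _).inv₀ fun θ => pow_ne_zero _ (hne θ)).mul
        (continuous_add_mul_zpow h p)
    have hc2 : Continuous fun θ : ℝ => (exp (θ * I) ^ i)⁻¹ * (a + b * exp (θ * I)) ^ (p - 1) :=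
      ((continuous_expI.pow _).inv₀ fun θ => pow_ne_zero _ (hne θ)).mul
        (continuous_add_mul_zpow h (p - 1))
    have hint := intervalIntegral.integral_eq_sub_of_hasDerivAt (a := 0) (b := 2 * Real.pi)
      (fun θ _ => hder θ) (by
        apply Continuous.intervalIntegrable
        exact (continuous_const.mul hc1).add (continuous_const.mul hc2))
    have hper : exp (((2 * Real.pi : ℝ) : ℂ) * I) = 1 := by
      push_cast; exact exp_two_pi_mul_I
    rw [intervalIntegral.integral_add ((hc1.intervalIntegrable _ _).const_mul _)
      ((hc2.intervalIntegrable _ _).const_mul _),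
      intervalIntegral.integral_const_mul, intervalIntegral.integral_const_mul, ih, hper] at hint
    simp only [ofReal_zero, zero_mul, exp_zero, sub_self] at hint
    have hi : ((i : ℂ) + 1) ≠ 0 := by exact_mod_cast Nat.succ_ne_zero i
    have hI : (I : ℂ) ≠ 0 := I_ne_zero
    apply mul_left_cancel₀ (mul_ne_zero hi hI)
    rw [show binom p (i + 1) = p / (i + 1) * binom (p - 1) i from rfl,
      show p - ((i + 1 : ℕ) : ℤ) = p - 1 - i by push_cast; ring, pow_succ]
    have e : ((i : ℂ) + 1) * (p / (i + 1) * binom (p - 1) i) = p * binom (p - 1) i := by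
      field_simp
    linear_combination -hint - (I * 2 * Real.pi * a ^ (p - 1 - i) * b ^ i * b) * e

/-- The Fourier coefficients of `θ ↦ (a + b e^{-iθ})^p`. -/
theorem integral_expI_pow_mul {a b : ℂ} (h : ‖b‖ < ‖a‖) (p : ℤ) (i : ℕ) :
    ∫ θ in (0 : ℝ)..2 * Real.pi, exp (θ * I) ^ i * (a + b * (exp (θ * I))⁻¹) ^ p =
      2 * Real.pi * (binom p i * a ^ (p - i) * b ^ i) := by
  rw [← integral_expI_inv_pow_mul h p i]
  have := intervalIntegral.integral_comp_sub_left (a := 0) (b := 2 * Real.pi)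
    (fun θ : ℝ => (exp (θ * I) ^ i)⁻¹ * (a + b * exp (θ * I)) ^ p) (2 * Real.pi)
  rw [sub_self, sub_zero] at this
  rw [← this]
  refine intervalIntegral.integral_congr fun θ _ => ?_
  have : exp (((2 * Real.pi - θ : ℝ) : ℂ) * I) = (exp (θ * I))⁻¹ := by
    push_cast; rw [sub_mul, exp_sub, exp_two_pi_mul_I, one_div]
  simp only [this, inv_pow, inv_inv]

theorem integral_expI_inv_pow_succ_mul {a b : ℂ} (h : ‖b‖ < ‖a‖) (p : ℤ) (j : ℕ) :
    ∫ θ in (0 : ℝ)..2 * Real.pi, (exp (θ * I) ^ (j + 1))⁻¹ * (a + b * (exp (θ * I))⁻¹) ^ p = 0 := by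
  rw [← integral_expI_pow_succ_mul h p j]
  have := intervalIntegral.integral_comp_sub_left (a := 0) (b := 2 * Real.pi)
    (fun θ : ℝ => exp (θ * I) ^ (j + 1) * (a + b * exp (θ * I)) ^ p) (2 * Real.pi)
  rw [sub_self, sub_zero] at this
  rw [← this]
  refine intervalIntegral.integral_congr fun θ _ => ?_
  have : exp (((2 * Real.pi - θ : ℝ) : ℂ) * I) = (exp (θ * I))⁻¹ := by
    push_cast; rw [sub_mul, exp_sub, exp_two_pi_mul_I, one_div]
  simp only [this, inv_pow]

/-! ### Diagonal matrix coefficients and averages over the phase of `z₁₂` -/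

/-- The function `(q!)⁻¹ ∂^q/∂a^q (a^p (a b - 1)^q)`, expanded as a Laurent polynomial in `a` and a
polynomial in `b`. At `b = conj a` it is a diagonal matrix coefficient at a point of the unit
hyperboloid with `z₁₁ = a`; here `p = l - m` and `q = l + m`. The exponent `q - j` is a subtraction
of natural numbers in the range `j ≤ q`. -/
noncomputable def diagPoly (p : ℤ) (q : ℕ) (a b : ℂ) : ℂ :=
  ∑ j ∈ Finset.range (q + 1),
    (-1) ^ j * (q.choose j : ℂ) * binom (p + q - j) q * a ^ (p - j) * b ^ (q - j)

/-- The function `(q!)⁻¹ ∂^q/∂a^q (a^(p-1) (a b - 1)^(q+1))`, which is, up to a constant, a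
primitive along the lines `Re a = x` of the difference of two diagonal matrix coefficients. -/
noncomputable def diagPrim (p : ℤ) (q : ℕ) (a b : ℂ) : ℂ :=
  ∑ j ∈ Finset.range (q + 2),
    (-1) ^ j * ((q + 1).choose j : ℂ) * binom (p + q - j) q * a ^ (p - j) * b ^ (q + 1 - j)

/-- The `q`-th derivative of `a^(p-1) (a b - 1)^(q+1)` still vanishes where `a b = 1`. The
derivative is represented as a Fourier coefficient of that function on a circle about `a`. -/
theorem diagPrim_eq_zero {a b : ℂ} (hab : a * b = 1) (p : ℤ) (q : ℕ) : diagPrim p q a b = 0 := by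
  have ha : a ≠ 0 := left_ne_zero_of_mul_eq_one hab
  have hb : b ≠ 0 := right_ne_zero_of_mul_eq_one hab
  have hc : ‖a / 2‖ < ‖a‖ := by
    rw [norm_div, Complex.norm_ofNat]
    linarith [norm_pos_iff.2 ha]
  have hc0 : a / 2 ≠ 0 := by simpa using ha
  have hz : ∀ θ : ℝ, a + a / 2 * (exp (θ * I))⁻¹ ≠ 0 := fun θ =>
    add_mul_ne_zero hc (by rw [norm_inv, norm_exp_ofReal_mul_I, inv_one])
  have hne : ∀ θ : ℝ, exp (θ * I) ≠ 0 := fun θ => exp_ne_zero _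
  have hcont : ∀ (n : ℤ), Continuous fun θ : ℝ =>
      exp (θ * I) ^ q * (a + a / 2 * (exp (θ * I))⁻¹) ^ n := fun n =>
    (continuous_expI.pow _).mul ((continuous_const.add (continuous_const.mul
      (continuous_expI.inv₀ hne))).zpow₀ n fun θ => Or.inl (hz θ))
  have h0 := integral_expI_inv_pow_succ_mul hc (p - 1) 0
  -- since `a b = 1`, `b ζ - 1` is a multiple of `e^{-iθ}` for `ζ = a + (a / 2) e^{-iθ}`
  have h1 : ∀ θ : ℝ, (exp (θ * I) ^ (0 + 1))⁻¹ * (a + a / 2 * (exp (θ * I))⁻¹) ^ (p - 1) =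
      (b * (a / 2)) ^ (-(q + 1 : ℤ)) * ∑ j ∈ Finset.range (q + 2),
        (-1) ^ j * ((q + 1).choose j : ℂ) * b ^ (q + 1 - j) *
          (exp (θ * I) ^ q * (a + a / 2 * (exp (θ * I))⁻¹) ^ (p + q - j)) := by
    intro θ
    set E := exp (θ * I) with hE
    set ζ := a + a / 2 * E⁻¹ with hζ
    have hE0 : E ≠ 0 := hne θ
    have hζ0 : ζ ≠ 0 := hz θ
    have e1 : (b * (a / 2) * E⁻¹) ^ (q + 1) = ∑ j ∈ Finset.range (q + 2),
        (-1) ^ j * ((q + 1).choose j : ℂ) * b ^ (q + 1 - j) * ζ ^ (q + 1 - j) := by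
      have : b * (a / 2) * E⁻¹ = -1 + b * ζ := by
        rw [hζ]; linear_combination -hab
      rw [this, add_pow]
      refine Finset.sum_congr rfl fun j _ => ?_
      rw [mul_pow]; ring
    have e2 : ∑ j ∈ Finset.range (q + 2), (-1) ^ j * ((q + 1).choose j : ℂ) * b ^ (q + 1 - j) *
        (E ^ q * ζ ^ (p + q - j)) = E ^ q * ζ ^ (p - 1) * (b * (a / 2) * E⁻¹) ^ (q + 1) := by
      rw [e1, Finset.mul_sum]
      refine Finset.sum_congr rfl fun j hj => ?_
      have hj' : j ≤ q + 1 := by have := Finset.mem_range.1 hj; omega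
      have : ζ ^ (p + q - j : ℤ) = ζ ^ (p - 1) * ζ ^ (q + 1 - j) := by
        rw [← zpow_natCast, ← zpow_add₀ hζ0]
        congr 1
        push_cast [hj']
        ring
      rw [this]; ring
    have hbc : b * (a / 2) ≠ 0 := mul_ne_zero hb hc0
    rw [e2, mul_pow, inv_pow, zpow_neg, show ((q : ℤ) + 1) = ((q + 1 : ℕ) : ℤ) by push_cast; rfl,
      zpow_natCast]
    field_simp
    ring
  simp_rw [h1] at h0
  rw [intervalIntegral.integral_const_mul, intervalIntegral.integral_finsetSum (fun j _ =>
    ((hcont _).intervalIntegrable _ _).const_mul _)] at h0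
  simp_rw [intervalIntegral.integral_const_mul, integral_expI_pow_mul hc] at h0
  have h2 : ∑ j ∈ Finset.range (q + 2), (-1) ^ j * ((q + 1).choose j : ℂ) * b ^ (q + 1 - j) *
      (2 * Real.pi * (binom (p + q - j) q * a ^ (p + q - j - q : ℤ) * (a / 2) ^ q)) =
      2 * Real.pi * (a / 2) ^ q * diagPrim p q a b := by
    rw [diagPrim, Finset.mul_sum]
    refine Finset.sum_congr rfl fun j _ => ?_
    rw [show p + q - j - q = p - j by ring]
    ring
  rw [h2] at h0
  have hpi : (Real.pi : ℂ) ≠ 0 := by exact_mod_cast Real.pi_ne_zero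
  have hbc : (b * (a / 2)) ^ (-(q + 1 : ℤ)) ≠ 0 := zpow_ne_zero _ (mul_ne_zero hb hc0)
  exact (mul_eq_zero.1 ((mul_eq_zero.1 h0).resolve_left hbc)).resolve_left
    (mul_ne_zero (mul_ne_zero two_ne_zero hpi) (pow_ne_zero _ hc0))

/-- Averaging over the phase of `z₁₂`. The pair `(s, t)` stands for the row vector `(e^{iθ}, 1) w`,
on which the point of the unit hyperboloid acts from the right; its two entries have the same norm.
-/
theorem integral_phase {a s t : ℂ} (ha : 1 < ‖a‖) (hst : ‖s‖ = ‖t‖) (hs : s ≠ 0) (p : ℤ) (q : ℕ) :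
    ∫ β in (0 : ℝ)..2 * Real.pi,
      (s * a + t * (√(‖a‖ ^ 2 - 1) * (exp (β * I))⁻¹)) ^ p *
        (s * (√(‖a‖ ^ 2 - 1) * exp (β * I)) + t * conj a) ^ q =
      2 * Real.pi * (s ^ p * t ^ q * diagPoly p q a (conj a)) := by
  set u : ℝ := √(‖a‖ ^ 2 - 1) with hu
  have hpos : 0 < ‖a‖ ^ 2 - 1 := by nlinarith
  have hu0 : 0 < u := Real.sqrt_pos.2 hpos
  have hu1 : u < ‖a‖ := by
    rw [hu]
    exact (Real.sqrt_lt' (by linarith)).2 (by linarith)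
  have hu2 : (u : ℂ) ^ 2 = a * conj a - 1 := by
    rw [mul_conj, normSq_eq_norm_sq, ← ofReal_pow, Real.sq_sqrt hpos.le]; push_cast; rfl
  have huc : (u : ℂ) ≠ 0 := by exact_mod_cast hu0.ne'
  have ha0 : a ≠ 0 := norm_pos_iff.1 (one_pos.trans ha)
  have hlt : ‖t * u‖ < ‖s * a‖ := by
    rw [norm_mul, norm_mul, norm_real, Real.norm_of_nonneg hu0.le, ← hst]
    exact mul_lt_mul_of_pos_left hu1 (norm_pos_iff.2 hs)
  have hne : ∀ θ : ℝ, exp (θ * I) ≠ 0 := fun θ => exp_ne_zero _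
  have hz : ∀ θ : ℝ, s * a + t * u * (exp (θ * I))⁻¹ ≠ 0 := fun θ =>
    add_mul_ne_zero hlt (by rw [norm_inv, norm_exp_ofReal_mul_I, inv_one])
  have hcont : ∀ (n : ℤ), Continuous fun θ : ℝ =>
      exp (θ * I) ^ q * (s * a + t * u * (exp (θ * I))⁻¹) ^ n := fun n =>
    (continuous_expI.pow _).mul ((continuous_const.add (continuous_const.mul
      (continuous_expI.inv₀ hne))).zpow₀ n fun θ => Or.inl (hz θ))
  -- with `A = s a + t u e^{-iβ}`, the second factor is `(ā A - s) e^{iβ} / u`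
  have h1 : ∀ β : ℝ, (s * a + t * (u * (exp (β * I))⁻¹)) ^ p *
        (s * (u * exp (β * I)) + t * conj a) ^ q =
      ∑ j ∈ Finset.range (q + 1), (-s) ^ j * conj a ^ (q - j) * (q.choose j : ℂ) * ((u : ℂ) ^ q)⁻¹ *
        (exp (β * I) ^ q * (s * a + t * u * (exp (β * I))⁻¹) ^ (p + q - j)) := by
    intro β
    set E := exp (β * I) with hE
    have hE0 : E ≠ 0 := hne β
    have hA0 : s * a + t * u * E⁻¹ ≠ 0 := hz β
    rw [← mul_assoc t]
    set A := s * a + t * u * E⁻¹ with hA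
    have e1 : s * (u * E) + t * conj a = ((u : ℂ)⁻¹ * E) * (-s + conj a * A) := by
      rw [hA]
      field_simp
      linear_combination E * s * hu2
    rw [e1, mul_pow, add_pow, mul_comm, Finset.mul_sum, Finset.sum_mul]
    refine Finset.sum_congr rfl fun j hj => ?_
    have hj' : j ≤ q := by have := Finset.mem_range.1 hj; omega
    have : A ^ (p + q - j : ℤ) = A ^ p * A ^ (q - j) := by
      rw [← zpow_natCast, ← zpow_add₀ hA0]
      congr 1
      push_cast [hj']
      ring
    rw [this, mul_pow, mul_pow, inv_pow]; ring
  simp_rw [h1]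
  rw [intervalIntegral.integral_finsetSum (fun j _ =>
    ((hcont _).intervalIntegrable _ _).const_mul _)]
  simp_rw [intervalIntegral.integral_const_mul, integral_expI_pow_mul hlt]
  rw [diagPoly, Finset.mul_sum, Finset.mul_sum]
  refine Finset.sum_congr rfl fun j _ => ?_
  rw [show p + q - j - q = p - j by ring, mul_zpow, mul_pow, zpow_sub₀ hs, zpow_natCast,
    show (-s) ^ j = (-1) ^ j * s ^ j by rw [← mul_pow]; ring]
  field_simp

/-! ### The matrix coefficients of the discrete series -/

/-- The contour integral with the unit circle parametrized by the angle. -/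
theorem matCoeff_eq (l2 n2 m2 : ℤ) (Z : HR) :
    matCoeff l2 n2 m2 Z = (2 * (Real.pi : ℂ))⁻¹ * ∫ θ in (0 : ℝ)..2 * Real.pi,
      (exp (θ * I) * z11 Z + z21 Z) ^ ((l2 - m2) / 2) *
        (exp (θ * I) * z12 Z + z22 Z) ^ ((l2 + m2) / 2) * exp (θ * I) ^ ((n2 - l2) / 2) := by
  simp only [matCoeff, circleIntegral, deriv_circleMap, circleMap_zero, ofReal_one, one_mul,
    smul_eq_mul]
  have h : ∀ θ : ℝ, exp (θ * I) * I * ((exp (θ * I) * z11 Z + z21 Z) ^ ((l2 - m2) / 2) *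
        (exp (θ * I) * z12 Z + z22 Z) ^ ((l2 + m2) / 2) * exp (θ * I) ^ ((n2 - l2) / 2) *
          (exp (θ * I))⁻¹) = I * ((exp (θ * I) * z11 Z + z21 Z) ^ ((l2 - m2) / 2) *
        (exp (θ * I) * z12 Z + z22 Z) ^ ((l2 + m2) / 2) * exp (θ * I) ^ ((n2 - l2) / 2)) := by
    intro θ
    have := exp_ne_zero (θ * I)
    field_simp
  simp_rw [h]
  rw [intervalIntegral.integral_const_mul, ← mul_assoc]
  congr 1
  have hI : (I : ℂ) ≠ 0 := I_ne_zero
  have hpi : (Real.pi : ℂ) ≠ 0 := by exact_mod_cast Real.pi_ne_zero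
  field_simp

/-- The matrix coefficients are homogeneous of degree `2 l`. -/
theorem matCoeff_smul {l2 n2 m2 : ℤ} (he : Even (m2 - l2)) {t : ℝ} (ht : 0 < t) (Z : HR) :
    matCoeff l2 n2 m2 (t • Z) = (t : ℂ) ^ l2 * matCoeff l2 n2 m2 Z := by
  have ht0 : (t : ℂ) ≠ 0 := by exact_mod_cast ht.ne'
  obtain ⟨r, hr⟩ := he
  have hl : l2 = (l2 - m2) / 2 + (l2 + m2) / 2 := by omega
  simp only [matCoeff_eq, z21_eq, z22_eq, z11_smul, z12_smul, map_mul, conj_ofReal]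
  have h : ∀ θ : ℝ, (exp (θ * I) * (t * z11 Z) + t * conj (z12 Z)) ^ ((l2 - m2) / 2) *
        (exp (θ * I) * (t * z12 Z) + t * conj (z11 Z)) ^ ((l2 + m2) / 2) *
          exp (θ * I) ^ ((n2 - l2) / 2) = (t : ℂ) ^ l2 *
      ((exp (θ * I) * z11 Z + conj (z12 Z)) ^ ((l2 - m2) / 2) *
        (exp (θ * I) * z12 Z + conj (z11 Z)) ^ ((l2 + m2) / 2) *
          exp (θ * I) ^ ((n2 - l2) / 2)) := by
    intro θ
    rw [mul_left_comm, ← mul_add, mul_left_comm, ← mul_add, mul_zpow, mul_zpow]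
    conv_rhs => rw [hl, zpow_add₀ ht0, ← hl]
    ring
  simp_rw [h]
  rw [intervalIntegral.integral_const_mul]
  ring

theorem conj_expI (θ : ℝ) : conj (exp (θ * I)) = (exp (θ * I))⁻¹ := by
  rw [← exp_conj, ← exp_neg]; simp

/-- Complex conjugation exchanges the holomorphic and the antiholomorphic discrete series. -/
theorem matCoeff_neg {l2 n2 m2 : ℤ} (hn : Even (n2 - l2)) (hm : Even (m2 - l2)) (Z : HR) :
    matCoeff l2 (-n2) (-m2) Z = conj (matCoeff l2 n2 m2 Z) := by
  simp only [matCoeff_eq, z21_eq, z22_eq]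
  rw [map_mul, ← intervalIntegral.intervalIntegral_conj]
  congr 1
  · simp [Complex.conj_ofNat]
  refine intervalIntegral.integral_congr fun θ _ => ?_
  have hE := exp_ne_zero (θ * I)
  simp only [map_mul, map_zpow₀, map_add, conj_conj, conj_expI]
  set E := exp (θ * I)
  obtain ⟨r, hr⟩ := hm
  obtain ⟨s, hs⟩ := hn
  have e1 : E⁻¹ * conj (z11 Z) + z12 Z = E⁻¹ * (E * z12 Z + conj (z11 Z)) := by field_simp; ring
  have e2 : E⁻¹ * conj (z12 Z) + z11 Z = E⁻¹ * (E * z11 Z + conj (z12 Z)) := by field_simp; ring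
  have e3 : (-n2 - l2) / 2 = -((l2 - m2) / 2) - (l2 + m2) / 2 - (n2 - l2) / 2 := by omega
  rw [e1, e2, mul_zpow, mul_zpow, e3, zpow_sub₀ hE, zpow_sub₀ hE, zpow_neg, inv_zpow, inv_zpow,
    inv_zpow, sub_neg_eq_add, show l2 + -m2 = l2 - m2 by ring]
  field_simp

theorem norm_z12_lt {Z : HR} (hZ : Z ∈ HRplus) : ‖z12 Z‖ < ‖z11 Z‖ := by
  have h : 0 < N Z := hZ
  rw [N_eq_norm] at h
  exact lt_of_pow_lt_pow_left₀ 2 (norm_nonneg _) (by linarith)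

theorem z11_ne_zero {Z : HR} (hZ : Z ∈ HRplus) : z11 Z ≠ 0 :=
  norm_pos_iff.1 ((norm_nonneg _).trans_lt (norm_z12_lt hZ))

/-- The summands in the binomial expansion of the matrix coefficients of the holomorphic discrete
series, with `p = l - m < 0`, `q = l + m` and `k = n - l`. The `i`-th Fourier coefficient vanishes
when its index `p + i + k` is negative. -/
noncomputable def coeffTerm (p : ℤ) (q k i : ℕ) (Z : HR) : ℂ :=
  if 0 ≤ p + i + k then (q.choose i : ℂ) * binom p (p + i + k).toNat *
    (z12 Z ^ i * conj (z11 Z) ^ (q - i) * ((z11 Z) ^ (i + k))⁻¹ *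
      conj (z12 Z) ^ (p + i + k).toNat) else 0

/-- In the holomorphic case the second factor of the integrand is a polynomial, and the first one is
expanded in `z₂₁ / z₁₁`, which is less than one in norm. -/
theorem matCoeff_eq_sum {l2 n2 m2 p : ℤ} {q k : ℕ} (hp : (l2 - m2) / 2 = p)
    (hq : (l2 + m2) / 2 = q) (hk : (n2 - l2) / 2 = k) {Z : HR} (hZ : Z ∈ HRplus) :
    matCoeff l2 n2 m2 Z = ∑ i ∈ Finset.range (q + 1), coeffTerm p q k i Z := by
  have hlt : ‖conj (z12 Z)‖ < ‖z11 Z‖ := by rw [norm_conj]; exact norm_z12_lt hZ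
  have ha := z11_ne_zero hZ
  rw [matCoeff_eq, hp, hq, hk, z21_eq, z22_eq]
  have hne : ∀ θ : ℝ, exp (θ * I) ≠ 0 := fun θ => exp_ne_zero _
  have h1 : ∀ θ : ℝ, (exp (θ * I) * z11 Z + conj (z12 Z)) ^ p *
      (exp (θ * I) * z12 Z + conj (z11 Z)) ^ (q : ℤ) * exp (θ * I) ^ (k : ℤ) =
      ∑ i ∈ Finset.range (q + 1), (q.choose i : ℂ) * z12 Z ^ i * conj (z11 Z) ^ (q - i) *
        (exp (θ * I) ^ (p + i + k : ℤ) * (z11 Z + conj (z12 Z) * (exp (θ * I))⁻¹) ^ p) := by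
    intro θ
    set E := exp (θ * I)
    have hE : E ≠ 0 := hne θ
    have e1 : E * z11 Z + conj (z12 Z) = E * (z11 Z + conj (z12 Z) * E⁻¹) := by
      field_simp
    rw [e1, mul_zpow, zpow_natCast, zpow_natCast, add_pow, Finset.mul_sum, Finset.sum_mul]
    refine Finset.sum_congr rfl fun i _ => ?_
    rw [zpow_add₀ hE, zpow_add₀ hE, zpow_natCast, zpow_natCast, mul_pow]
    ring
  have hcont : ∀ n : ℤ, Continuous fun θ : ℝ =>
      exp (θ * I) ^ n * (z11 Z + conj (z12 Z) * (exp (θ * I))⁻¹) ^ p := fun n =>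
    (continuous_expI.zpow₀ n fun θ => Or.inl (hne θ)).mul ((continuous_const.add
      (continuous_const.mul (continuous_expI.inv₀ hne))).zpow₀ p fun θ =>
        Or.inl (add_mul_ne_zero hlt (by rw [Pi.inv_apply, norm_inv, norm_exp_ofReal_mul_I, inv_one])))
  simp_rw [h1]
  rw [intervalIntegral.integral_finsetSum (fun j _ =>
    ((hcont _).intervalIntegrable _ _).const_mul _), Finset.mul_sum]
  refine Finset.sum_congr rfl fun i _ => ?_
  rw [intervalIntegral.integral_const_mul, coeffTerm]
  have hpi : (Real.pi : ℂ) ≠ 0 := by exact_mod_cast Real.pi_ne_zero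
  split_ifs with h
  · obtain ⟨m, hm⟩ := Int.eq_ofNat_of_zero_le h
    rw [hm]
    simp only [zpow_natCast, Int.toNat_natCast]
    rw [integral_expI_pow_mul hlt, show p - m = -((i + k : ℕ) : ℤ) by push_cast; omega, zpow_neg,
      zpow_natCast]
    field_simp
  · obtain ⟨m, hm⟩ : ∃ m : ℕ, p + i + k = -((m + 1 : ℕ) : ℤ) :=
      ⟨(-(p + i + k) - 1).toNat, by push_cast; omega⟩
    rw [hm]
    simp only [zpow_neg, zpow_natCast]
    rw [integral_expI_inv_pow_succ_mul hlt]
    simp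

theorem contDiff_z11 : ContDiff ℝ ∞ z11 := by
  have : z11 = fun X : HR => (X 0 : ℂ) - X 3 * I := by
    ext X; apply Complex.ext <;> simp [z11]
  rw [this]
  have h : ∀ i, ContDiff ℝ ∞ fun X : HR => (X i : ℂ) := fun i =>
    ofRealCLM.contDiff.comp (contDiff_euclidean.1 contDiff_id i)
  exact (h 0).sub ((h 3).mul contDiff_const)

theorem contDiff_z12 : ContDiff ℝ ∞ z12 := by
  have : z12 = fun X : HR => (X 1 : ℂ) + X 2 * I := by
    ext X; apply Complex.ext <;> simp [z12]
  rw [this]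
  have h : ∀ i, ContDiff ℝ ∞ fun X : HR => (X i : ℂ) := fun i =>
    ofRealCLM.contDiff.comp (contDiff_euclidean.1 contDiff_id i)
  exact (h 1).add ((h 2).mul contDiff_const)

theorem contDiff_N : ContDiff ℝ ∞ N := by
  have h : ∀ i, ContDiff ℝ ∞ fun X : HR => X i := fun i => contDiff_euclidean.1 contDiff_id i
  unfold N
  exact ((((h 0).pow 2).sub ((h 1).pow 2)).sub ((h 2).pow 2)).add ((h 3).pow 2)

theorem contDiffOn_coeffTerm (p : ℤ) (q k i : ℕ) : ContDiffOn ℝ ∞ (coeffTerm p q k i) HRplus := by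
  unfold coeffTerm
  split_ifs with h
  · have c1 : ContDiff ℝ ∞ fun Z => conj (z11 Z) := conjCLE.contDiff.comp contDiff_z11
    have c2 : ContDiff ℝ ∞ fun Z => conj (z12 Z) := conjCLE.contDiff.comp contDiff_z12
    exact contDiffOn_const.mul ((((contDiff_z12.pow i).mul (c1.pow _)).contDiffOn.mul
      ((contDiff_z11.pow _).contDiffOn.inv fun Z hZ => pow_ne_zero _ (z11_ne_zero hZ))).mul
        (c2.pow _).contDiffOn)
  · exact contDiffOn_const

theorem norm_coeffTerm_le (p : ℤ) (q k i : ℕ) (hi : i ≤ q) {Z : HR} (hZ : Z ∈ HRplus) :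
    ‖coeffTerm p q k i Z‖ ≤ ‖(q.choose i : ℂ) * binom p (p + i + k).toNat‖ *
      ‖z11 Z‖ ^ (p + q) := by
  unfold coeffTerm
  have hlt := (norm_z12_lt hZ).le
  have hpos : 0 < ‖z11 Z‖ := norm_pos_iff.2 (z11_ne_zero hZ)
  split_ifs with h
  · rw [norm_mul]
    refine mul_le_mul_of_nonneg_left ?_ (norm_nonneg _)
    simp only [norm_mul, norm_pow, norm_inv, norm_conj]
    obtain ⟨m, hm⟩ := Int.eq_ofNat_of_zero_le h
    calc ‖z12 Z‖ ^ i * ‖z11 Z‖ ^ (q - i) * (‖z11 Z‖ ^ (i + k))⁻¹ * ‖z12 Z‖ ^ (p + i + k).toNat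
        ≤ ‖z11 Z‖ ^ i * ‖z11 Z‖ ^ (q - i) * (‖z11 Z‖ ^ (i + k))⁻¹ *
          ‖z11 Z‖ ^ (p + i + k).toNat := by gcongr
      _ = ‖z11 Z‖ ^ (p + q) := by
        rw [hm, Int.toNat_natCast, ← zpow_natCast, ← zpow_natCast, ← zpow_natCast, ← zpow_natCast,
          ← zpow_neg, ← zpow_add₀ hpos.ne', ← zpow_add₀ hpos.ne', ← zpow_add₀ hpos.ne']
        congr 1
        push_cast [hi]
        omega
  · simp only [norm_zero]
    positivity

theorem contDiffOn_matCoeff_of_eq {l2 n2 m2 p : ℤ} {q k : ℕ} (hp : (l2 - m2) / 2 = p)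
    (hq : (l2 + m2) / 2 = q) (hk : (n2 - l2) / 2 = k) :
    ContDiffOn ℝ ∞ (matCoeff l2 n2 m2) HRplus :=
  ContDiffOn.congr (ContDiffOn.sum fun i _ => contDiffOn_coeffTerm p q k i)
    fun _ hZ => matCoeff_eq_sum hp hq hk hZ

/-- Every summand is homogeneous of degree `p + q` and bounded in terms of `z₁₁`, as
`‖z₁₂‖ < ‖z₁₁‖`. -/
theorem exists_norm_matCoeff_le_of_eq {l2 n2 m2 p : ℤ} {q k : ℕ} (hp : (l2 - m2) / 2 = p)
    (hq : (l2 + m2) / 2 = q) (hk : (n2 - l2) / 2 = k) :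
    ∃ C : ℝ, ∀ Z ∈ HRplus, ‖matCoeff l2 n2 m2 Z‖ ≤ C * ‖z11 Z‖ ^ (p + q) := by
  refine ⟨∑ i ∈ Finset.range (q + 1), ‖(q.choose i : ℂ) * binom p (p + i + k).toNat‖,
    fun Z hZ => ?_⟩
  rw [matCoeff_eq_sum hp hq hk hZ, Finset.sum_mul]
  exact norm_sum_le_of_le _ fun i hi =>
    norm_coeffTerm_le p q k i (Nat.lt_succ_iff.1 (Finset.mem_range.1 hi)) hZ

theorem z11_unitPt (p : ℂ × ℝ) : z11 (unitPt p) = p.1 := z11_ofPair _ _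

theorem z12_unitPt (p : ℂ × ℝ) : z12 (unitPt p) = √(‖p.1‖ ^ 2 - 1) * exp (p.2 * I) :=
  z12_ofPair _ _

theorem mem_HRplus_mul {w X : HR} (hw : w ∈ HRplus) (hX : X ∈ HRplus) : mul w X ∈ HRplus := by
  have h1 : 0 < N w := hw
  have h2 : 0 < N X := hX
  have h3 : 0 < N (mul w X) := by rw [N_mul]; positivity
  exact h3

theorem unitPt_mem {p : ℂ × ℝ} (hp : 1 < ‖p.1‖) : unitPt p ∈ HRplus := by
  have : 0 < N (unitPt p) := by rw [N_unitPt hp]; exact one_pos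
  exact this

theorem expI_mul_z_ne_zero {X : HR} (hX : X ∈ HRplus) (θ : ℝ) :
    exp (θ * I) * z11 X + z21 X ≠ 0 ∧ exp (θ * I) * z12 X + z22 X ≠ 0 := by
  have h := norm_z12_lt hX
  rw [z21_eq, z22_eq]
  constructor
  · intro h0
    have : ‖exp (θ * I) * z11 X‖ = ‖conj (z12 X)‖ := by
      rw [eq_neg_of_add_eq_zero_left h0, norm_neg]
    rw [norm_mul, norm_exp_ofReal_mul_I, one_mul, norm_conj] at this
    linarith
  · intro h0
    have : ‖exp (θ * I) * z12 X‖ = ‖conj (z11 X)‖ := by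
      rw [eq_neg_of_add_eq_zero_left h0, norm_neg]
    rw [norm_mul, norm_exp_ofReal_mul_I, one_mul, norm_conj] at this
    linarith

theorem intervalIntegral_swap_of_continuous {f : ℝ × ℝ → ℂ} (hf : Continuous f) (a b c d : ℝ) :
    ∫ x in a..b, ∫ y in c..d, f (x, y) = ∫ y in c..d, ∫ x in a..b, f (x, y) :=
  intervalIntegral_intervalIntegral_swap (F := fun x y => f (x, y))
    ((hf.continuousOn.integrableOn_compact (isCompact_uIcc.prod isCompact_uIcc)).mono_set
      (Set.prod_mono Set.uIoc_subset_uIcc Set.uIoc_subset_uIcc))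

/-- The matrix coefficients are reproduced, up to a diagonal one, when a left translate is
averaged over the phase of `z₁₂`. -/
theorem integral_phase_matCoeff {l2 n2 m2 p : ℤ} {q : ℕ} (hp : (l2 - m2) / 2 = p)
    (hq : (l2 + m2) / 2 = q) {w : HR} (hw : w ∈ HRplus) {a : ℂ} (ha : 1 < ‖a‖) :
    ∫ β in (0 : ℝ)..2 * Real.pi, matCoeff l2 n2 m2 (mul w (unitPt (a, β))) =
      2 * Real.pi * (matCoeff l2 n2 m2 w * diagPoly p q a (conj a)) := by
  simp_rw [matCoeff_eq]
  rw [intervalIntegral.integral_const_mul]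
  have hU : ∀ β : ℝ, mul w (unitPt (a, β)) ∈ HRplus := fun β => mem_HRplus_mul hw (unitPt_mem ha)
  have hcE : Continuous fun x : ℝ × ℝ => exp (x.2 * I) := by fun_prop
  have hcU : Continuous fun x : ℝ × ℝ => mul w (unitPt (a, x.1)) :=
    (continuous_mul_left w).comp (continuous_unitPt.comp (by fun_prop))
  have hc : Continuous fun x : ℝ × ℝ =>
      (exp (x.2 * I) * z11 (mul w (unitPt (a, x.1))) + z21 (mul w (unitPt (a, x.1)))) ^
        ((l2 - m2) / 2) *
      (exp (x.2 * I) * z12 (mul w (unitPt (a, x.1))) + z22 (mul w (unitPt (a, x.1)))) ^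
        ((l2 + m2) / 2) * exp (x.2 * I) ^ ((n2 - l2) / 2) := by
    have h1 : Continuous z21 := by simp_rw [funext z21_eq]; exact continuous_conj.comp continuous_z12
    have h2 : Continuous z22 := by simp_rw [funext z22_eq]; exact continuous_conj.comp continuous_z11
    exact (((hcE.mul (continuous_z11.comp hcU)).add (h1.comp hcU)).zpow₀ _ fun x =>
      Or.inl (expI_mul_z_ne_zero (hU x.1) x.2).1).mul (((hcE.mul (continuous_z12.comp hcU)).add
        (h2.comp hcU)).zpow₀ _ fun x => Or.inl (expI_mul_z_ne_zero (hU x.1) x.2).2) |>.mul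
          (hcE.zpow₀ _ fun x => Or.inl (exp_ne_zero _))
  rw [intervalIntegral_swap_of_continuous hc]
  have h3 : ∀ θ : ℝ, ∫ β in (0 : ℝ)..2 * Real.pi,
      (exp (θ * I) * z11 (mul w (unitPt (a, β))) + z21 (mul w (unitPt (a, β)))) ^
        ((l2 - m2) / 2) *
      (exp (θ * I) * z12 (mul w (unitPt (a, β))) + z22 (mul w (unitPt (a, β)))) ^
        ((l2 + m2) / 2) * exp (θ * I) ^ ((n2 - l2) / 2) =
      2 * Real.pi * diagPoly p q a (conj a) * ((exp (θ * I) * z11 w + z21 w) ^ ((l2 - m2) / 2) *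
        (exp (θ * I) * z12 w + z22 w) ^ ((l2 + m2) / 2) * exp (θ * I) ^ ((n2 - l2) / 2)) := by
    intro θ
    rw [intervalIntegral.integral_mul_const, hp, hq]
    have hs := expI_mul_z_ne_zero hw θ
    -- the two entries are conjugate up to the phase `e^{iθ}`
    have hst : ‖exp (θ * I) * z11 w + z21 w‖ = ‖exp (θ * I) * z12 w + z22 w‖ := by
      have : exp (θ * I) * z11 w + z21 w = exp (θ * I) * conj (exp (θ * I) * z12 w + z22 w) := by
        have := exp_ne_zero (θ * I)
        rw [map_add, map_mul, conj_expI, z21_eq, z22_eq, conj_conj]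
        field_simp
        ring
      rw [this, norm_mul, norm_exp_ofReal_mul_I, one_mul, norm_conj]
    have h := integral_phase ha hst hs.1 p q
    have e : ∀ β : ℝ, (exp (θ * I) * z11 (mul w (unitPt (a, β))) + z21 (mul w (unitPt (a, β)))) ^ p *
        (exp (θ * I) * z12 (mul w (unitPt (a, β))) + z22 (mul w (unitPt (a, β)))) ^ (q : ℤ) =
        ((exp (θ * I) * z11 w + z21 w) * a + (exp (θ * I) * z12 w + z22 w) *
          (√(‖a‖ ^ 2 - 1) * (exp (β * I))⁻¹)) ^ p *
        ((exp (θ * I) * z11 w + z21 w) * (√(‖a‖ ^ 2 - 1) * exp (β * I)) +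
          (exp (θ * I) * z12 w + z22 w) * conj a) ^ q := by
      intro β
      simp only [z21_eq, z22_eq, z11_mul, z12_mul, z11_unitPt, z12_unitPt, map_add, map_mul,
        conj_conj, conj_ofReal, conj_expI, map_inv₀, inv_inv, zpow_natCast]
      congr 2 <;> ring
    simp_rw [e]
    rw [h, zpow_natCast]
    ring
  simp_rw [h3]
  rw [intervalIntegral.integral_const_mul]
  ring

/-! ### Orbital integrals of the diagonal matrix coefficients -/

theorem norm_diag_term_le {a : ℂ} (ha : 1 ≤ ‖a‖) (c : ℂ) (p : ℤ) (q j : ℕ) (hj : j ≤ q) :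
    ‖c * a ^ (p - j) * conj a ^ (q - j)‖ ≤ ‖c‖ * ‖a‖ ^ (p + q) := by
  have h0 : ‖a‖ ≠ 0 := by linarith
  rw [norm_mul, norm_mul, norm_zpow, norm_pow, norm_conj, mul_assoc, ← zpow_natCast,
    ← zpow_add₀ h0]
  refine mul_le_mul_of_nonneg_left (zpow_le_zpow_right₀ ha ?_) (norm_nonneg _)
  push_cast [hj]
  omega

theorem exists_norm_diagPoly_le (p : ℤ) (q : ℕ) :
    ∃ C : ℝ, 0 ≤ C ∧ ∀ a : ℂ, 1 ≤ ‖a‖ → ‖diagPoly p q a (conj a)‖ ≤ C * ‖a‖ ^ (p + q) := by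
  refine ⟨∑ j ∈ Finset.range (q + 1), ‖(-1) ^ j * (q.choose j : ℂ) * binom (p + q - j) q‖,
    by positivity, fun a ha => ?_⟩
  rw [diagPoly, Finset.sum_mul]
  exact norm_sum_le_of_le _ fun j hj =>
    norm_diag_term_le ha _ p q j (Nat.lt_succ_iff.1 (Finset.mem_range.1 hj))

theorem exists_norm_diagPrim_le (p : ℤ) (q : ℕ) :
    ∃ C : ℝ, 0 ≤ C ∧ ∀ a : ℂ, 1 ≤ ‖a‖ → ‖diagPrim p q a (conj a)‖ ≤ C * ‖a‖ ^ (p + q + 1) := by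
  refine ⟨∑ j ∈ Finset.range (q + 2), ‖(-1) ^ j * ((q + 1).choose j : ℂ) * binom (p + q - j) q‖,
    by positivity, fun a ha => ?_⟩
  rw [diagPrim, Finset.sum_mul]
  refine norm_sum_le_of_le _ fun j hj => ?_
  have := norm_diag_term_le ha ((-1) ^ j * ((q + 1).choose j : ℂ) * binom (p + q - j) q) p (q + 1) j
    (Nat.lt_succ_iff.1 (Finset.mem_range.1 hj))
  rwa [Nat.cast_add, Nat.cast_one, ← add_assoc] at this

/-- The derivative in the direction `i` along a line `Re a = x`: that in `a` gives the first matrix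
coefficient and that in `b = conj a` the second. -/
theorem hasDerivAt_diagPrim (p : ℤ) (q : ℕ) {x y : ℝ} (h : (x + y * I : ℂ) ≠ 0) :
    HasDerivAt (fun y : ℝ => diagPrim p q (x + y * I) (x - y * I))
      (I * (q + 1) * (diagPoly (p - 1) (q + 1) (x + y * I) (x - y * I) -
        diagPoly p q (x + y * I) (x - y * I))) y := by
  have ha : HasDerivAt (fun y : ℝ => (x + y * I : ℂ)) I y := by
    simpa using ((hasDerivAt_id y).ofReal_comp.mul_const I).const_add (x : ℂ)
  have hb : HasDerivAt (fun y : ℝ => (x - y * I : ℂ)) (-I) y := by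
    simpa using ((hasDerivAt_id y).ofReal_comp.mul_const I).const_sub (x : ℂ)
  have hterm : ∀ j ∈ Finset.range (q + 2), HasDerivAt
      (fun y : ℝ => (-1) ^ j * ((q + 1).choose j : ℂ) * binom (p + q - j) q *
        (x + y * I : ℂ) ^ (p - j) * (x - y * I : ℂ) ^ (q + 1 - j))
      ((-1) ^ j * ((q + 1).choose j : ℂ) * binom (p + q - j) q *
          (((p - j : ℤ) : ℂ) * (x + y * I : ℂ) ^ (p - j - 1) * I) * (x - y * I : ℂ) ^ (q + 1 - j) +
        (-1) ^ j * ((q + 1).choose j : ℂ) * binom (p + q - j) q * (x + y * I : ℂ) ^ (p - j) *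
          (((q + 1 - j : ℕ) : ℂ) * (x - y * I : ℂ) ^ (q + 1 - j - 1) * -I)) y := fun j _ =>
    (((hasDerivAt_zpow (p - j) _ (Or.inl h)).comp y ha).const_mul
      ((-1) ^ j * ((q + 1).choose j : ℂ) * binom (p + q - j) q)).mul (hb.fun_pow (q + 1 - j))
  have hsum := HasDerivAt.fun_sum hterm
  refine hsum.congr_deriv ?_
  rw [Finset.sum_add_distrib, mul_sub, sub_eq_add_neg (I * _ * _)]
  refine congrArg₂ (· + ·) ?_ ?_
  · rw [diagPoly, Finset.mul_sum]
    refine Finset.sum_congr rfl fun j _ => ?_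
    have hb := binom_succ_right (p + q - j) q
    push_cast at hb ⊢
    rw [show p - 1 + (q + 1) - j = p + q - j by ring, show p - 1 - (j : ℤ) = p - j - 1 by ring]
    linear_combination (-(I * (-1) ^ j * ((q + 1).choose j : ℂ) * (x + y * I) ^ (p - j - 1 : ℤ) *
      (x - y * I) ^ (q + 1 - j))) * hb
  · rw [Finset.sum_range_succ, Nat.sub_self, diagPoly, Finset.mul_sum, ← Finset.sum_neg_distrib]
    simp only [Nat.cast_zero, zero_mul, mul_zero, add_zero]
    refine Finset.sum_congr rfl fun j hj => ?_
    have hj' : j ≤ q := Nat.lt_succ_iff.1 (Finset.mem_range.1 hj)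
    have hc : (q.choose j : ℂ) * (q + 1) = (q + 1).choose j * ((q + 1 - j : ℕ) : ℂ) := by
      exact_mod_cast Nat.choose_mul_succ_eq q j
    rw [show q + 1 - j - 1 = q - j by omega]
    linear_combination (I * (-1) ^ j * binom (p + q - j) q * (x + y * I) ^ (p - j : ℤ) *
      (x - y * I) ^ (q - j)) * hc

theorem norm_add_mul_I_sq (x y : ℝ) : ‖(x + y * I : ℂ)‖ ^ 2 = x ^ 2 + y ^ 2 := by
  rw [← normSq_eq_norm_sq, normSq_add_mul_I]

theorem one_le_of_sqrt_le {x y : ℝ} (h : √(1 - x ^ 2) ≤ |y|) : 1 ≤ x ^ 2 + y ^ 2 := by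
  have := (Real.sqrt_le_left (abs_nonneg y)).1 h
  rw [sq_abs] at this
  linarith

/-- The line `Re a = x` outside the unit disc, as a pair of half lines. For `1 < |x|` the line
misses the disc, the square root is zero and the half lines omit the point `0`, whence the equality
up to a null set. -/
theorem lineSet_ae_eq (x : ℝ) : {y : ℝ | 1 < x ^ 2 + y ^ 2} =ᵐ[volume]
    (Set.Iio (-√(1 - x ^ 2)) ∪ Set.Ioi (√(1 - x ^ 2)) : Set ℝ) := by
  have h : {y : ℝ | 1 < x ^ 2 + y ^ 2} \ {0} =
      (Set.Iio (-√(1 - x ^ 2)) ∪ Set.Ioi (√(1 - x ^ 2)) : Set ℝ) \ {0} := by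
    ext y
    simp only [Set.mem_sdiff, Set.mem_ofPred_eq, Set.mem_singleton_iff, Set.mem_union, Set.mem_Iio,
      Set.mem_Ioi, and_congr_left_iff]
    intro hy
    rw [← sub_lt_iff_lt_add', ← sq_abs y, ← Real.sqrt_lt' (abs_pos.2 hy), lt_abs, or_comm, lt_neg]
  have h1 : ∀ s : Set ℝ, (s \ {0} : Set ℝ) =ᵐ[volume] s := fun s =>
    sdiff_null_ae_eq_self (by simp)
  exact (h1 _).symm.trans ((Filter.EventuallyEq.of_eq h).trans (h1 _))

theorem continuous_line (x : ℝ) : Continuous fun y : ℝ => (x + y * I : ℂ) := by fun_prop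

theorem integrableOn_line {x C : ℝ} {f : ℝ → ℂ} (hf : ContinuousOn f {y | 1 ≤ x ^ 2 + y ^ 2})
    (hfC : ∀ y, 1 ≤ x ^ 2 + y ^ 2 → ‖f y‖ ≤ C * (x ^ 2 + y ^ 2)⁻¹) :
    IntegrableOn f {y : ℝ | 1 < x ^ 2 + y ^ 2} := by
  have hms : MeasurableSet {y : ℝ | 1 ≤ x ^ 2 + y ^ 2} :=
    measurableSet_le measurable_const (by fun_prop)
  have hmem : 1 ≤ x ^ 2 + (1 : ℝ) ^ 2 := by nlinarith [sq_nonneg x]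
  have hC : 0 ≤ C := nonneg_of_mul_nonneg_left ((norm_nonneg _).trans (hfC 1 hmem))
    (inv_pos.2 (by linarith))
  have hint : IntegrableOn f {y : ℝ | 1 ≤ x ^ 2 + y ^ 2} := by
    refine Integrable.mono' ((integrable_inv_one_add_sq.const_mul (2 * C)).integrableOn)
      (hf.aestronglyMeasurable hms) ?_
    filter_upwards [ae_restrict_mem hms] with y hy
    have hy' : 1 ≤ x ^ 2 + y ^ 2 := hy
    refine (hfC y hy).trans ?_
    rw [mul_assoc, mul_left_comm]
    refine mul_le_mul_of_nonneg_left ?_ hC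
    rw [← div_eq_mul_inv, inv_le_iff_one_le_mul₀ (by positivity), div_mul_eq_mul_div,
      le_div_iff₀ (by positivity)]
    nlinarith [sq_nonneg x]
  exact hint.mono_set fun y hy => le_of_lt (Set.mem_ofPred.1 hy)

/-- The fundamental theorem of calculus on the line `Re a = x` outside the unit disc. -/
theorem setIntegral_deriv_line {x : ℝ} {F f : ℝ → ℂ} {C : ℝ}
    (hF : ∀ y, 1 ≤ x ^ 2 + y ^ 2 → HasDerivAt F (f y) y)
    (hf : ContinuousOn f {y | 1 ≤ x ^ 2 + y ^ 2})
    (hfC : ∀ y, 1 ≤ x ^ 2 + y ^ 2 → ‖f y‖ ≤ C * (x ^ 2 + y ^ 2)⁻¹)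
    (hFC : ∀ y, 1 ≤ x ^ 2 + y ^ 2 → ‖F y‖ ≤ C * (√(x ^ 2 + y ^ 2))⁻¹) :
    IntegrableOn f {y : ℝ | 1 < x ^ 2 + y ^ 2} ∧
    ∫ y in {y : ℝ | 1 < x ^ 2 + y ^ 2}, f y = F (-√(1 - x ^ 2)) - F (√(1 - x ^ 2)) := by
  set y0 := √(1 - x ^ 2) with hy0
  have hy0n : 0 ≤ y0 := Real.sqrt_nonneg _
  have hm1 : ∀ y ∈ Set.Ici y0, 1 ≤ x ^ 2 + y ^ 2 := fun y hy =>
    one_le_of_sqrt_le (le_trans hy (le_abs_self y))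
  have hm2 : ∀ y ∈ Set.Iic (-y0), 1 ≤ x ^ 2 + y ^ 2 := fun y hy =>
    one_le_of_sqrt_le (le_trans (le_neg.1 hy) (neg_le_abs y))
  have hC : 0 ≤ C := by
    have := (norm_nonneg _).trans (hfC y0 (hm1 y0 Set.self_mem_Ici))
    have h2 : 0 < (x ^ 2 + y0 ^ 2)⁻¹ := by
      have := hm1 y0 Set.self_mem_Ici
      positivity
    exact nonneg_of_mul_nonneg_left this h2
  have hint := integrableOn_line hf hfC
  have hint' : IntegrableOn f (Set.Iio (-y0) ∪ Set.Ioi y0) := hint.congr_set_ae (lineSet_ae_eq x).symm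
  have hi1 : IntegrableOn f (Set.Ioi y0) := hint'.mono_set Set.subset_union_right
  have hi2 : IntegrableOn f (Set.Iic (-y0)) :=
    (hint'.mono_set Set.subset_union_left).congr_set_ae Iio_ae_eq_Iic.symm
  have hlim : ∀ l : Filter ℝ, Tendsto (fun y : ℝ => |y|) l atTop → Tendsto F l (𝓝 0) := by
    intro l hl
    have h0 : Tendsto (fun y : ℝ => C * |y|⁻¹) l (𝓝 0) := by
      simpa using (tendsto_inv_atTop_zero.comp hl).const_mul C
    refine squeeze_zero_norm' ?_ h0
    filter_upwards [hl.eventually_ge_atTop 1] with y hy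
    have h1 : 1 ≤ x ^ 2 + y ^ 2 := by nlinarith [sq_abs y, sq_nonneg x]
    refine (hFC y h1).trans (mul_le_mul_of_nonneg_left ?_ hC)
    exact inv_anti₀ (by linarith) (Real.le_sqrt_of_sq_le (by nlinarith [sq_abs y, sq_nonneg x]))
  have e1 := integral_Ioi_of_hasDerivAt_of_tendsto
    (hF y0 (hm1 y0 Set.self_mem_Ici)).continuousAt.continuousWithinAt
    (fun y hy => hF y (hm1 y (Set.Ioi_subset_Ici_self hy))) hi1 (hlim atTop tendsto_abs_atTop_atTop)
  have e2 := integral_Iic_of_hasDerivAt_of_tendsto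
    (hF (-y0) (hm2 (-y0) Set.self_mem_Iic)).continuousAt.continuousWithinAt
    (fun y hy => hF y (hm2 y (Set.Iio_subset_Iic_self hy))) hi2 (hlim atBot tendsto_abs_atBot_atTop)
  refine ⟨hint, ?_⟩
  rw [setIntegral_congr_set (lineSet_ae_eq x), setIntegral_union (by
      rw [Set.disjoint_left]
      intro y h1 h2
      simp only [Set.mem_Iio, Set.mem_Ioi] at h1 h2
      linarith) measurableSet_Ioi (hi2.mono_set Set.Iio_subset_Iic_self) hi1,
    ← integral_Iic_eq_integral_Iio, e1, e2]
  ring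

theorem conj_line (x y : ℝ) : conj (x + y * I : ℂ) = x - y * I := by
  simp [sub_eq_add_neg]

theorem line_ne_zero {x y : ℝ} (h : 1 ≤ x ^ 2 + y ^ 2) : (x + y * I : ℂ) ≠ 0 := by
  intro h0
  have := norm_add_mul_I_sq x y
  rw [h0, norm_zero] at this
  linarith [this]

theorem one_le_norm_line {x y : ℝ} (h : 1 ≤ x ^ 2 + y ^ 2) : 1 ≤ ‖(x + y * I : ℂ)‖ := by
  rw [← norm_add_mul_I_sq] at h
  exact (one_le_sq_iff₀ (norm_nonneg _)).1 h

theorem norm_line_zpow_le {x y : ℝ} (h : 1 ≤ x ^ 2 + y ^ 2) {L : ℤ} (hL : L ≤ -2) :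
    ‖(x + y * I : ℂ)‖ ^ L ≤ (x ^ 2 + y ^ 2)⁻¹ ∧
      ‖(x + y * I : ℂ)‖ ^ (L + 1) ≤ (√(x ^ 2 + y ^ 2))⁻¹ := by
  have h1 := one_le_norm_line h
  constructor
  · calc _ ≤ ‖(x + y * I : ℂ)‖ ^ (-2 : ℤ) := zpow_le_zpow_right₀ h1 hL
      _ = _ := by rw [← norm_add_mul_I_sq, zpow_neg]; rfl
  · calc _ ≤ ‖(x + y * I : ℂ)‖ ^ (-1 : ℤ) := zpow_le_zpow_right₀ h1 (by omega)
      _ = _ := by rw [← norm_add_mul_I_sq, zpow_neg_one, Real.sqrt_sq (norm_nonneg _)]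

theorem continuousOn_diagPoly_line (p : ℤ) (q : ℕ) (x : ℝ) :
    ContinuousOn (fun y : ℝ => diagPoly p q (x + y * I) (x - y * I)) {y | 1 ≤ x ^ 2 + y ^ 2} := by
  unfold diagPoly
  refine continuousOn_finsetSum _ fun j _ => ?_
  exact (continuousOn_const.mul ((continuous_line x).continuousOn.zpow₀ _ fun y hy =>
    Or.inl (line_ne_zero hy))).mul (by fun_prop)

/-- The orbital integrals of the diagonal matrix coefficients of a given weight are all equal. -/
theorem orbital_diagPoly_succ {p : ℤ} {q : ℕ} (hL : p + q ≤ -2) (x : ℝ) :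
    ∫ y in {y : ℝ | 1 < x ^ 2 + y ^ 2}, diagPoly (p - 1) (q + 1) (x + y * I) (x - y * I) =
      ∫ y in {y : ℝ | 1 < x ^ 2 + y ^ 2}, diagPoly p q (x + y * I) (x - y * I) := by
  obtain ⟨C1, hC1, h1⟩ := exists_norm_diagPoly_le (p - 1) (q + 1)
  obtain ⟨C2, hC2, h2⟩ := exists_norm_diagPoly_le p q
  obtain ⟨C3, hC3, h3⟩ := exists_norm_diagPrim_le p q
  have hint : ∀ (p' : ℤ) (q' : ℕ), p' + q' = p + q →
      IntegrableOn (fun y : ℝ => diagPoly p' q' (x + y * I) (x - y * I))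
        {y : ℝ | 1 < x ^ 2 + y ^ 2} := by
    intro p' q' hpq
    obtain ⟨C, hC, h⟩ := exists_norm_diagPoly_le p' q'
    refine integrableOn_line (C := C) (continuousOn_diagPoly_line p' q' x) fun y hy => ?_
    rw [← conj_line]
    refine (h _ (one_le_norm_line hy)).trans (mul_le_mul_of_nonneg_left ?_ hC)
    exact (norm_line_zpow_le hy (hpq ▸ hL)).1
  have key := (setIntegral_deriv_line (x := x) (C := (q + 1) * (C1 + C2) + C3)
    (F := fun y : ℝ => diagPrim p q (x + y * I) (x - y * I))
    (f := fun y : ℝ => I * (q + 1) * (diagPoly (p - 1) (q + 1) (x + y * I) (x - y * I) -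
        diagPoly p q (x + y * I) (x - y * I)))
    (fun y hy => hasDerivAt_diagPrim p q (line_ne_zero hy))
    (continuousOn_const.mul ((continuousOn_diagPoly_line _ _ x).sub
      (continuousOn_diagPoly_line _ _ x)))
    (fun y hy => ?_) (fun y hy => ?_))
  · have hbd : diagPrim p q (x + (-√(1 - x ^ 2) : ℝ) * I) (x - (-√(1 - x ^ 2) : ℝ) * I) =
        diagPrim p q (x + (√(1 - x ^ 2) : ℝ) * I) (x - (√(1 - x ^ 2) : ℝ) * I) := by
      -- either the line meets the unit circle, where `a conj a = 1`, or the two ends coincide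
      rcases le_total (x ^ 2) 1 with hx | hx
      · have hs : ((√(1 - x ^ 2) : ℝ) : ℂ) ^ 2 = 1 - x ^ 2 := by
          rw [← ofReal_pow, Real.sq_sqrt (by linarith)]
          push_cast
          rfl
        rw [diagPrim_eq_zero, diagPrim_eq_zero]
        · linear_combination hs - ((√(1 - x ^ 2) : ℝ) : ℂ) ^ 2 * I_sq
        · push_cast
          linear_combination hs - ((√(1 - x ^ 2) : ℝ) : ℂ) ^ 2 * I_sq
      · simp [Real.sqrt_eq_zero_of_nonpos (by linarith : 1 - x ^ 2 ≤ 0)]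
    have hk := key.2
    rw [hbd, sub_self, integral_const_mul, integral_sub (hint _ _ (by push_cast; ring))
      (hint _ _ rfl)] at hk
    have hq : (I * (q + 1) : ℂ) ≠ 0 := mul_ne_zero I_ne_zero (by exact_mod_cast q.succ_ne_zero)
    exact sub_eq_zero.1 ((mul_eq_zero.1 hk).resolve_left hq)
  · have e1 := h1 _ (one_le_norm_line hy)
    have e2 := h2 _ (one_le_norm_line hy)
    rw [conj_line] at e1 e2
    have hn := (norm_line_zpow_le hy hL).1
    have hn1 : ‖(x + y * I : ℂ)‖ ^ (p - 1 + (q + 1 : ℕ) : ℤ) ≤ (x ^ 2 + y ^ 2)⁻¹ := by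
      rwa [show p - 1 + ((q + 1 : ℕ) : ℤ) = p + q by push_cast; ring]
    have hq : ‖(I * (q + 1) : ℂ)‖ = q + 1 := by
      rw [norm_mul, norm_I, one_mul]
      exact_mod_cast norm_natCast (q + 1)
    rw [norm_mul, hq, add_mul _ C3, mul_assoc, add_mul C1]
    refine le_add_of_le_of_nonneg (mul_le_mul_of_nonneg_left ((norm_sub_le _ _).trans
      (add_le_add (e1.trans (mul_le_mul_of_nonneg_left hn1 hC1))
        (e2.trans (mul_le_mul_of_nonneg_left hn hC2)))) (by positivity)) (by positivity)
  · have e3 := h3 _ (one_le_norm_line hy)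
    rw [conj_line] at e3
    rw [add_mul]
    exact le_add_of_nonneg_of_le (by positivity)
      (e3.trans (mul_le_mul_of_nonneg_left (norm_line_zpow_le hy hL).2 hC3))

/-- The value of the orbital integral of weight `L` at `x`. For `1 ≤ |x|` it vanishes, the square
root being zero there. -/
noncomputable def orbital (L : ℤ) (x : ℝ) : ℂ :=
  ((x - √(1 - x ^ 2) * I : ℂ) ^ (L + 1) - (x + √(1 - x ^ 2) * I : ℂ) ^ (L + 1)) / (I * (L + 1))

/-- The orbital integral of the lowest weight coefficient `a^L`. -/
theorem orbital_zero {L : ℤ} (hL : L ≤ -2) (x : ℝ) :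
    ∫ y in {y : ℝ | 1 < x ^ 2 + y ^ 2}, (x + y * I : ℂ) ^ L = orbital L x := by
  have hL1 : (I * (L + 1) : ℂ) ≠ 0 := mul_ne_zero I_ne_zero (by exact_mod_cast (by omega : L + 1 ≠ 0))
  have hn : 1 ≤ ‖(I * (L + 1) : ℂ)‖ := by
    rw [norm_mul, norm_I, one_mul, show (L + 1 : ℂ) = ((L + 1 : ℤ) : ℂ) by push_cast; rfl, norm_intCast]
    exact_mod_cast Int.one_le_abs (by omega : L + 1 ≠ 0)
  have key := (setIntegral_deriv_line (x := x) (C := 1)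
    (F := fun y : ℝ => (x + y * I : ℂ) ^ (L + 1) / (I * (L + 1)))
    (f := fun y : ℝ => (x + y * I : ℂ) ^ L) (fun y hy => ?_)
    ((continuous_line x).continuousOn.zpow₀ _ fun y hy => Or.inl (line_ne_zero hy))
    (fun y hy => ?_) (fun y hy => ?_)).2
  · rw [key, orbital]
    push_cast
    rw [neg_mul, ← sub_eq_add_neg, ← sub_div]
  · have ha : HasDerivAt (fun y : ℝ => (x + y * I : ℂ)) I y := by
      simpa using ((hasDerivAt_id y).ofReal_comp.mul_const I).const_add (x : ℂ)
    refine (((hasDerivAt_zpow (L + 1) _ (Or.inl (line_ne_zero hy))).comp y ha).div_const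
      (I * (L + 1))).congr_deriv ?_
    rw [div_eq_iff hL1, add_sub_cancel_right]
    push_cast
    ring
  · rw [norm_zpow, one_mul]
    exact (norm_line_zpow_le hy hL).1
  · rw [norm_div, norm_zpow, one_mul]
    exact (div_le_self (by positivity) hn).trans (norm_line_zpow_le hy hL).2

/-- The orbital integral of a diagonal matrix coefficient depends on its weight `L = p + q` only. -/
theorem orbital_diagPoly (q : ℕ) : ∀ {p : ℤ}, p + q ≤ -2 → ∀ x : ℝ,
    ∫ y in {y : ℝ | 1 < x ^ 2 + y ^ 2}, diagPoly p q (x + y * I) (x - y * I) =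
      orbital (p + q) x := by
  induction q with
  | zero =>
    intro p hp x
    rw [← orbital_zero hp]
    simp [diagPoly, binom]
  | succ q ih =>
    intro p hp x
    have h : p + 1 + q = p + (q + 1 : ℕ) := by push_cast; ring
    have hs := orbital_diagPoly_succ (p := p + 1) (q := q) (h ▸ hp) x
    rw [add_sub_cancel_right] at hs
    rw [hs, ih (h ▸ hp), h]

theorem orbital_eq_zero {L : ℤ} {x : ℝ} (hx : 1 ≤ |x|) : orbital L x = 0 := by
  have : 1 ≤ x ^ 2 := by rwa [one_le_sq_iff_one_le_abs]
  simp [orbital, Real.sqrt_eq_zero_of_nonpos (by linarith : 1 - x ^ 2 ≤ 0)]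

/-- At `x = cos θ` the orbital integral is the trigonometric function
`-2 sin((L + 1) θ) / (L + 1)`. -/
theorem orbital_cos {L : ℤ} {θ : ℝ} (h0 : 0 ≤ θ) (hπ : θ ≤ Real.pi) :
    orbital L (Real.cos θ) = -2 * Real.sin ((L + 1) * θ) / (L + 1) := by
  have hs : √(1 - Real.cos θ ^ 2) = Real.sin θ := by
    rw [← Real.sin_sq, Real.sqrt_sq (Real.sin_nonneg_of_nonneg_of_le_pi h0 hπ)]
  have e1 : (Real.cos θ - Real.sin θ * I : ℂ) = exp (-(θ * I)) := by
    rw [ofReal_cos, ofReal_sin, ← neg_mul, exp_mul_I, cos_neg, sin_neg]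
    ring
  have e2 : (Real.cos θ + Real.sin θ * I : ℂ) = exp (θ * I) := by
    rw [ofReal_cos, ofReal_sin, exp_mul_I]
  rw [orbital, hs, e1, e2, ← exp_int_mul, ← exp_int_mul]
  rw [ofReal_sin, Complex.sin]
  have h2 : (I : ℂ) * I = -1 := I_mul_I
  rcases eq_or_ne (L + 1 : ℂ) 0 with h | h
  · simp [h]
  rw [div_eq_div_iff (mul_ne_zero I_ne_zero h) h]
  push_cast
  rw [show ((L : ℂ) + 1) * -(θ * I) = -((L + 1) * θ) * I by ring,
    show ((L : ℂ) + 1) * (θ * I) = (L + 1) * θ * I by ring]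
  linear_combination (exp (-((L + 1) * θ) * I) - exp ((L + 1) * θ * I)) * (L + 1) * h2

/-! ### Integrability against the regularized kernel -/

/-- An integrable weight on the line, just beyond the borderline `(1 + |x|)⁻¹`. -/
noncomputable def lineWeight (x : ℝ) : ℝ := (1 + |x|)⁻¹ * ((1 + Real.log (1 + |x|)) ^ 2)⁻¹

theorem one_le_one_add_log {x : ℝ} (hx : 1 ≤ x) : 1 ≤ 1 + Real.log x := by
  linarith [Real.log_nonneg hx]

theorem one_le_one_add_abs (x : ℝ) : 1 ≤ 1 + |x| := by linarith [abs_nonneg x]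

theorem integrable_lineWeight : Integrable lineWeight := by
  have h1 : IntegrableOn lineWeight (Set.Ioi 0) := by
    have hd : ∀ x ∈ Set.Ici (0 : ℝ), HasDerivAt (fun x : ℝ => -(1 + Real.log (1 + x))⁻¹)
        ((1 + x)⁻¹ * ((1 + Real.log (1 + x)) ^ 2)⁻¹) x := by
      intro x hx
      have hx : 0 ≤ x := hx
      have hl : 1 ≤ 1 + Real.log (1 + x) := one_le_one_add_log (by linarith)
      refine (((((hasDerivAt_id x).const_add 1).log (by simp; linarith)).const_add 1).inv
        (by simp; linarith)).neg.congr_deriv ?_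
      simp only [id]
      field_simp
    refine (integrableOn_Ioi_deriv_of_nonneg' (l := 0) hd ?_ ?_).congr_fun ?_ measurableSet_Ioi
    · intro x hx
      have hx : 0 < x := hx
      positivity
    · have h1 : Tendsto (fun x : ℝ => 1 + Real.log (1 + x)) atTop atTop :=
        tendsto_atTop_add_const_left _ _ (Real.tendsto_log_atTop.comp
          (tendsto_atTop_add_const_left _ _ tendsto_id))
      simpa using (tendsto_inv_atTop_zero.comp h1).neg
    · intro x hx
      have hx : 0 < x := hx
      simp [lineWeight, abs_of_pos hx]
  have h2 : IntegrableOn lineWeight (Set.Iic 0) := by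
    rw [integrableOn_Iic_iff_integrableOn_Iio]
    have h := h1.comp_neg
    rw [Set.neg_Ioi, neg_zero] at h
    exact h.congr_fun (fun x _ => by simp [lineWeight]) measurableSet_Iio
  rw [← integrableOn_univ, ← Set.Iic_union_Ioi (a := (0 : ℝ))]
  exact h2.union h1

/-- The regularized kernel grows linearly in `x = Re z₁₁`. -/
theorem le_mul_norm_kernel {A B ε : ℝ} (hB : 0 < B) (hε : 0 < ε) (σ : ℤˣ) (x : ℝ) :
    1 + |x| ≤ ((1 + |A| / B) / ε + B⁻¹) * ‖((A - B * x : ℝ) : ℂ) + ((σ : ℤ) : ℂ) * I * ε‖ := by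
  set d := ((A - B * x : ℝ) : ℂ) + ((σ : ℤ) : ℂ) * I * ε with hd
  have h1 : |A - B * x| ≤ ‖d‖ := by
    have : d.re = A - B * x := by simp [hd]
    rw [← this]
    exact abs_re_le_norm d
  have h2 : ε ≤ ‖d‖ := by
    have : d.im = ((σ : ℤ) : ℝ) * ε := by simp [hd]
    have h3 : |d.im| = ε := by
      rw [this, abs_mul, abs_of_pos hε]
      rcases Int.units_eq_one_or σ with h | h <;> simp [h]
    rw [← h3]
    exact abs_im_le_norm d
  have h3 : |x| ≤ (|A - B * x| + |A|) / B := by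
    rw [le_div_iff₀ hB, ← abs_of_pos hB, ← abs_mul, abs_of_pos hB]
    have := abs_sub_abs_le_abs_sub (B * x) A
    rw [abs_sub_comm (B * x) A] at this
    rw [mul_comm x B]
    linarith
  have h4 : 1 + |A| / B ≤ (1 + |A| / B) / ε * ‖d‖ := by
    rw [div_mul_eq_mul_div, le_div_iff₀ hε]
    gcongr
  have h5 : (|A - B * x| + |A|) / B = B⁻¹ * |A - B * x| + |A| / B := by ring
  have h6 : B⁻¹ * |A - B * x| ≤ B⁻¹ * ‖d‖ := by gcongr
  rw [add_mul]
  linarith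

theorem kernel_ne_zero {ε : ℝ} (hε : 0 < ε) (σ : ℤˣ) (x : ℝ) :
    (x : ℂ) + ((σ : ℤ) : ℂ) * I * ε ≠ 0 := by
  intro h
  have := congrArg Complex.im h
  rcases Int.units_eq_one_or σ with h | h <;> simp [h] at this <;> linarith

/-- Half of the fourth power of the logarithm makes the weight integrable in `Re a`, the other half
in `Im a`. -/
theorem log_weight_le {a : ℂ} (ha : 1 ≤ ‖a‖) :
    (‖a‖ * (1 + Real.log ‖a‖) ^ 4)⁻¹ * (1 + |a.re|)⁻¹ ≤
      32 * (lineWeight a.re * lineWeight a.im) := by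
  have key : ∀ t : ℝ, |t| ≤ ‖a‖ → 1 + |t| ≤ 2 * ‖a‖ ∧
      1 + Real.log (1 + |t|) ≤ 2 * (1 + Real.log ‖a‖) := by
    intro t ht
    have h1 : 1 + |t| ≤ 2 * ‖a‖ := by linarith
    refine ⟨h1, ?_⟩
    have h2 := Real.log_le_log (by positivity) h1
    rw [Real.log_mul (by norm_num) (by positivity)] at h2
    linarith [Real.log_nonneg ha, Real.log_two_lt_d9]
  have hx := (key _ (abs_re_le_norm a)).2
  obtain ⟨hy1, hy⟩ := key _ (abs_im_le_norm a)
  have ex := one_le_one_add_log (one_le_one_add_abs a.re)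
  have ey := one_le_one_add_log (one_le_one_add_abs a.im)
  have ea := one_le_one_add_log ha
  unfold lineWeight
  rw [show 32 * ((1 + |a.re|)⁻¹ * ((1 + Real.log (1 + |a.re|)) ^ 2)⁻¹ *
      ((1 + |a.im|)⁻¹ * ((1 + Real.log (1 + |a.im|)) ^ 2)⁻¹)) =
      32 * ((1 + |a.im|) * ((1 + Real.log (1 + |a.re|)) ^ 2 * (1 + Real.log (1 + |a.im|)) ^ 2))⁻¹ *
      (1 + |a.re|)⁻¹ by
    rw [mul_inv, mul_inv]
    ring]
  refine mul_le_mul_of_nonneg_right ?_ (by positivity)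
  rw [← div_eq_mul_inv, inv_eq_one_div, div_le_div_iff₀ (by positivity) (by positivity), one_mul]
  calc (1 + |a.im|) * ((1 + Real.log (1 + |a.re|)) ^ 2 * (1 + Real.log (1 + |a.im|)) ^ 2)
      ≤ (2 * ‖a‖) * ((2 * (1 + Real.log ‖a‖)) ^ 2 * (2 * (1 + Real.log ‖a‖)) ^ 2) := by gcongr
    _ = 32 * (‖a‖ * (1 + Real.log ‖a‖) ^ 4) := by ring

theorem integrable_lineWeight_mul : Integrable fun a : ℂ => lineWeight a.re * lineWeight a.im :=
  Complex.volume_preserving_equiv_real_prod.integrable_comp_emb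
    (MeasurableEquiv.measurableEmbedding _) |>.2 (integrable_lineWeight.mul_prod integrable_lineWeight)

/-- The regularized kernel `(A - B x ± iε)⁻¹`. -/
noncomputable def regKernel (σ : ℤˣ) (A B ε x : ℝ) : ℂ :=
  (((A - B * x : ℝ) : ℂ) + ((σ : ℤ) : ℂ) * I * ε)⁻¹

theorem continuous_regKernel (σ : ℤˣ) (A B : ℝ) {ε : ℝ} (hε : 0 < ε) :
    Continuous (regKernel σ A B ε) := by
  unfold regKernel
  exact Continuous.inv₀ (by fun_prop) fun x => kernel_ne_zero hε σ _

theorem norm_regKernel_le {A B ε : ℝ} (hB : 0 < B) (hε : 0 < ε) (σ : ℤˣ) (x : ℝ) :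
    ‖regKernel σ A B ε x‖ ≤ ((1 + |A| / B) / ε + B⁻¹) * (1 + |x|)⁻¹ := by
  rw [regKernel, norm_inv, ← div_eq_mul_inv, le_div_iff₀ (by positivity), inv_mul_le_iff₀
    (norm_pos_iff.2 (kernel_ne_zero hε σ _)), mul_comm]
  exact le_mul_norm_kernel hB hε σ x

/-- A function on the unit hyperboloid with the decay of the Schwartz space is integrable against
every kernel that decays like the regularized one. -/
theorem integrable_mul_kernel {G : ℂ × ℝ → ℂ} {M K : ℝ} {k : ℝ → ℂ} (hk : Continuous k)
    (hK : ∀ x, ‖k x‖ ≤ K * (1 + |x|)⁻¹) (hG : AEStronglyMeasurable G unitMeasure)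
    (hM : ∀ p : ℂ × ℝ, 1 < ‖p.1‖ → ‖G p‖ ≤ M * (‖p.1‖ * (1 + Real.log ‖p.1‖) ^ 4)⁻¹) :
    Integrable (fun p => G p * k p.1.re) unitMeasure := by
  have hK0 : 0 ≤ K := nonneg_of_mul_nonneg_left ((norm_nonneg _).trans (hK 0)) (by simp)
  have hdom : Integrable (fun p : ℂ × ℝ => M * K * (32 * (lineWeight p.1.re * lineWeight p.1.im)))
      unitMeasure := by
    have h1 : Integrable (fun a : ℂ => M * K * (32 * (lineWeight a.re * lineWeight a.im)))
      (volume.restrict {a : ℂ | 1 < ‖a‖}) :=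
      ((integrable_lineWeight_mul.const_mul 32).const_mul (M * K)).integrableOn
    exact h1.comp_fst _
  refine hdom.mono' (hG.mul (Continuous.aestronglyMeasurable (by fun_prop))) ?_
  filter_upwards [ae_unitMeasure] with p hp
  have e1 := one_le_one_add_log hp.le
  have hM0 : 0 ≤ M := nonneg_of_mul_nonneg_left ((norm_nonneg _).trans (hM p hp)) (by positivity)
  rw [norm_mul]
  calc _ ≤ M * (‖p.1‖ * (1 + Real.log ‖p.1‖) ^ 4)⁻¹ * (K * (1 + |p.1.re|)⁻¹) :=
        mul_le_mul (hM p hp) (hK _) (norm_nonneg _) (by positivity)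
    _ = M * K * ((‖p.1‖ * (1 + Real.log ‖p.1‖) ^ 4)⁻¹ * (1 + |p.1.re|)⁻¹) := by ring
    _ ≤ _ := mul_le_mul_of_nonneg_left (log_weight_le hp.le) (by positivity)

theorem one_add_log_pow_le {t : ℝ} (ht : 1 ≤ t) : (1 + Real.log t) ^ 4 ≤ 256 * t := by
  have h0 : 0 < t := by linarith
  have h1 := Real.log_le_sub_one_of_pos (Real.rpow_pos_of_pos h0 (1 / 4))
  rw [Real.log_rpow h0] at h1
  have h2 : 1 + Real.log t ≤ 4 * t ^ (1 / 4 : ℝ) := by linarith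
  calc (1 + Real.log t) ^ 4 ≤ (4 * t ^ (1 / 4 : ℝ)) ^ 4 := by
        have := one_le_one_add_log ht
        gcongr
    _ = 256 * t := by
        rw [mul_pow, ← Real.rpow_natCast (t ^ (1 / 4 : ℝ)), ← Real.rpow_mul h0.le]
        norm_num

/-- The matrix coefficients with `l ≤ -1` have the decay of the Schwartz space on the hyperboloid.
-/
theorem zpow_le_log_weight {t : ℝ} (ht : 1 ≤ t) {L : ℤ} (hL : L ≤ -2) :
    t ^ L ≤ 256 * (t * (1 + Real.log t) ^ 4)⁻¹ := by
  have e1 := one_le_one_add_log ht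
  calc t ^ L ≤ t ^ (-2 : ℤ) := zpow_le_zpow_right₀ ht hL
    _ = (t * t)⁻¹ := by rw [zpow_neg, ← sq]; rfl
    _ ≤ _ := by
      rw [← div_eq_mul_inv, inv_eq_one_div, div_le_div_iff₀ (by positivity) (by positivity)]
      nlinarith [one_add_log_pow_le ht]

/-! ### The Poisson integral in the coordinates of the unit hyperboloid -/

theorem mul_one' (w : HR) : mul w (ofPair 1 0) = w := by
  apply HR_ext <;> simp [z11_mul, z12_mul, z11_ofPair, z12_ofPair]

/-- The scalar `√N(W)` and the point of the unit hyperboloid below `W`. -/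
theorem exists_unit_smul {W : HR} (hW : W ∈ HRplus) :
    ∃ (ρ : ℝ) (w : HR), 0 < ρ ∧ N w = 1 ∧ ρ ^ 2 = N W ∧ W = ρ • w := by
  have h : 0 < N W := hW
  refine ⟨√(N W), (√(N W))⁻¹ • W, Real.sqrt_pos.2 h, ?_, Real.sq_sqrt h.le, ?_⟩
  · rw [N_smul, inv_pow, Real.sq_sqrt h.le, inv_mul_cancel₀ h.ne']
  · rw [smul_inv_smul₀ (Real.sqrt_pos.2 h).ne']

/-- The translation by `w` carries `W = ρ w` to the scalar `ρ`, and `N(R u - ρ)` depends on the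
real part of `z₁₁(u)` only. -/
theorem N_sub_smul {R ρ : ℝ} {w : HR} (hw : N w = 1) {p : ℂ × ℝ} (hp : 1 < ‖p.1‖) :
    N (R • mul w (unitPt p) - ρ • w) = R ^ 2 + ρ ^ 2 - 2 * R * ρ * p.1.re := by
  have h1 : R • mul w (unitPt p) - ρ • w = mul w (R • unitPt p - ρ • ofPair 1 0) := by
    rw [mul_sub', mul_smul', mul_smul', mul_one']
  have h2 := N_unitPt hp
  rw [N_eq, z11_unitPt] at h2
  rw [h1, N_mul, hw, one_mul, N_eq, z11_sub, z12_sub, z11_smul, z12_smul, z11_smul, z12_smul,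
    z11_ofPair, z12_ofPair, z11_unitPt]
  simp only [normSq_apply, sub_re, sub_im, mul_re, mul_im, ofReal_re, ofReal_im, one_re, one_im,
    zero_re, zero_im] at h2 ⊢
  linear_combination R ^ 2 * h2

theorem continuousOn_kernel {F : HR → ℂ} (hF : ContinuousOn F HRplus) (σ : ℤˣ) (W : HR) {ε : ℝ}
    (hε : 0 < ε) :
    ContinuousOn (fun X => F X / ((N (X - W) : ℂ) + ((σ : ℤ) : ℂ) * I * ε)) HRplus := by
  refine hF.div (Continuous.continuousOn ?_) fun X _ => kernel_ne_zero hε σ _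
  have := continuous_N.comp (continuous_id.sub (continuous_const (y := W)))
  exact (continuous_ofReal.comp this).add continuous_const

/-- The regularized Poisson integral in the parameters centred at `w = W / √N(W)`: the kernel is a
function of `Re z₁₁`. -/
theorem poissonIntegral_eq {R ρ ε : ℝ} (hR : 0 < R) {w : HR} (hw : N w = 1) {φ : HR → ℂ}
    (hφ : ContinuousOn (degOp φ) HRplus) (σ : ℤˣ) (hε : 0 < ε) :
    poissonIntegral σ R φ (ρ • w) ε = (2 * (Real.pi : ℂ) ^ 2)⁻¹ * (R ^ 2 *
      ∫ p, degOp φ (R • mul w (unitPt p)) * regKernel σ (R ^ 2 + ρ ^ 2) (2 * R * ρ) ε p.1.re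
        ∂unitMeasure) := by
  unfold poissonIntegral poissonIntegrand
  congr 1
  rw [integral_surface_eq hR hw (continuousOn_kernel hφ σ (ρ • w) hε)]
  congr 1
  refine integral_congr_ae ?_
  filter_upwards [ae_unitMeasure] with p hp
  rw [N_sub_smul hw hp, div_eq_mul_inv, regKernel]

theorem aestronglyMeasurable_comp_unitPt {R : ℝ} (hR : 0 < R) {w : HR} (hw : N w = 1) {F : HR → ℂ}
    (hF : ContinuousOn F HRplus) :
    AEStronglyMeasurable (fun p => F (R • mul w (unitPt p))) unitMeasure :=
  (aestronglyMeasurable_map hR hw hF).comp_aemeasurable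
    (((continuous_mul_left w).comp continuous_unitPt).const_smul R).aemeasurable

theorem integrable_poissonIntegrand {R ρ ε M : ℝ} (hR : 0 < R) (hρ : 0 < ρ) {w : HR} (hw : N w = 1)
    {φ : HR → ℂ} (hφ : ContinuousOn (degOp φ) HRplus) (σ : ℤˣ) (hε : 0 < ε)
    (hM : ∀ p : ℂ × ℝ, 1 < ‖p.1‖ → ‖degOp φ (R • mul w (unitPt p))‖ ≤
      M * (‖p.1‖ * (1 + Real.log ‖p.1‖) ^ 4)⁻¹) :
    Integrable (poissonIntegrand σ φ (ρ • w) ε) (surfaceMeasure R) := by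
  refine (integrable_surface_iff hR hw (continuousOn_kernel hφ σ (ρ • w) hε)).2 ?_
  refine (integrable_mul_kernel (continuous_regKernel σ (R ^ 2 + ρ ^ 2) (2 * R * ρ) hε)
    (norm_regKernel_le (by positivity) hε σ)
    (aestronglyMeasurable_comp_unitPt hR hw hφ) hM).congr ?_
  filter_upwards [ae_unitMeasure] with p hp
  rw [N_sub_smul hw hp, div_eq_mul_inv, regKernel]

/-! ### The radial integral -/

theorem abs_sin_nat_mul_le (κ : ℕ) (θ : ℝ) : |Real.sin (κ * θ)| ≤ κ * |Real.sin θ| := by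
  induction κ with
  | zero => simp
  | succ κ ih =>
    push_cast
    rw [add_mul, one_mul, Real.sin_add]
    refine (abs_add_le _ _).trans ?_
    rw [abs_mul, abs_mul, add_mul, one_mul]
    exact add_le_add ((mul_le_of_le_one_right (abs_nonneg _) (Real.abs_cos_le_one _)).trans ih)
      (mul_le_of_le_one_left (abs_nonneg _) (Real.abs_cos_le_one _))

theorem sin_sq_le_two_mul (θ : ℝ) : Real.sin θ ^ 2 ≤ 2 * (1 - Real.cos θ) := by
  rw [Real.sin_sq]
  nlinarith [Real.cos_le_one θ, Real.neg_one_le_cos θ]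

theorem cos_lt_one_of_mem {θ : ℝ} (h : θ ∈ Set.Ioo 0 Real.pi) : Real.cos θ < 1 := by
  rw [← Real.cos_zero]
  exact Real.cos_lt_cos_of_nonneg_of_le_pi le_rfl h.2.le h.1

/-- The denominators of the regularized kernel do not vanish faster than `sin² θ`. -/
theorem sin_mul_sin_div_le {A B : ℝ} (hB : 0 < B) (hAB : B ≤ A) (κ : ℕ) {θ : ℝ}
    (h : θ ∈ Set.Ioo 0 Real.pi) :
    |Real.sin (κ * θ) * Real.sin θ| / (A - B * Real.cos θ) ≤ 2 * κ / B := by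
  have h1 := cos_lt_one_of_mem h
  have h2 : 0 < A - B * Real.cos θ := by nlinarith
  rw [div_le_div_iff₀ h2 hB, abs_mul]
  have h3 := abs_sin_nat_mul_le κ θ
  calc |Real.sin (κ * θ)| * |Real.sin θ| * B ≤ κ * |Real.sin θ| * |Real.sin θ| * B := by gcongr
    _ = κ * Real.sin θ ^ 2 * B := by rw [← sq_abs (Real.sin θ)]; ring
    _ ≤ κ * (2 * (1 - Real.cos θ)) * B := by gcongr; exact sin_sq_le_two_mul θ
    _ = 2 * κ * (B - B * Real.cos θ) := by ring
    _ ≤ _ := by gcongr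

/-- The integral of `sin κθ sin θ` against `(1 + r² - 2 r cos θ)⁻¹`. -/
noncomputable def radialIntegral (r : ℝ) (κ : ℕ) : ℝ :=
  ∫ θ in 0..Real.pi, Real.sin (κ * θ) * Real.sin θ / (1 + r ^ 2 - 2 * r * Real.cos θ)

theorem radial_denom_pos {r : ℝ} (hr : 0 < r) {θ : ℝ} (h : θ ∈ Set.Ioo 0 Real.pi) :
    0 < 1 + r ^ 2 - 2 * r * Real.cos θ := by
  nlinarith [cos_lt_one_of_mem h, sq_nonneg (1 - r)]

/-- The end points of the interval are left out because the denominators in use may vanish there. -/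
theorem integral_Ioo_congr {f g : ℝ → ℝ} (h : ∀ θ ∈ Set.Ioo 0 Real.pi, f θ = g θ) :
    ∫ θ in 0..Real.pi, f θ = ∫ θ in 0..Real.pi, g θ := by
  rw [intervalIntegral.integral_of_le Real.pi_pos.le, intervalIntegral.integral_of_le Real.pi_pos.le,
    integral_Ioc_eq_integral_Ioo, integral_Ioc_eq_integral_Ioo]
  exact setIntegral_congr_fun measurableSet_Ioo h

theorem intervalIntegrable_radial {r : ℝ} (hr : 0 < r) (κ : ℕ) :
    IntervalIntegrable (fun θ => Real.sin (κ * θ) * Real.sin θ / (1 + r ^ 2 - 2 * r * Real.cos θ))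
      volume 0 Real.pi := by
  rw [intervalIntegrable_iff_integrableOn_Ioo_of_le Real.pi_pos.le]
  refine Integrable.mono' (g := fun _ => 2 * κ / (2 * r)) (integrable_const _)
    (Measurable.aestronglyMeasurable (by fun_prop)) ?_
  filter_upwards [ae_restrict_mem measurableSet_Ioo] with θ hθ
  rw [Real.norm_eq_abs, abs_div, abs_of_pos (radial_denom_pos hr hθ)]
  exact sin_mul_sin_div_le (by positivity) (by nlinarith [sq_nonneg (1 - r)]) κ hθ

theorem integral_sin_nat_mul_sin (κ : ℕ) (hκ : 1 ≤ κ) :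
    ∫ θ in 0..Real.pi, Real.sin (κ * θ) * Real.sin θ = if κ = 1 then Real.pi / 2 else 0 := by
  split_ifs with h
  · simp only [h, Nat.cast_one, one_mul, ← sq]
    rw [integral_sin_sq]
    simp
  · have h1 : (κ : ℝ) - 1 ≠ 0 := by
      rw [sub_ne_zero]
      exact_mod_cast h
    have h2 : (κ : ℝ) + 1 ≠ 0 := by positivity
    have hd : ∀ θ ∈ Set.uIcc 0 Real.pi, HasDerivAt (fun θ : ℝ =>
        Real.sin ((κ - 1) * θ) / (κ - 1) / 2 - Real.sin ((κ + 1) * θ) / (κ + 1) / 2)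
        (Real.sin (κ * θ) * Real.sin θ) θ := by
      intro θ _
      have d1 : HasDerivAt (fun θ : ℝ => Real.sin ((κ - 1) * θ)) (Real.cos ((κ - 1) * θ) * (κ - 1)) θ := by
        simpa using ((hasDerivAt_id θ).const_mul ((κ : ℝ) - 1)).sin
      have d2 : HasDerivAt (fun θ : ℝ => Real.sin ((κ + 1) * θ)) (Real.cos ((κ + 1) * θ) * (κ + 1)) θ := by
        simpa using ((hasDerivAt_id θ).const_mul ((κ : ℝ) + 1)).sin
      refine (((d1.div_const _).div_const 2).sub ((d2.div_const _).div_const 2)).congr_deriv ?_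
      rw [mul_div_cancel_right₀ _ h1, mul_div_cancel_right₀ _ h2, sub_mul, add_mul, one_mul,
        Real.cos_sub, Real.cos_add]
      ring
    rw [intervalIntegral.integral_eq_sub_of_hasDerivAt hd (Continuous.intervalIntegrable (by fun_prop) _ _)]
    have e1 : Real.sin ((κ - 1) * Real.pi) = 0 := by
      have := Real.sin_int_mul_pi ((κ : ℤ) - 1)
      push_cast at this
      exact this
    have e2 : Real.sin ((κ + 1) * Real.pi) = 0 := by
      exact_mod_cast Real.sin_nat_mul_pi (κ + 1)
    simp [e1, e2]

/-- The recursion comes from `sin((κ+2)θ) + sin(κθ) = 2 cos θ sin((κ+1)θ)`. -/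
theorem radialIntegral_rec {r : ℝ} (hr : 0 < r) (κ : ℕ) :
    r * radialIntegral r (κ + 2) + r * radialIntegral r κ - (1 + r ^ 2) * radialIntegral r (κ + 1) =
      -(if κ = 0 then Real.pi / 2 else 0) := by
  have h := integral_sin_nat_mul_sin (κ + 1) (by omega)
  simp only [Nat.add_eq_right] at h
  rw [← h, ← intervalIntegral.integral_neg]
  simp only [radialIntegral]
  rw [← intervalIntegral.integral_const_mul, ← intervalIntegral.integral_const_mul,
    ← intervalIntegral.integral_const_mul,
    ← intervalIntegral.integral_add ((intervalIntegrable_radial hr _).const_mul _)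
      ((intervalIntegrable_radial hr _).const_mul _),
    ← intervalIntegral.integral_sub (((intervalIntegrable_radial hr _).const_mul _).add
      ((intervalIntegrable_radial hr _).const_mul _)) ((intervalIntegrable_radial hr _).const_mul _)]
  refine integral_Ioo_congr fun θ hθ => ?_
  have hd := (radial_denom_pos hr hθ).ne'
  have e : Real.sin ((κ + 2 : ℕ) * θ) = 2 * Real.cos θ * Real.sin ((κ + 1 : ℕ) * θ) -
      Real.sin (κ * θ) := by
    push_cast
    rw [show ((κ : ℝ) + 2) * θ = (κ + 1) * θ + θ by ring, show (κ : ℝ) * θ = (κ + 1) * θ - θ by ring,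
      Real.sin_add, Real.sin_sub]
    ring
  rw [e]
  have e2 : ∀ c s t u D : ℝ, D ≠ 0 → D = 1 + r ^ 2 - 2 * r * c →
      r * ((2 * c * s - t) * u / D) + r * (t * u / D) - (1 + r ^ 2) * (s * u / D) = -(s * u) := by
    intro c s t u D h0 h1
    have : r * ((2 * c * s - t) * u / D) + r * (t * u / D) - (1 + r ^ 2) * (s * u / D) =
        -(s * u) * ((1 + r ^ 2 - 2 * r * c) / D) := by ring
    rw [this, ← h1, div_self h0, mul_one]
  exact e2 _ _ _ _ _ hd rfl

theorem radialIntegral_zero (r : ℝ) : radialIntegral r 0 = 0 := by simp [radialIntegral]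

theorem abs_radialIntegral_le {r : ℝ} (hr : 0 < r) (hr1 : r < 1) (κ : ℕ) :
    |radialIntegral r κ| ≤ ((1 - r) ^ 2)⁻¹ * Real.pi := by
  have h := intervalIntegral.norm_integral_le_of_norm_le_const (a := 0) (b := Real.pi)
    (C := ((1 - r) ^ 2)⁻¹)
    (f := fun θ => Real.sin (κ * θ) * Real.sin θ / (1 + r ^ 2 - 2 * r * Real.cos θ)) ?_
  · rwa [sub_zero, abs_of_pos Real.pi_pos] at h
  · intro θ _
    have hd : (1 - r) ^ 2 ≤ 1 + r ^ 2 - 2 * r * Real.cos θ := by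
      nlinarith [Real.cos_le_one θ]
    have h0 : 0 < (1 - r) ^ 2 := by nlinarith
    rw [norm_div, norm_mul, Real.norm_eq_abs, Real.norm_eq_abs, Real.norm_eq_abs,
      abs_of_pos (h0.trans_le hd), ← one_div]
    refine div_le_div₀ zero_le_one ?_ h0 hd
    exact mul_le_one₀ (Real.abs_sin_le_one _) (abs_nonneg _) (Real.abs_sin_le_one _)

/-- The recursion in `κ` has a one-parameter family of solutions; boundedness (and, for `r = 1`,
the elementary value at `κ = 1`) singles out the geometric one. -/
theorem radialIntegral_eq {r : ℝ} (hr : 0 < r) (hr1 : r ≤ 1) (κ : ℕ) :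
    radialIntegral r (κ + 1) = Real.pi / 2 * r ^ κ := by
  have hrec : ∀ κ : ℕ, r * (radialIntegral r (κ + 3) - r * radialIntegral r (κ + 2)) =
      radialIntegral r (κ + 2) - r * radialIntegral r (κ + 1) := by
    intro κ
    have := radialIntegral_rec hr (κ + 1)
    simp only [Nat.add_eq_zero_iff, one_ne_zero, and_false, if_false] at this
    linear_combination this
  have h0 := radialIntegral_rec hr 0
  rw [radialIntegral_zero] at h0
  simp only [if_true, zero_add] at h0
  have hK : radialIntegral r 2 - r * radialIntegral r 1 = 0 := by
    rcases hr1.lt_or_eq with h | h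
    -- the differences `J (κ + 2) - r J (κ + 1)` grow like `r ^ (-κ)` unless they vanish
    · have hpow : ∀ κ : ℕ, r ^ κ * (radialIntegral r (κ + 2) - r * radialIntegral r (κ + 1)) =
          radialIntegral r 2 - r * radialIntegral r 1 := by
        intro κ
        induction κ with
        | zero => simp
        | succ κ ih => rw [← ih, ← hrec κ]; ring
      have hle : ∀ κ : ℕ, |radialIntegral r 2 - r * radialIntegral r 1| ≤
          r ^ κ * (2 * (((1 - r) ^ 2)⁻¹ * Real.pi)) := by
        intro κ
        rw [← hpow κ, abs_mul, abs_of_pos (pow_pos hr κ)]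
        have h1 := abs_radialIntegral_le hr h (κ + 2)
        have h2 := abs_radialIntegral_le hr h (κ + 1)
        have h3 : |r * radialIntegral r (κ + 1)| ≤ ((1 - r) ^ 2)⁻¹ * Real.pi := by
          rw [abs_mul, abs_of_pos hr]
          exact (mul_le_of_le_one_left (abs_nonneg _) hr1).trans h2
        have h4 := abs_sub (radialIntegral r (κ + 2)) (r * radialIntegral r (κ + 1))
        gcongr
        linarith
      have hlim : Tendsto (fun κ : ℕ => r ^ κ * (2 * (((1 - r) ^ 2)⁻¹ * Real.pi))) atTop (𝓝 0) := by
        simpa using (tendsto_pow_atTop_nhds_zero_of_lt_one hr.le h).mul_const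
          (2 * (((1 - r) ^ 2)⁻¹ * Real.pi))
      exact abs_nonpos_iff.1 (ge_of_tendsto' hlim hle)
    -- for `r = 1` the denominator at `κ = 1` cancels against `sin² θ`
    · subst h
      have h1 : radialIntegral 1 1 = Real.pi / 2 := by
        have : radialIntegral 1 1 = ∫ θ in 0..Real.pi, (1 / 2 + Real.cos θ * (1 / 2)) := by
          refine integral_Ioo_congr fun θ hθ => ?_
          have hd := (radial_denom_pos hr hθ).ne'
          rw [div_eq_iff hd]
          have := Real.sin_sq θ
          simp only [Nat.cast_one, one_mul]
          linear_combination this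
        rw [this, intervalIntegral.integral_add (by simp)
          (Continuous.intervalIntegrable (by fun_prop) _ _)]
        simp [integral_cos]
        ring
      rw [h1] at h0 ⊢
      linarith
  have hone : radialIntegral r 1 = Real.pi / 2 := by
    have : radialIntegral r 2 = r * radialIntegral r 1 := by linarith
    rw [this] at h0
    linarith
  have hstep : ∀ κ : ℕ, radialIntegral r (κ + 2) - r * radialIntegral r (κ + 1) = 0 := by
    intro κ
    induction κ with
    | zero => exact hK
    | succ κ ih =>
      have := hrec κ
      rw [ih] at this
      exact (mul_eq_zero.1 this).resolve_left hr.ne'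
  induction κ with
  | zero => simpa using hone
  | succ κ ih =>
    have := hstep κ
    rw [ih] at this
    rw [pow_succ]
    linarith

/-! ### The limit of the radial integral -/

/-- The orbital integrals are supported in `[-1, 1]`, which is parametrized by `x = cos θ`. -/
theorem integral_mul_orbital (κ : ℕ) (k : ℝ → ℂ) :
    ∫ x, k x * orbital (-(κ + 2)) x = ∫ θ in Set.Ioo 0 Real.pi,
      (-2 / (κ + 1) : ℂ) * (((Real.sin ((κ + 1 : ℕ) * θ) * Real.sin θ : ℝ) : ℂ) * k (Real.cos θ)) := by
  have h1 : ∫ x in Set.Icc (-1) 1, k x * orbital (-(κ + 2)) x = ∫ x, k x * orbital (-(κ + 2)) x := by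
    refine setIntegral_eq_integral_of_forall_compl_eq_zero fun x hx => ?_
    rw [orbital_eq_zero, mul_zero]
    by_contra! h
    exact hx (abs_le.1 h.le)
  rw [← h1, ← Real.bijOn_cos.image_eq, integral_image_eq_integral_abs_deriv_smul measurableSet_Icc
    (fun x _ => (Real.hasDerivAt_cos x).hasDerivWithinAt) Real.injOn_cos, integral_Icc_eq_integral_Ioo]
  refine setIntegral_congr_fun measurableSet_Ioo fun θ hθ => ?_
  rw [orbital_cos hθ.1.le hθ.2.le, abs_neg, abs_of_pos (Real.sin_pos_of_mem_Ioo hθ), real_smul]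
  have e1 : ((-(κ + 2) : ℤ) + 1 : ℂ) = -(κ + 1) := by push_cast; ring
  have e2 : (((-(κ + 2) : ℤ) + 1) * θ : ℝ) = -((κ + 1 : ℕ) * θ) := by push_cast; ring
  rw [e1, e2, Real.sin_neg]
  push_cast
  have : (κ + 1 : ℂ) ≠ 0 := by exact_mod_cast κ.succ_ne_zero
  field_simp

theorem tendsto_regKernel (σ : ℤˣ) {A B x : ℝ} (h : A - B * x ≠ 0) :
    Tendsto (fun ε => regKernel σ A B ε x) (𝓝[>] 0) (𝓝 ((A - B * x : ℝ) : ℂ)⁻¹) := by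
  unfold regKernel
  refine Tendsto.inv₀ ?_ (ofReal_ne_zero.2 h)
  have : Continuous fun ε : ℝ => ((A - B * x : ℝ) : ℂ) + ((σ : ℤ) : ℂ) * I * ε := by fun_prop
  have h2 := this.tendsto 0
  simp only [ofReal_zero, mul_zero, add_zero] at h2
  exact h2.mono_left nhdsWithin_le_nhds

theorem norm_regKernel_le_inv (σ : ℤˣ) {A B ε x : ℝ} (h : 0 < A - B * x) :
    ‖regKernel σ A B ε x‖ ≤ (A - B * x)⁻¹ := by
  rw [regKernel, norm_inv]
  refine inv_anti₀ h ?_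
  refine (le_abs_self _).trans (le_trans (le_of_eq ?_) (abs_re_le_norm _))
  simp

theorem measurable_regKernel (σ : ℤˣ) (A B ε : ℝ) : Measurable (regKernel σ A B ε) := by
  unfold regKernel
  fun_prop

/-- Removing the regularization in the radial integral: dominated convergence. -/
theorem tendsto_integral_regKernel {A B : ℝ} (hB : 0 < B) (hAB : B ≤ A) (κ : ℕ) (σ : ℤˣ) :
    Tendsto (fun ε => ∫ x, regKernel σ A B ε x * orbital (-(κ + 2)) x) (𝓝[>] 0)
      (𝓝 ((-2 / (κ + 1) : ℂ) * ((∫ θ in 0..Real.pi, Real.sin ((κ + 1 : ℕ) * θ) * Real.sin θ /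
        (A - B * Real.cos θ) : ℝ) : ℂ))) := by
  have hpos : ∀ θ ∈ Set.Ioo 0 Real.pi, 0 < A - B * Real.cos θ := fun θ hθ => by
    nlinarith [cos_lt_one_of_mem hθ]
  simp_rw [integral_mul_orbital, integral_const_mul]
  refine Tendsto.const_mul _ ?_
  rw [intervalIntegral.integral_of_le Real.pi_pos.le, integral_Ioc_eq_integral_Ioo,
    ← integral_complex_ofReal]
  refine tendsto_integral_filter_of_dominated_convergence (fun _ => 2 * (κ + 1 : ℕ) / B)
    (Eventually.of_forall fun ε => ?_) (Eventually.of_forall fun ε => ?_) (integrable_const _) ?_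
  · refine Measurable.aestronglyMeasurable ?_
    exact Measurable.mul (by fun_prop) ((measurable_regKernel σ A B ε).comp Real.measurable_cos)
  · filter_upwards [ae_restrict_mem measurableSet_Ioo] with θ hθ
    rw [norm_mul, norm_real, Real.norm_eq_abs]
    refine le_trans ?_ (sin_mul_sin_div_le hB hAB (κ + 1) hθ)
    rw [div_eq_mul_inv]
    exact mul_le_mul_of_nonneg_left (norm_regKernel_le_inv σ (hpos θ hθ)) (abs_nonneg _)
  · filter_upwards [ae_restrict_mem measurableSet_Ioo] with θ hθ
    rw [ofReal_div, div_eq_mul_inv]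
    exact (tendsto_regKernel σ (hpos θ hθ).ne').const_mul _

/-- The radial integral in homogeneous form, with `r = m / M ≤ 1`. -/
theorem integral_sin_mul_sin_div {m M : ℝ} (hm : 0 < m) (hmM : m ≤ M) (κ : ℕ) :
    ∫ θ in 0..Real.pi, Real.sin ((κ + 1 : ℕ) * θ) * Real.sin θ /
      (m ^ 2 + M ^ 2 - 2 * m * M * Real.cos θ) = Real.pi / 2 * (m ^ κ / M ^ (κ + 2)) := by
  have hM : 0 < M := hm.trans_le hmM
  have h := radialIntegral_eq (div_pos hm hM) ((div_le_one hM).2 hmM) κ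
  have h2 : ∀ θ : ℝ, Real.sin ((κ + 1 : ℕ) * θ) * Real.sin θ /
      (m ^ 2 + M ^ 2 - 2 * m * M * Real.cos θ) = (M ^ 2)⁻¹ * (Real.sin ((κ + 1 : ℕ) * θ) * Real.sin θ /
        (1 + (m / M) ^ 2 - 2 * (m / M) * Real.cos θ)) := by
    intro θ
    have : m ^ 2 + M ^ 2 - 2 * m * M * Real.cos θ =
        M ^ 2 * (1 + (m / M) ^ 2 - 2 * (m / M) * Real.cos θ) := by
      field_simp
      ring
    rw [this, ← div_div, div_right_comm, div_eq_inv_mul _ (M ^ 2)]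
  simp_rw [h2]
  rw [intervalIntegral.integral_const_mul]
  rw [radialIntegral] at h
  rw [h, div_pow, pow_add]
  field_simp

/-! ### The Poisson integrals of the matrix coefficients -/

/-- The differential equation of Euler for homogeneous functions, at a single point. -/
theorem degOp_of_homogeneous {φ : HR → ℂ} {X : HR} {d : ℤ} (hd : DifferentiableAt ℝ φ X)
    (hom : ∀ t : ℝ, 0 < t → φ (t • X) = (t : ℂ) ^ d * φ X) : degOp φ X = (d + 1) * φ X := by
  have h1 : HasDerivAt (fun t : ℝ => φ (t • X)) (fderiv ℝ φ X X) 1 := by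
    have h0 : HasDerivAt (fun t : ℝ => t • X) X 1 := by
      simpa using (hasDerivAt_id (1 : ℝ)).smul_const X
    have hd' : HasFDerivAt φ (fderiv ℝ φ X) ((1 : ℝ) • X) := by
      rw [one_smul]
      exact hd.hasFDerivAt
    exact hd'.comp_hasDerivAt (1 : ℝ) h0
  have h2 : HasDerivAt (fun t : ℝ => (t : ℂ) ^ d * φ X) (d * φ X) 1 := by
    have h3 : HasDerivAt (fun z : ℂ => z ^ d) (d * ((1 : ℝ) : ℂ) ^ (d - 1)) ((1 : ℝ) : ℂ) :=
      hasDerivAt_zpow d _ (Or.inl (by simp))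
    simpa using (h3.comp_ofReal).mul_const (φ X)
  have h3 : (fun t : ℝ => φ (t • X)) =ᶠ[𝓝 1] fun t : ℝ => (t : ℂ) ^ d * φ X := by
    filter_upwards [lt_mem_nhds (zero_lt_one' ℝ)] with t ht using hom t ht
  have h4 := h1.unique (h2.congr_of_eventuallyEq h3)
  rw [degOp, h4]
  ring

theorem IsDiscreteIndex.neg {l2 n2 m2 : ℤ} (h : IsDiscreteIndex l2 n2 m2) :
    IsDiscreteIndex l2 (-n2) (-m2) := by
  obtain ⟨h1, ⟨r, hr⟩, ⟨s, hs⟩, h4⟩ := h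
  exact ⟨h1, ⟨-r - l2, by omega⟩, ⟨-s - l2, by omega⟩, by omega⟩

/-- A property of matrix coefficients that is stable under complex conjugation has to be checked
only for the holomorphic discrete series. -/
theorem IsDiscreteIndex.induction {P : (HR → ℂ) → Prop} {l2 n2 m2 : ℤ}
    (h : IsDiscreteIndex l2 n2 m2) (hconj : ∀ f, P f → P fun Z => conj (f Z))
    (holo : ∀ (n2 m2 p : ℤ) (q k : ℕ), (l2 - m2) / 2 = p → (l2 + m2) / 2 = q →
      (n2 - l2) / 2 = k → p + q = l2 → P (matCoeff l2 n2 m2)) : P (matCoeff l2 n2 m2) := by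
  have main : ∀ n2 m2 : ℤ, IsDiscreteIndex l2 n2 m2 → -l2 ≤ m2 → -l2 ≤ n2 →
      P (matCoeff l2 n2 m2) := by
    rintro n2 m2 ⟨h1, ⟨r, hr⟩, ⟨s, hs⟩, -⟩ h2 h3
    exact holo n2 m2 ((l2 - m2) / 2) ((l2 + m2) / 2).toNat ((n2 - l2) / 2).toNat rfl
      (by omega) (by omega) (by omega)
  rcases h.2.2.2 with ⟨h1, h2⟩ | ⟨h1, h2⟩
  · exact main n2 m2 h h1 h2
  · have e : matCoeff l2 n2 m2 = fun Z => conj (matCoeff l2 (-n2) (-m2) Z) := by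
      funext Z
      rw [← matCoeff_neg h.neg.2.1 h.neg.2.2.1, neg_neg, neg_neg]
    rw [e]
    exact hconj _ (main _ _ h.neg (by omega) (by omega))

theorem contDiffOn_matCoeff {l2 n2 m2 : ℤ} (h : IsDiscreteIndex l2 n2 m2) :
    ContDiffOn ℝ ∞ (matCoeff l2 n2 m2) HRplus := by
  refine h.induction (P := fun f => ContDiffOn ℝ ∞ f HRplus) (fun f hf => ?_)
    fun n2 m2 p q k hp hq hk _ => contDiffOn_matCoeff_of_eq hp hq hk
  exact conjCLE.contDiff.comp_contDiffOn hf

theorem exists_norm_matCoeff_le {l2 n2 m2 : ℤ} (h : IsDiscreteIndex l2 n2 m2) :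
    ∃ C : ℝ, ∀ Z ∈ HRplus, ‖matCoeff l2 n2 m2 Z‖ ≤ C * ‖z11 Z‖ ^ l2 := by
  refine h.induction (P := fun f => ∃ C : ℝ, ∀ Z ∈ HRplus, ‖f Z‖ ≤ C * ‖z11 Z‖ ^ l2)
    (fun f hf => ?_) fun n2 m2 p q k hp hq hk hl => ?_
  · simpa only [norm_conj] using hf
  · simpa only [hl] using exists_norm_matCoeff_le_of_eq hp hq hk

theorem norm_z12_lt_of_N {w : HR} (hw : N w = 1) : ‖z12 w‖ < ‖z11 w‖ :=
  norm_z12_lt (show 0 < N w by rw [hw]; exact one_pos)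

/-- The size of a translate of a point of the unit hyperboloid is controlled by `z₁₁`. -/
theorem le_norm_z11_mul (w : HR) {p : ℂ × ℝ} (hp : 1 < ‖p.1‖) :
    (‖z11 w‖ - ‖z12 w‖) * ‖p.1‖ ≤ ‖z11 (mul w (unitPt p))‖ := by
  have h1 : ‖z12 (unitPt p)‖ ≤ ‖p.1‖ := by
    rw [← z11_unitPt p]
    exact (norm_z12_lt (unitPt_mem hp)).le
  rw [z11_mul, z11_unitPt]
  have h2 := norm_sub_le_norm_add (z11 w * p.1) (z12 w * conj (z12 (unitPt p)))
  rw [norm_mul, norm_mul, norm_conj] at h2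
  have h3 : ‖z12 w‖ * ‖z12 (unitPt p)‖ ≤ ‖z12 w‖ * ‖p.1‖ := by gcongr
  linarith

theorem smul_mul_unitPt_mem {R : ℝ} (hR : 0 < R) {w : HR} (hw : N w = 1) {p : ℂ × ℝ}
    (hp : 1 < ‖p.1‖) : R • mul w (unitPt p) ∈ HRplus := by
  change 0 < N _
  rw [N_smul_mul_unitPt hw hp]
  positivity

/-- The decay of a matrix coefficient on a translate of a hyperboloid. -/
theorem exists_norm_matCoeff_translate_le {l2 n2 m2 : ℤ} (h : IsDiscreteIndex l2 n2 m2) {R : ℝ}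
    (hR : 0 < R) {w : HR} (hw : N w = 1) :
    ∃ M : ℝ, ∀ p : ℂ × ℝ, 1 < ‖p.1‖ → ‖matCoeff l2 n2 m2 (R • mul w (unitPt p))‖ ≤
      M * (‖p.1‖ * (1 + Real.log ‖p.1‖) ^ 4)⁻¹ := by
  obtain ⟨C, hC⟩ := exists_norm_matCoeff_le h
  have hw0 := sub_pos.2 (norm_z12_lt_of_N hw)
  set c := R * (‖z11 w‖ - ‖z12 w‖) with hc
  have hc0 : 0 < c := by positivity
  refine ⟨|C| * c ^ l2 * 256, fun p hp => ?_⟩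
  have h1 : c * ‖p.1‖ ≤ ‖z11 (R • mul w (unitPt p))‖ := by
    rw [z11_smul, norm_mul, norm_real, Real.norm_eq_abs, abs_of_pos hR, hc, mul_assoc]
    exact mul_le_mul_of_nonneg_left (le_norm_z11_mul w hp) hR.le
  have hp0 : 0 < ‖p.1‖ := by linarith
  have h2 : ‖z11 (R • mul w (unitPt p))‖ ^ l2 ≤ (c * ‖p.1‖) ^ l2 := by
    have := zpow_le_zpow_left₀ (n := -l2) (by have := h.1; omega) (by positivity) h1
    rw [zpow_neg, zpow_neg] at this
    exact (inv_le_inv₀ (by positivity) (zpow_pos ((by positivity : 0 < c * ‖p.1‖).trans_le h1) _)).1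
      this
  calc _ ≤ C * ‖z11 (R • mul w (unitPt p))‖ ^ l2 := hC _ (smul_mul_unitPt_mem hR hw hp)
    _ ≤ |C| * (c * ‖p.1‖) ^ l2 := by
      refine (mul_le_mul_of_nonneg_right (le_abs_self C) (by positivity)).trans ?_
      gcongr
    _ = |C| * c ^ l2 * ‖p.1‖ ^ l2 := by rw [mul_zpow, mul_assoc]
    _ ≤ |C| * c ^ l2 * (256 * (‖p.1‖ * (1 + Real.log ‖p.1‖) ^ 4)⁻¹) := by
      gcongr
      exact zpow_le_log_weight hp.le h.1
    _ = _ := by ring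

theorem continuousOn_degOp {φ : HR → ℂ} (hφ : ContDiffOn ℝ ∞ φ HRplus) :
    ContinuousOn (degOp φ) HRplus := by
  refine hφ.continuousOn.add ?_
  exact (hφ.continuousOn_fderiv_of_isOpen isOpen_HRplus (by simp)).clm_apply continuousOn_id

/-- The orbital integrals are real. -/
theorem conj_orbital (L : ℤ) (x : ℝ) : conj (orbital L x) = orbital L x := by
  simp only [orbital, map_div₀, map_sub, map_zpow₀, map_mul, map_add, conj_ofReal, conj_I, map_one,
    map_intCast]
  rw [neg_mul, div_neg, ← neg_div]
  simp [sub_eq_add_neg]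

/-- The exterior of the unit disc is integrated over the lines `Re a = x`. -/
theorem setIntegral_complex_eq {F : ℂ → ℂ} (hF : IntegrableOn F {a : ℂ | 1 < ‖a‖}) :
    ∫ a in {a : ℂ | 1 < ‖a‖}, F a =
      ∫ x : ℝ, ∫ y in {y : ℝ | 1 < x ^ 2 + y ^ 2}, F (x + y * I) := by
  have hms := measurableSet_one_lt_norm
  rw [← integral_indicator hms]
  have h1 : Integrable ({a : ℂ | 1 < ‖a‖}.indicator F) := hF.integrable_indicator hms
  have h2 := Complex.volume_preserving_equiv_real_prod.symm
  rw [← h2.integral_comp (MeasurableEquiv.measurableEmbedding _)]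
  have h3 := (h2.integrable_comp_emb (MeasurableEquiv.measurableEmbedding _)).2 h1
  simp only [Function.comp_def] at h3
  rw [Measure.volume_eq_prod] at h3 ⊢
  rw [integral_prod _ h3]
  refine integral_congr_ae (ae_of_all _ fun x => ?_)
  have hm : MeasurableSet {y : ℝ | 1 < x ^ 2 + y ^ 2} :=
    measurableSet_lt measurable_const (by fun_prop)
  simp only
  rw [← integral_indicator hm]
  refine integral_congr_ae (ae_of_all _ fun y => ?_)
  have e : Complex.measurableEquivRealProd.symm (x, y) = x + y * I := by
    apply Complex.ext <;> simp [Complex.measurableEquivRealProd_symm_apply]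
  simp only [e, Set.indicator_apply, Set.mem_ofPred_eq]
  refine if_congr ?_ rfl rfl
  rw [← norm_add_mul_I_sq, one_lt_sq_iff₀ (norm_nonneg _)]

/-- Against a kernel that depends on `Re z₁₁` only, a matrix coefficient of the discrete series is
an eigenfunction of the averaging over the unit hyperboloid. -/
theorem integral_matCoeff_mul {l2 n2 m2 : ℤ} (h : IsDiscreteIndex l2 n2 m2) {w : HR} (hw : N w = 1)
    {k : ℝ → ℂ} {K : ℝ} (hk : Continuous k) (hK : ∀ x, ‖k x‖ ≤ K * (1 + |x|)⁻¹) :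
    ∫ p, matCoeff l2 n2 m2 (mul w (unitPt p)) * k p.1.re ∂unitMeasure =
      2 * Real.pi * matCoeff l2 n2 m2 w * ∫ x, k x * orbital l2 x := by
  have hint : ∀ {n2 m2 : ℤ}, IsDiscreteIndex l2 n2 m2 → ∀ {k : ℝ → ℂ}, Continuous k →
      (∀ x, ‖k x‖ ≤ K * (1 + |x|)⁻¹) →
      Integrable (fun p => matCoeff l2 n2 m2 (mul w (unitPt p)) * k p.1.re) unitMeasure := by
    intro n2 m2 h k hk hK
    obtain ⟨M, hM⟩ := exists_norm_matCoeff_translate_le h one_pos hw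
    have hm := aestronglyMeasurable_comp_unitPt one_pos hw (contDiffOn_matCoeff h).continuousOn
    simp only [one_smul] at hM hm
    exact integrable_mul_kernel hk hK hm hM
  have main : ∀ (n2 m2 : ℤ), IsDiscreteIndex l2 n2 m2 → -l2 ≤ m2 → -l2 ≤ n2 → ∀ {k : ℝ → ℂ},
      Continuous k → (∀ x, ‖k x‖ ≤ K * (1 + |x|)⁻¹) →
      ∫ p, matCoeff l2 n2 m2 (mul w (unitPt p)) * k p.1.re ∂unitMeasure =
        2 * Real.pi * matCoeff l2 n2 m2 w * ∫ x, k x * orbital l2 x := by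
    intro n2 m2 h h2 h3 k hk hK
    obtain ⟨h1, ⟨r, hr⟩, ⟨s, hs⟩, -⟩ := id h
    obtain ⟨q, hq⟩ : ∃ q : ℕ, (l2 + m2) / 2 = q := ⟨((l2 + m2) / 2).toNat, by omega⟩
    have hpq : (l2 - m2) / 2 + (q : ℤ) = l2 := by omega
    set p := (l2 - m2) / 2 with hp
    have hi := hint h hk hK
    rw [unitMeasure] at hi ⊢
    rw [integral_prod _ hi]
    have hi2 := hi.integral_prod_left
    have e : ∀ a ∈ {a : ℂ | 1 < ‖a‖}, ∫ β in Set.Ico 0 (2 * Real.pi),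
        matCoeff l2 n2 m2 (mul w (unitPt (a, β))) * k a.re =
        2 * Real.pi * matCoeff l2 n2 m2 w * (k a.re * diagPoly p q a (conj a)) := by
      intro a ha
      rw [integral_mul_const, integral_Ico_eq_integral_Ioc,
        ← intervalIntegral.integral_of_le Real.two_pi_pos.le,
        integral_phase_matCoeff hp.symm hq (show 0 < N w by rw [hw]; exact one_pos) ha]
      ring
    rw [setIntegral_complex_eq hi2]
    rw [← integral_const_mul]
    refine integral_congr_ae (ae_of_all _ fun x => ?_)
    have hm : MeasurableSet {y : ℝ | 1 < x ^ 2 + y ^ 2} :=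
      measurableSet_lt measurable_const (by fun_prop)
    simp only
    rw [← hpq, ← orbital_diagPoly q (hpq ▸ h1) x, ← integral_const_mul, ← integral_const_mul]
    refine setIntegral_congr_fun hm fun y hy => ?_
    rw [hpq, e _ ?_, conj_line]
    · simp
    · change 1 < ‖(x + y * I : ℂ)‖
      rw [← one_lt_sq_iff₀ (norm_nonneg _), norm_add_mul_I_sq]
      exact hy
  rcases h.2.2.2 with ⟨h1, h2⟩ | ⟨h1, h2⟩
  · exact main n2 m2 h h1 h2 hk hK
  -- the antiholomorphic case, by conjugation of both the coefficient and the kernel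
  · have e : ∀ Z, matCoeff l2 n2 m2 Z = conj (matCoeff l2 (-n2) (-m2) Z) := by
      intro Z
      rw [← matCoeff_neg h.neg.2.1 h.neg.2.2.1, neg_neg, neg_neg]
    have := congrArg conj (main _ _ h.neg (by omega) (by omega) (k := fun x => conj (k x))
      (continuous_conj.comp hk) (fun x => by rw [norm_conj]; exact hK x))
    rw [← integral_conj, map_mul, ← integral_conj] at this
    simpa only [map_mul, ← e, conj_conj, conj_orbital, conj_ofReal, Complex.conj_ofNat] using this

/-- A function whose degree is, on the hyperboloid, a multiple of a matrix coefficient has the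
convergent Poisson integrals of that matrix coefficient. Here `l = -(κ + 2) / 2`, and `m ≤ M` are
`R` and `ρ` in increasing order. -/
theorem tendsto_poissonIntegral {κ : ℕ} {n2 m2 : ℤ} (h : IsDiscreteIndex (-(κ + 2)) n2 m2)
    {R ρ m M : ℝ} (hR : 0 < R) (hρ : 0 < ρ) {w : HR} (hw : N w = 1) (hm : 0 < m) (hmM : m ≤ M)
    (hsq : R ^ 2 + ρ ^ 2 = m ^ 2 + M ^ 2) (hpr : R * ρ = m * M) (σ : ℤˣ) {φ : HR → ℂ} {c : ℂ}
    (hφ : ContDiffOn ℝ ∞ φ HRplus)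
    (hc : ∀ X, N X = R ^ 2 → degOp φ X = c * matCoeff (-(κ + 2)) n2 m2 X) :
    (∀ ε : ℝ, 0 < ε → Integrable (poissonIntegrand σ φ (ρ • w) ε) (surfaceMeasure R)) ∧
      Tendsto (poissonIntegral σ R φ (ρ • w)) (𝓝[>] 0)
        (𝓝 (-(c / (κ + 1)) * (m ^ κ / (R ^ κ * M ^ (κ + 2))) * matCoeff (-(κ + 2)) n2 m2 w)) := by
  have hcφ := continuousOn_degOp hφ
  have hM : 0 < M := hm.trans_le hmM
  have hdeg : ∀ p : ℂ × ℝ, 1 < ‖p.1‖ → degOp φ (R • mul w (unitPt p)) =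
      c * matCoeff (-(κ + 2)) n2 m2 (R • mul w (unitPt p)) := fun p hp =>
    hc _ (N_smul_mul_unitPt hw hp)
  constructor
  · intro ε hε
    obtain ⟨K, hK⟩ := exists_norm_matCoeff_translate_le h hR hw
    refine integrable_poissonIntegrand (M := ‖c‖ * K) hR hρ hw hcφ σ hε fun p hp => ?_
    rw [hdeg p hp, norm_mul, mul_assoc]
    exact mul_le_mul_of_nonneg_left (hK p hp) (norm_nonneg _)
  · have hB : 0 < 2 * R * ρ := by positivity
    have hlim := tendsto_integral_regKernel hB (A := R ^ 2 + ρ ^ 2) (by nlinarith [sq_nonneg (R - ρ)])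
      κ σ
    have hint : (fun θ : ℝ => Real.sin ((κ + 1 : ℕ) * θ) * Real.sin θ /
        (R ^ 2 + ρ ^ 2 - 2 * R * ρ * Real.cos θ)) = fun θ : ℝ => Real.sin ((κ + 1 : ℕ) * θ) *
        Real.sin θ / (m ^ 2 + M ^ 2 - 2 * m * M * Real.cos θ) := by
      funext θ
      rw [hsq, mul_assoc 2 R, hpr, ← mul_assoc]
    rw [hint, integral_sin_mul_sin_div hm hmM] at hlim
    have h2 := hlim.const_mul ((2 * (Real.pi : ℂ) ^ 2)⁻¹ * (R ^ 2 * (c * (R : ℂ) ^ (-(κ + 2) : ℤ) *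
      (2 * Real.pi * matCoeff (-(κ + 2)) n2 m2 w))))
    have hpi : (Real.pi : ℂ) ≠ 0 := ofReal_ne_zero.2 Real.pi_ne_zero
    have hR0 : (R : ℂ) ≠ 0 := ofReal_ne_zero.2 hR.ne'
    have hM0 : (M : ℂ) ≠ 0 := ofReal_ne_zero.2 hM.ne'
    have hκ : (κ + 1 : ℂ) ≠ 0 := by exact_mod_cast κ.succ_ne_zero
    have hz : (R : ℂ) ^ (-(κ + 2) : ℤ) = ((R : ℂ) ^ (κ + 2))⁻¹ := by
      rw [zpow_neg]
      norm_cast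
    refine (h2.congr' ?_).trans_eq ?_
    · filter_upwards [self_mem_nhdsWithin] with ε hε
      rw [poissonIntegral_eq hR hw hcφ σ hε]
      have e : ∫ p, degOp φ (R • mul w (unitPt p)) *
          regKernel σ (R ^ 2 + ρ ^ 2) (2 * R * ρ) ε p.1.re ∂unitMeasure =
          ∫ p, c * (R : ℂ) ^ (-(κ + 2) : ℤ) * (matCoeff (-(κ + 2)) n2 m2 (mul w (unitPt p)) *
            regKernel σ (R ^ 2 + ρ ^ 2) (2 * R * ρ) ε p.1.re) ∂unitMeasure := by
        refine integral_congr_ae ?_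
        filter_upwards [ae_unitMeasure] with p hp
        rw [hdeg p hp, matCoeff_smul h.2.2.1 hR]
        ring
      rw [e, integral_const_mul, integral_matCoeff_mul h hw (continuous_regKernel σ _ _ hε)
        (norm_regKernel_le hB hε σ)]
      ring
    · congr 1
      push_cast
      rw [hz]
      field_simp
      ring

theorem contDiffOn_matCoeffInv {l2 n2 m2 : ℤ} (h : IsDiscreteIndex l2 n2 m2) :
    ContDiffOn ℝ ∞ (matCoeffInv l2 n2 m2) HRplus := by
  obtain ⟨j, hj⟩ : ∃ j : ℕ, -l2 - 1 = j := ⟨(-l2 - 1).toNat, by have := h.1; omega⟩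
  unfold matCoeffInv
  rw [hj]
  simp only [zpow_natCast]
  exact ((ofRealCLM.contDiff.comp contDiff_N).pow j).contDiffOn.mul (contDiffOn_matCoeff h)

theorem differentiableAt_of_contDiffOn {φ : HR → ℂ} (hφ : ContDiffOn ℝ ∞ φ HRplus) {X : HR}
    (hX : X ∈ HRplus) : DifferentiableAt ℝ φ X :=
  (hφ.contDiffAt (isOpen_HRplus.mem_nhds hX)).differentiableAt (by simp)

theorem degOp_matCoeff {l2 n2 m2 : ℤ} (h : IsDiscreteIndex l2 n2 m2) {X : HR} (hX : X ∈ HRplus) :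
    degOp (matCoeff l2 n2 m2) X = (l2 + 1) * matCoeff l2 n2 m2 X :=
  degOp_of_homogeneous (differentiableAt_of_contDiffOn (contDiffOn_matCoeff h) hX)
    fun _ ht => matCoeff_smul h.2.2.1 ht X

/-- The function `N^(-2l-1) t` is homogeneous of degree `-2l-2`, so that its degree is the negative
of that of `t` on the hyperboloid, up to the constant `N^(-2l-1)`. -/
theorem degOp_matCoeffInv {l2 n2 m2 : ℤ} (h : IsDiscreteIndex l2 n2 m2) {X : HR} (hX : X ∈ HRplus) :
    degOp (matCoeffInv l2 n2 m2) X =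
      -(l2 + 1) * ((N X : ℂ) ^ (-l2 - 1) * matCoeff l2 n2 m2 X) := by
  rw [degOp_of_homogeneous (d := -l2 - 2)
    (differentiableAt_of_contDiffOn (contDiffOn_matCoeffInv h) hX) fun t ht => ?_]
  · rw [matCoeffInv]
    push_cast
    ring
  · have h0 : (t : ℂ) ≠ 0 := ofReal_ne_zero.2 ht.ne'
    rw [matCoeffInv, matCoeffInv, matCoeff_smul h.2.2.1 ht X, N_smul]
    push_cast
    rw [mul_zpow, ← zpow_natCast, ← zpow_mul]
    have : (t : ℂ) ^ (-l2 - 2) = (t : ℂ) ^ ((2 : ℕ) * (-l2 - 1)) * (t : ℂ) ^ l2 := by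
      rw [← zpow_add₀ h0]
      congr 1
      push_cast
      ring
    rw [this]
    ring

/-- The limits of the Poisson integrals of a function whose degree is, on the hyperboloid, a
multiple `c` of that of a matrix coefficient. -/
theorem poisson_matCoeff {l2 n2 m2 : ℤ} (h : IsDiscreteIndex l2 n2 m2) {R : ℝ} (hR : 0 < R)
    {W : HR} (hW : W ∈ HRplus) (σ : ℤˣ) {φ : HR → ℂ} {c : ℂ} (hφ : ContDiffOn ℝ ∞ φ HRplus)
    (hc : ∀ X, N X = R ^ 2 → degOp φ X = (l2 + 1) * (c * matCoeff l2 n2 m2 X)) :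
    (∀ ε : ℝ, 0 < ε → Integrable (poissonIntegrand σ φ W ε) (surfaceMeasure R)) ∧
      Tendsto (poissonIntegral σ R φ W) (𝓝[>] 0) (𝓝 (if N W ≤ R ^ 2 then
        c * ((R : ℂ) ^ (2 * (l2 + 1)) * (N W : ℂ) ^ (-l2 - 1) * matCoeff l2 n2 m2 W)
        else c * matCoeff l2 n2 m2 W)) := by
  obtain ⟨κ, rfl⟩ : ∃ κ : ℕ, l2 = -(κ + 2) := ⟨(-l2 - 2).toNat, by have := h.1; omega⟩
  obtain ⟨ρ, w, hρ, hw, hρN, rfl⟩ := exists_unit_smul hW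
  have hκ : (κ + 1 : ℂ) ≠ 0 := by exact_mod_cast κ.succ_ne_zero
  have hR0 : (R : ℂ) ≠ 0 := ofReal_ne_zero.2 hR.ne'
  have hρ0 : (ρ : ℂ) ≠ 0 := ofReal_ne_zero.2 hρ.ne'
  have hc' : ∀ X, N X = R ^ 2 → degOp φ X = (-(κ + 1) * c) * matCoeff (-(κ + 2)) n2 m2 X := by
    intro X hX
    rw [hc X hX]
    push_cast
    ring
  have z1 : ∀ z : ℂ, z ^ (-(κ + 2) : ℤ) = (z ^ (κ + 2))⁻¹ := fun z => by
    rw [zpow_neg]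
    norm_cast
  rw [← hρN, matCoeff_smul h.2.2.1 hρ, z1]
  have hcκ : -((-(κ + 1) * c) / (κ + 1 : ℂ)) = c := by field_simp
  split_ifs with hle
  · have hle' : ρ ≤ R := (sq_le_sq₀ hρ.le hR.le).1 hle
    obtain ⟨h1, h2⟩ := tendsto_poissonIntegral h hR hρ hw hρ hle' (by ring) (by ring) σ hφ hc'
    refine ⟨h1, h2.trans_eq ?_⟩
    have z2 : (R : ℂ) ^ (2 * (-(κ + 2) + 1) : ℤ) = ((R : ℂ) ^ (2 * (κ + 1)))⁻¹ := by
      rw [show (2 * (-(κ + 2) + 1) : ℤ) = -((2 * (κ + 1) : ℕ) : ℤ) by push_cast; ring, zpow_neg,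
        zpow_natCast]
    have z3 : ((ρ ^ 2 : ℝ) : ℂ) ^ (-(-(κ + 2)) - 1 : ℤ) = (ρ : ℂ) ^ (2 * (κ + 1)) := by
      rw [show (-(-(κ + 2)) - 1 : ℤ) = ((κ + 1 : ℕ) : ℤ) by push_cast; ring, zpow_natCast, pow_mul]
      push_cast
      rfl
    rw [hcκ, z2, z3]
    congr 1
    field_simp
    ring
  · have hle' : R ≤ ρ := (lt_of_pow_lt_pow_left₀ 2 hρ.le (not_le.1 hle)).le
    obtain ⟨h1, h2⟩ := tendsto_poissonIntegral h hR hρ hw hR hle' (by ring) (by ring) σ hφ hc'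
    refine ⟨h1, h2.trans_eq ?_⟩
    rw [hcκ]
    congr 1
    field_simp

theorem poissonOp_eq {σ : ℤˣ} {R : ℝ} {φ : HR → ℂ} {W : HR} {c : ℂ}
    (h : Tendsto (poissonIntegral σ R φ W) (𝓝[>] 0) (𝓝 c)) : poissonOp σ R φ W = c :=
  h.limUnder_eq

/-- On the hyperboloid `N(X) = R²` both functions have, up to a constant, the same image under
`deg`; the two formulas for the values agree where `N(W) = R²`. -/
theorem poisson_matCoeff_values {R : ℝ} (hR : 0 < R) {l2 n2 m2 : ℤ} (h : IsDiscreteIndex l2 n2 m2)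
    (σ : ℤˣ) {W : HR} (hW : W ∈ HRplus) :
    (PoissonConverges σ R (matCoeffInv l2 n2 m2) W ∧
        (N W ≤ R ^ 2 → poissonOp σ R (matCoeffInv l2 n2 m2) W =
          -((N W : ℂ) ^ (-l2 - 1) * matCoeff l2 n2 m2 W)) ∧
        (R ^ 2 ≤ N W → poissonOp σ R (matCoeffInv l2 n2 m2) W =
          -((R : ℂ) ^ (-2 * (l2 + 1)) * matCoeff l2 n2 m2 W))) ∧
      (PoissonConverges σ R (matCoeff l2 n2 m2) W ∧
        (N W ≤ R ^ 2 → poissonOp σ R (matCoeff l2 n2 m2) W =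
          (R : ℂ) ^ (2 * (l2 + 1)) * (N W : ℂ) ^ (-l2 - 1) * matCoeff l2 n2 m2 W) ∧
        (R ^ 2 ≤ N W → poissonOp σ R (matCoeff l2 n2 m2) W =
          matCoeff l2 n2 m2 W)) := by
  have hmem : ∀ X, N X = R ^ 2 → X ∈ HRplus := fun X hX => by
    change 0 < N X
    rw [hX]
    positivity
  have hR0 : (R : ℂ) ≠ 0 := ofReal_ne_zero.2 hR.ne'
  have e1 : ((R ^ 2 : ℝ) : ℂ) ^ (-l2 - 1) = (R : ℂ) ^ (-2 * (l2 + 1)) := by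
    push_cast
    rw [← zpow_natCast, ← zpow_mul]
    congr 1
    push_cast
    ring
  have e2 : (R : ℂ) ^ (-2 * (l2 + 1)) * (R : ℂ) ^ (2 * (l2 + 1)) = 1 := by
    rw [← zpow_add₀ hR0, show -2 * (l2 + 1) + 2 * (l2 + 1) = 0 by ring, zpow_zero]
  obtain ⟨i1, t1⟩ := poisson_matCoeff h hR hW σ (c := -(R : ℂ) ^ (-2 * (l2 + 1)))
    (contDiffOn_matCoeffInv h) fun X hX => by
      rw [degOp_matCoeffInv h (hmem X hX), hX, e1]
      ring
  obtain ⟨i2, t2⟩ := poisson_matCoeff h hR hW σ (c := 1) (contDiffOn_matCoeff h) fun X hX => by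
      rw [degOp_matCoeff h (hmem X hX), one_mul]
  refine ⟨⟨⟨i1, _, t1⟩, fun hle => ?_, fun hle => ?_⟩, ⟨i2, _, t2⟩, fun hle => ?_, fun hle => ?_⟩
  · rw [poissonOp_eq t1, if_pos hle]
    linear_combination (-((N W : ℂ) ^ (-l2 - 1) * matCoeff l2 n2 m2 W)) * e2
  · rw [poissonOp_eq t1]
    split_ifs with hle2
    · rw [le_antisymm hle2 hle, e1]
      linear_combination (-((R : ℂ) ^ (-2 * (l2 + 1)) * matCoeff l2 n2 m2 W)) * e2
    · ring
  · rw [poissonOp_eq t2, if_pos hle]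
    ring
  · rw [poissonOp_eq t2]
    split_ifs with hle2
    · rw [le_antisymm hle2 hle, e1]
      linear_combination (matCoeff l2 n2 m2 W) * e2
    · ring

/-! ### The kernel on circles -/

theorem one_sub_mul_expI_ne_zero {r : ℂ} (hr : ‖r‖ < 1) (θ : ℝ) : 1 - r * exp (θ * I) ≠ 0 := by
  have := add_mul_ne_zero (a := 1) (b := -r) (z := exp (θ * I)) (by simpa using hr)
    (norm_exp_ofReal_mul_I θ).le
  rwa [neg_mul, ← sub_eq_add_neg] at this

/-- The Poisson kernel has total mass one; here `r` is allowed to be complex. -/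
theorem integral_poissonKernel {r : ℂ} (hr : ‖r‖ < 1) :
    ∫ θ in (0 : ℝ)..2 * Real.pi,
      (1 - r ^ 2) * ((1 - r * exp (θ * I)) * (1 - r * (exp (θ * I))⁻¹))⁻¹ =
        (2 * Real.pi : ℂ) := by
  have hr' : ‖-r‖ < ‖(1 : ℂ)‖ := by simpa using hr
  have h1 := integral_add_mul_expI hr' (-1)
  have h2 := integral_expI_pow_succ_mul hr' (-1) 0
  simp only [zpow_neg_one, neg_mul, ← sub_eq_add_neg, inv_one, mul_one, zero_add, pow_one] at h1 h2
  have hinv : ∀ θ : ℝ, exp ((2 * Real.pi - θ : ℝ) * I) = (exp (θ * I))⁻¹ := by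
    intro θ
    push_cast
    rw [sub_mul, Complex.exp_sub, exp_two_pi_mul_I, one_div]
  have h3 := intervalIntegral.integral_comp_sub_left (a := 0) (b := 2 * Real.pi)
    (fun θ : ℝ => exp (θ * I) * (1 - r * exp (θ * I))⁻¹) (2 * Real.pi)
  rw [sub_self, sub_zero, h2] at h3
  simp only [hinv] at h3
  have e : ∀ θ : ℝ, (1 - r ^ 2) * ((1 - r * exp (θ * I)) * (1 - r * (exp (θ * I))⁻¹))⁻¹ =
      (1 - r * exp (θ * I))⁻¹ + r * ((exp (θ * I))⁻¹ * (1 - r * (exp (θ * I))⁻¹)⁻¹) := by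
    intro θ
    have n1 := one_sub_mul_expI_ne_zero hr θ
    have n2 := one_sub_mul_expI_ne_zero hr (2 * Real.pi - θ)
    rw [hinv] at n2
    have n3 := exp_ne_zero (θ * I)
    have n4 : exp (θ * I) * (exp (θ * I))⁻¹ = 1 := mul_inv_cancel₀ n3
    generalize (exp (θ * I))⁻¹ = F at *
    generalize exp (θ * I) = E at *
    rw [mul_inv, ← mul_left_inj' (mul_ne_zero n1 n2)]
    have a1 : (1 - r * E)⁻¹ * (1 - r * E) = 1 := inv_mul_cancel₀ n1
    have a2 : (1 - r * F)⁻¹ * (1 - r * F) = 1 := inv_mul_cancel₀ n2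
    linear_combination (1 - r ^ 2) * (1 - r * F)⁻¹ * (1 - r * F) * a1 + (1 - r ^ 2) * a2 -
      (1 - r * F) * a1 - r * F * (1 - r * E) * a2 + r ^ 2 * n4
  have c1 : Continuous fun θ : ℝ => (1 - r * exp (θ * I))⁻¹ :=
    Continuous.inv₀ (by fun_prop) (one_sub_mul_expI_ne_zero hr)
  have c2 : Continuous fun θ : ℝ => (exp (θ * I))⁻¹ * (1 - r * (exp (θ * I))⁻¹)⁻¹ := by
    simp_rw [← hinv]
    exact Continuous.mul (by fun_prop)
      (Continuous.inv₀ (by fun_prop) fun θ => one_sub_mul_expI_ne_zero hr _)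
  simp_rw [e]
  rw [intervalIntegral.integral_add (c1.intervalIntegrable _ _)
    ((c2.const_mul r).intervalIntegrable _ _), intervalIntegral.integral_const_mul, h3, h1]
  simp

/-- Off the segment `[-1, 1]`, the map `r ↦ (r + r⁻¹) / 2` is onto from the unit disc. -/
theorem exists_joukowski {u : ℂ} (hu : ∀ α : ℝ, u ≠ Real.cos α) :
    ∃ r : ℂ, ‖r‖ < 1 ∧ r ≠ 0 ∧ 2 * r * u = 1 + r ^ 2 := by
  obtain ⟨s, hs⟩ := IsAlgClosed.exists_pow_nat_eq (u ^ 2 - 1) (n := 2) two_pos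
  have hprod : (u - s) * (u + s) = 1 := by linear_combination -hs
  have n1 : u - s ≠ 0 := left_ne_zero_of_mul_eq_one hprod
  have n2 : u + s ≠ 0 := right_ne_zero_of_mul_eq_one hprod
  have hn : ‖u - s‖ * ‖u + s‖ = 1 := by rw [← norm_mul, hprod, norm_one]
  rcases lt_trichotomy ‖u - s‖ 1 with h | h | h
  · exact ⟨u - s, h, n1, by linear_combination -hs⟩
  · exfalso
    have h2 : u + s = conj (u - s) := by
      rw [← mul_right_inj' n1, hprod, mul_conj, normSq_eq_norm_sq, h]
      simp
    have h3 : u = ((u - s).re : ℂ) := by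
      have := add_conj (u - s)
      rw [← h2] at this
      push_cast at this
      linear_combination this / 2
    have h4 : |(u - s).re| ≤ 1 := h ▸ abs_re_le_norm _
    refine hu (Real.arccos (u - s).re) ?_
    rw [Real.cos_arccos (abs_le.1 h4).1 (abs_le.1 h4).2]
    exact h3
  · refine ⟨u + s, ?_, n2, by linear_combination -hs⟩
    by_contra! h2
    nlinarith [norm_nonneg (u + s)]

/-- The square of the integral is `π² / (z² - c²)`. Squaring avoids the choice of a branch of the
root. -/
theorem integral_inv_sub_cos_sq {z : ℂ} {c : ℝ} (hc : 0 < c) (hz : ∀ α : ℝ, z ≠ c * Real.cos α) :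
    (∫ α in (0 : ℝ)..Real.pi, (z - c * Real.cos α)⁻¹) ^ 2 * (z ^ 2 - c ^ 2) = Real.pi ^ 2 := by
  have hc0 : (c : ℂ) ≠ 0 := ofReal_ne_zero.2 hc.ne'
  have hcont : Continuous fun α : ℝ => (z - c * Real.cos α)⁻¹ :=
    Continuous.inv₀ (by fun_prop) fun α => sub_ne_zero.2 (hz α)
  obtain ⟨r, hr, hr0, hru⟩ := exists_joukowski (u := z / c) fun α h => hz α (by
    rw [← h]
    field_simp)
  have hz' : 2 * r * z = c * (1 + r ^ 2) := by
    rw [← hru]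
    field_simp
  have hr1 : 1 - r ^ 2 ≠ 0 := by
    intro h
    have : ‖r‖ ^ 2 = 1 := by rw [← norm_pow, ← sub_eq_zero.1 h, norm_one]
    nlinarith [norm_nonneg r]
  have hsym : ∫ α in (0 : ℝ)..2 * Real.pi, (z - c * Real.cos α)⁻¹ =
      2 * ∫ α in (0 : ℝ)..Real.pi, (z - c * Real.cos α)⁻¹ := by
    rw [← intervalIntegral.integral_add_adjacent_intervals (b := Real.pi)
      (hcont.intervalIntegrable _ _) (hcont.intervalIntegrable _ _)]
    have := intervalIntegral.integral_comp_sub_left (a := 0) (b := Real.pi)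
      (fun α : ℝ => (z - c * Real.cos α)⁻¹) (2 * Real.pi)
    rw [sub_zero, show 2 * Real.pi - Real.pi = Real.pi by ring] at this
    simp_rw [← this, Real.cos_two_pi_sub]
    ring
  have hfull : (1 - r ^ 2) * (c * ∫ α in (0 : ℝ)..2 * Real.pi, (z - c * Real.cos α)⁻¹) =
      2 * r * (2 * Real.pi) := by
    rw [← integral_poissonKernel hr, ← intervalIntegral.integral_const_mul,
      ← intervalIntegral.integral_const_mul, ← intervalIntegral.integral_const_mul]
    refine intervalIntegral.integral_congr fun α _ => ?_
    have h1 : (1 - r * exp (α * I)) * (1 - r * (exp (α * I))⁻¹) * c = 2 * r * (z - c * Real.cos α) := by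
      have e1 : exp (α * I) * (exp (α * I))⁻¹ = 1 := mul_inv_cancel₀ (exp_ne_zero _)
      have e2 : exp (α * I) + (exp (α * I))⁻¹ = 2 * Real.cos α := by
        rw [← exp_neg, ofReal_cos, Complex.cos]
        ring_nf
      linear_combination c * r ^ 2 * e1 - c * r * e2 - hz'
    have h2 := sub_ne_zero.2 (hz α)
    have h3 : (1 - r * exp (α * I)) * (1 - r * (exp (α * I))⁻¹) ≠ 0 := by
      intro h0
      rw [h0, zero_mul] at h1
      exact (mul_ne_zero (mul_ne_zero two_ne_zero hr0) h2) h1.symm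
    generalize (1 - r * exp (α * I)) * (1 - r * (exp (α * I))⁻¹) = P at *
    generalize z - c * Real.cos α = Q at *
    field_simp
    linear_combination h1
  rw [hsym] at hfull
  set J := ∫ α in (0 : ℝ)..Real.pi, (z - c * Real.cos α)⁻¹
  have h4 : (1 - r ^ 2) * (c * J) = 2 * r * Real.pi := by linear_combination hfull / 2
  have h5 : (2 * r) ^ 2 * (z ^ 2 - c ^ 2) = c ^ 2 * (1 - r ^ 2) ^ 2 := by
    linear_combination (2 * r * z + c * (1 + r ^ 2)) * hz'
  have h6 : (2 * r) ^ 2 ≠ 0 := pow_ne_zero 2 (mul_ne_zero two_ne_zero hr0)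
  rw [← mul_right_inj' h6]
  linear_combination J ^ 2 * h5 + ((1 - r ^ 2) * (c * J) + 2 * r * Real.pi) * h4

/-- The size of the singularity left after integration over a circle of radius `c`. -/
noncomputable def circleWeight (x₀ c : ℝ) : ℝ := (√c * √|c - x₀|)⁻¹

theorem circleWeight_nonneg (x₀ c : ℝ) : 0 ≤ circleWeight x₀ c := by
  unfold circleWeight
  positivity

/-- The bound does not involve the imaginary part of `z`, which is the regularization. -/
theorem norm_integral_inv_sub_cos_le {z : ℂ} {c : ℝ} (hc : 0 < c) (hz : ∀ α : ℝ, z ≠ c * Real.cos α)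
    (hz0 : 0 ≤ z.re) (hne : c ≠ z.re) :
    ‖∫ α in (0 : ℝ)..Real.pi, (z - c * Real.cos α)⁻¹‖ ≤ Real.pi * circleWeight z.re c := by
  have h := congrArg norm (integral_inv_sub_cos_sq hc hz)
  rw [show z ^ 2 - c ^ 2 = (z - c) * (z + c) by ring, norm_mul, norm_pow, norm_mul, norm_pow,
    norm_real, Real.norm_eq_abs, abs_of_pos Real.pi_pos] at h
  have h1 : |c - z.re| ≤ ‖z - c‖ := by
    rw [abs_sub_comm]
    simpa using abs_re_le_norm (z - c)
  have h2 : c ≤ ‖z + c‖ := by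
    have := re_le_norm (z + c)
    simp only [add_re, ofReal_re] at this
    linarith
  have h3 : 0 < |c - z.re| := abs_pos.2 (sub_ne_zero.2 hne)
  refine le_of_sq_le_sq ?_ (by have := circleWeight_nonneg z.re c; positivity)
  rw [mul_pow, circleWeight, inv_pow, mul_pow, Real.sq_sqrt hc.le, Real.sq_sqrt h3.le,
    ← div_eq_mul_inv, le_div_iff₀ (by positivity), ← h, mul_comm c]
  gcongr

theorem mul_le_sin_of_le {t : ℝ} (h0 : 0 ≤ t) (h1 : t ≤ 3 * Real.pi / 4) :
    2 / (3 * Real.pi) * t ≤ Real.sin t := by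
  have hπ := Real.pi_pos
  rcases le_total t (Real.pi / 2) with h | h
  · refine le_trans ?_ (Real.mul_le_sin h0 h)
    gcongr
    linarith
  · rw [← Real.sin_pi_sub]
    refine le_trans ?_ (Real.mul_le_sin (x := Real.pi - t) (by linarith) (by linarith))
    rw [div_mul_eq_mul_div, div_mul_eq_mul_div, div_le_div_iff₀ (by positivity) (by positivity)]
    nlinarith

/-- The cosine separates points of `[0, π]` at least as well as a square root. -/
theorem abs_sub_mul_le_abs_cos_sub {α α₀ : ℝ} (h0 : 0 ≤ α₀) (h1 : α₀ ≤ Real.pi / 2) (h2 : 0 ≤ α)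
    (h3 : α ≤ Real.pi) :
    4 / (3 * Real.pi ^ 2) * (√α * √α₀) * |α - α₀| ≤ |Real.cos α₀ - Real.cos α| := by
  have hπ := Real.pi_pos
  rw [abs_sub_comm (Real.cos α₀), Real.cos_sub_cos, abs_mul, abs_mul, abs_neg, abs_two]
  have e1 : 2 / (3 * Real.pi) * (√α * √α₀) ≤ |Real.sin ((α + α₀) / 2)| := by
    refine le_trans ?_ ((mul_le_sin_of_le (t := (α + α₀) / 2) (by linarith) (by linarith)).trans
      (le_abs_self _))
    refine mul_le_mul_of_nonneg_left ?_ (by positivity)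
    nlinarith [sq_nonneg (√α - √α₀), Real.sq_sqrt h0, Real.sq_sqrt h2]
  have e2 : 1 / Real.pi * |α - α₀| ≤ |Real.sin ((α - α₀) / 2)| := by
    have h4 : |α - α₀| ≤ Real.pi := abs_le.2 ⟨by linarith, by linarith⟩
    have h5 := Real.mul_le_sin (x := |α - α₀| / 2) (by positivity) (by linarith)
    have h6 : |Real.sin ((α - α₀) / 2)| = |Real.sin (|α - α₀| / 2)| := by
      rcases abs_cases (α - α₀) with ⟨h, -⟩ | ⟨h, -⟩ <;> rw [h]
      rw [neg_div, Real.sin_neg, abs_neg]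
    rw [h6]
    refine le_trans (le_of_eq ?_) (h5.trans (le_abs_self _))
    field_simp
  calc _ = 2 * (2 / (3 * Real.pi) * (√α * √α₀)) * (1 / Real.pi * |α - α₀|) := by
        field_simp
        ring
    _ ≤ _ := by gcongr

/-- On a circle the regularized kernel is, up to an integrable singularity in the radius, bounded on
differentiable functions, uniformly in the regularization. -/
theorem norm_integral_mul_inv_sub_cos_le {G G' : ℝ → ℂ} {K c : ℝ} {z : ℂ} (hz1 : 0 ≤ z.re)
    (him : z.im ≠ 0) (hc : 0 < c) (hne : c ≠ z.re)
    (hG : ∀ α ∈ Set.Icc 0 Real.pi, HasDerivAt G (G' α) α)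
    (hK : ∀ α ∈ Set.Icc 0 Real.pi, ‖G α‖ ≤ K) (hK' : ∀ α ∈ Set.Icc 0 Real.pi, ‖G' α‖ ≤ K) :
    ‖∫ α in (0 : ℝ)..Real.pi, G α * (z - c * Real.cos α)⁻¹‖ ≤
      (Real.pi + 3 * Real.pi ^ 2 / 2 * √Real.pi) * K * circleWeight z.re c := by
  have hπ := Real.pi_pos
  have hK0 : 0 ≤ K := (norm_nonneg _).trans (hK 0 ⟨le_rfl, hπ.le⟩)
  have hw := circleWeight_nonneg z.re c
  have hzc : ∀ α : ℝ, z ≠ c * Real.cos α := by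
    intro α h
    apply him
    rw [h, ← ofReal_mul]
    exact ofReal_im _
  have hcont : Continuous fun α : ℝ => (z - c * Real.cos α)⁻¹ :=
    Continuous.inv₀ (by fun_prop) fun α => sub_ne_zero.2 (hzc α)
  have hre : ∀ α : ℝ, |z.re - c * Real.cos α| ≤ ‖z - c * Real.cos α‖ := fun α => by
    have := abs_re_le_norm (z - c * Real.cos α)
    rwa [sub_re, ← ofReal_mul, ofReal_re, ofReal_mul] at this
  have hmain := norm_integral_inv_sub_cos_le hc hzc hz1 hne
  rcases lt_or_gt_of_ne hne with hlt | hlt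
  -- For `c < Re z` the real part of the denominator stays positive, and the modulus of the kernel
  -- is at most the kernel of the real point `Re z`.
  · have hpos : ∀ α : ℝ, 0 < z.re - c * Real.cos α := fun α => by
      nlinarith [Real.cos_le_one α]
    have hreal := norm_integral_inv_sub_cos_le (z := (z.re : ℂ)) hc (fun α h => by
      have := hpos α
      rw [← ofReal_mul, ofReal_inj] at h
      linarith) (by simpa using hz1) (by simpa using hne)
    simp only [ofReal_re] at hreal
    have hci : Continuous fun α : ℝ => (z.re - c * Real.cos α)⁻¹ :=
      Continuous.inv₀ (by fun_prop) fun α => (hpos α).ne'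
    have e1 : ∫ α in (0 : ℝ)..Real.pi, ((z.re : ℂ) - c * Real.cos α)⁻¹ =
        ((∫ α in (0 : ℝ)..Real.pi, (z.re - c * Real.cos α)⁻¹ : ℝ) : ℂ) := by
      rw [← intervalIntegral.integral_ofReal]
      simp
    rw [e1, norm_real] at hreal
    have e2 : ‖∫ α in (0 : ℝ)..Real.pi, G α * (z - c * Real.cos α)⁻¹‖ ≤
        ∫ α in (0 : ℝ)..Real.pi, K * (z.re - c * Real.cos α)⁻¹ := by
      refine intervalIntegral.norm_integral_le_of_norm_le hπ.le (ae_of_all _ fun α hα => ?_)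
        ((hci.const_mul K).intervalIntegrable _ _)
      rw [norm_mul, norm_inv]
      have := (le_abs_self _).trans (hre α)
      exact mul_le_mul (hK α ⟨hα.1.le, hα.2⟩) (inv_anti₀ (hpos α) this) (by positivity) hK0
    rw [intervalIntegral.integral_const_mul] at e2
    calc _ ≤ K * ∫ α in (0 : ℝ)..Real.pi, (z.re - c * Real.cos α)⁻¹ := e2
      _ ≤ K * (Real.pi * circleWeight z.re c) :=
        mul_le_mul_of_nonneg_left ((le_abs_self _).trans hreal) hK0
      _ ≤ _ := by
        have : 0 ≤ 3 * Real.pi ^ 2 / 2 * √Real.pi * K * circleWeight z.re c := by positivity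
        linarith
  · -- The zero `α₀` of the real part of the denominator; the value of `G` there is split off.
    have hq1 : z.re / c < 1 := (div_lt_one hc).2 hlt
    have hq0 : 0 ≤ z.re / c := by positivity
    set α₀ := Real.arccos (z.re / c) with hα₀
    have hcos : c * Real.cos α₀ = z.re := by
      rw [hα₀, Real.cos_arccos (by linarith) hq1.le]
      field_simp
    have ha1 : α₀ ≤ Real.pi / 2 := Real.arccos_le_pi_div_two.2 hq0
    have ha0 : 0 < α₀ := Real.arccos_pos.2 hq1
    have hmem : α₀ ∈ Set.Icc 0 Real.pi := ⟨ha0.le, by linarith⟩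
    have hGc : ContinuousOn G (Set.Icc 0 Real.pi) := fun α hα =>
      (hG α hα).continuousAt.continuousWithinAt
    have hlip : ∀ α ∈ Set.Icc 0 Real.pi, ‖G α - G α₀‖ ≤ K * |α - α₀| := fun α hα =>
      (convex_Icc 0 Real.pi).norm_image_sub_le_of_norm_hasDerivWithin_le
        (fun x hx => (hG x hx).hasDerivWithinAt) hK' hmem hα
    have hsplit : ∫ α in (0 : ℝ)..Real.pi, G α * (z - c * Real.cos α)⁻¹ =
        G α₀ * (∫ α in (0 : ℝ)..Real.pi, (z - c * Real.cos α)⁻¹) +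
        ∫ α in (0 : ℝ)..Real.pi, (G α - G α₀) * (z - c * Real.cos α)⁻¹ := by
      rw [← intervalIntegral.integral_const_mul, ← intervalIntegral.integral_add]
      · refine intervalIntegral.integral_congr fun α _ => ?_
        ring
      · exact (hcont.const_mul _).intervalIntegrable _ _
      · refine ContinuousOn.intervalIntegrable ?_
        rw [Set.uIcc_of_le hπ.le]
        exact (hGc.sub continuousOn_const).mul hcont.continuousOn
    -- `1 - cos α₀ ≤ α₀` turns the factor `(√α₀)⁻¹` into the weight of the circle.
    have hδ : √((c - z.re) / c) ≤ √α₀ := by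
      refine Real.sqrt_le_sqrt ?_
      have h1 := Real.one_sub_sq_div_two_le_cos (x := α₀)
      have h2 : (c - z.re) / c = 1 - Real.cos α₀ := by
        rw [← hcos]
        field_simp
      have h3 : 0 ≤ (c - z.re) / c := div_nonneg (by linarith) hc.le
      have h4 : (c - z.re) / c ≤ 1 := (div_le_one hc).2 (by linarith)
      nlinarith
    have hδ0 : 0 < √((c - z.re) / c) := Real.sqrt_pos.2 (div_pos (by linarith) hc)
    have hS : c⁻¹ * (√α₀)⁻¹ ≤ circleWeight z.re c := by
      have h1 : (√α₀)⁻¹ ≤ (√((c - z.re) / c))⁻¹ := inv_anti₀ hδ0 hδ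
      refine (mul_le_mul_of_nonneg_left h1 (by positivity)).trans (le_of_eq ?_)
      rw [circleWeight, abs_of_pos (by linarith), Real.sqrt_div (by linarith), ← mul_inv]
      congr 1
      have := Real.mul_self_sqrt hc.le
      have h0 : √c ≠ 0 := (Real.sqrt_pos.2 hc).ne'
      rw [mul_div_assoc', div_eq_iff h0]
      linear_combination -√(c - z.re) * this
    have hrem : ‖∫ α in (0 : ℝ)..Real.pi, (G α - G α₀) * (z - c * Real.cos α)⁻¹‖ ≤
        ∫ α in (0 : ℝ)..Real.pi, (3 * Real.pi ^ 2 / 4 * K * (c⁻¹ * (√α₀)⁻¹)) * α ^ (-1 / 2 : ℝ) := by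
      refine intervalIntegral.norm_integral_le_of_norm_le hπ.le (ae_of_all _ fun α hα => ?_)
        ((intervalIntegral.intervalIntegrable_rpow' (by norm_num)).const_mul _)
      have hα' : α ∈ Set.Icc 0 Real.pi := ⟨hα.1.le, hα.2⟩
      have hsα : 0 < √α := Real.sqrt_pos.2 hα.1
      have hsα0 : 0 < √α₀ := Real.sqrt_pos.2 ha0
      have e1 : α ^ (-1 / 2 : ℝ) = (√α)⁻¹ := by
        rw [Real.sqrt_eq_rpow, ← Real.rpow_neg hα.1.le]
        norm_num
      rw [e1, norm_mul, norm_inv]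
      have hn : 0 < ‖z - c * Real.cos α‖ := norm_pos_iff.2 (sub_ne_zero.2 (hzc α))
      rw [← div_eq_mul_inv, div_le_iff₀ hn]
      have h1 : c * (4 / (3 * Real.pi ^ 2) * (√α * √α₀) * |α - α₀|) ≤ ‖z - c * Real.cos α‖ := by
        refine le_trans ?_ (hre α)
        rw [← hcos, ← mul_sub, abs_mul, abs_of_pos hc]
        exact mul_le_mul_of_nonneg_left
          (abs_sub_mul_le_abs_cos_sub ha0.le ha1 hα.1.le hα.2) hc.le
      refine (hlip α hα').trans ?_
      refine le_trans (le_of_eq ?_) (mul_le_mul_of_nonneg_left h1 (by positivity))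
      field_simp
    have hint : ∫ α in (0 : ℝ)..Real.pi, α ^ (-1 / 2 : ℝ) = 2 * √Real.pi := by
      rw [integral_rpow (Or.inl (by norm_num)), Real.sqrt_eq_rpow]
      norm_num
      ring
    rw [intervalIntegral.integral_const_mul, hint] at hrem
    rw [hsplit]
    calc _ ≤ K * (Real.pi * circleWeight z.re c) +
          3 * Real.pi ^ 2 / 4 * K * circleWeight z.re c * (2 * √Real.pi) := by
          refine (norm_add_le _ _).trans (add_le_add ?_ (hrem.trans (by gcongr)))
          rw [norm_mul]
          exact mul_le_mul (hK α₀ hmem) hmain (norm_nonneg _) hK0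
      _ = _ := by ring

/-! ### The uniform bound for the regularized integrals -/

/-- The radial measure `c dc` of the region `1 < |a|` in polar coordinates. -/
noncomputable def radialMeasure : Measure ℝ :=
  (volume.restrict (Set.Ioi 1)).withDensity fun c => ENNReal.ofReal c

instance : SFinite radialMeasure := by unfold radialMeasure; infer_instance

/-- `unitMeasure` in polar coordinates `a = c e^{iα}`. -/
theorem map_polar_eq_unitMeasure :
    Measure.map (fun x : (ℝ × ℝ) × ℝ => ((x.1.1 : ℂ) * exp (x.2 * I), x.1.2))
      ((radialMeasure.prod (volume.restrict (Set.Ico 0 (2 * Real.pi)))).prod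
        (volume.restrict (Set.Ico 0 (2 * Real.pi)))) = unitMeasure := by
  refine Measure.ext_of_lintegral _ fun u hu => ?_
  have hm : Measurable fun x : (ℝ × ℝ) × ℝ => ((x.1.1 : ℂ) * exp (x.2 * I), x.1.2) := by fun_prop
  have hhm : Measurable fun a : ℂ => ∫⁻ β in Set.Ico 0 (2 * Real.pi), u (a, β) :=
    Measurable.lintegral_prod_right' hu
  have hum : Measurable fun x : (ℝ × ℝ) × ℝ => u ((x.1.1 : ℂ) * exp (x.2 * I), x.1.2) := hu.comp hm
  have h2 : Measurable fun q : ℝ × ℝ => ∫⁻ α in Set.Ico 0 (2 * Real.pi),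
      u ((q.1 : ℂ) * exp (α * I), q.2) :=
    Measurable.lintegral_prod_right' hum
  have h3 : Measurable fun c : ℝ => ∫⁻ β in Set.Ico 0 (2 * Real.pi),
      ∫⁻ α in Set.Ico 0 (2 * Real.pi), u ((c : ℂ) * exp (α * I), β) :=
    Measurable.lintegral_prod_right' h2
  rw [lintegral_map hu hm, lintegral_prod _ hum.aemeasurable,
    lintegral_prod _ h2.aemeasurable, radialMeasure,
    lintegral_withDensity_eq_lintegral_mul _ (by fun_prop) h3, unitMeasure,
    lintegral_prod _ hu.aemeasurable, setLIntegral_polar hhm]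
  refine lintegral_congr fun c => ?_
  rw [Pi.mul_apply]
  congr 1
  exact lintegral_lintegral_swap
    (hu.comp (by fun_prop : Measurable fun x : ℝ × ℝ => ((c : ℂ) * exp (x.2 * I), x.1))).aemeasurable

theorem ae_radialMeasure (x₀ : ℝ) : ∀ᵐ c ∂radialMeasure, 1 < c ∧ c ≠ x₀ := by
  refine (withDensity_absolutelyContinuous _ _).ae_le ?_
  filter_upwards [ae_restrict_mem measurableSet_Ioi,
    ae_restrict_of_ae (Measure.ae_ne volume x₀)] with c h1 h2 using ⟨h1, h2⟩

theorem intervalIntegrable_inv_sqrt_abs (x₀ a b : ℝ) :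
    IntervalIntegrable (fun c => (√|c - x₀|)⁻¹) volume a b := by
  have h : IntervalIntegrable (fun c : ℝ => (√|c|)⁻¹) volume (a - x₀) (b - x₀) := by
    refine intervalIntegrable_of_even (fun x => by rw [abs_neg]) fun x hx => ?_
    refine (intervalIntegral.intervalIntegrable_rpow' (r := -1 / 2) (by norm_num)).congr ?_
    intro c hc
    rw [Set.uIoc_of_le hx.le] at hc
    simp only
    rw [abs_of_pos hc.1, Real.sqrt_eq_rpow, ← Real.rpow_neg hc.1.le]
    norm_num
  simpa using h.comp_sub_right x₀

/-- The weight by which the circle of radius `c` contributes to the regularized integral of a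
function with the decay of the Schwartz space. -/
noncomputable def shellWeight (x₀ c : ℝ) : ℝ :=
  (c * (1 + Real.log c) ^ 4)⁻¹ * circleWeight x₀ c

theorem measurable_shellWeight (x₀ : ℝ) : Measurable (shellWeight x₀) := by
  unfold shellWeight circleWeight
  fun_prop

/-- The singularity at `c = x₀` is an inverse square root. At infinity the weight against `c dc` is
`c⁻¹ (log c)⁻⁴`, up to a constant. -/
theorem integrable_shellWeight (x₀ : ℝ) (hx₀ : 1 ≤ x₀) :
    Integrable (shellWeight x₀) radialMeasure := by
  rw [radialMeasure, integrable_withDensity_iff_integrable_smul' (by fun_prop) (by simp)]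
  have hmeas : Measurable fun c => (ENNReal.ofReal c).toReal • shellWeight x₀ c :=
    (ENNReal.measurable_ofReal.ennreal_toReal).smul (measurable_shellWeight x₀)
  have hval : ∀ c : ℝ, 1 < c → ‖(ENNReal.ofReal c).toReal • shellWeight x₀ c‖ =
      ((1 + Real.log c) ^ 4)⁻¹ * (√c)⁻¹ * (√|c - x₀|)⁻¹ := by
    intro c hc
    have hl := one_le_one_add_log hc.le
    have h0 : 0 < c := by linarith
    rw [ENNReal.toReal_ofReal h0.le, smul_eq_mul, Real.norm_of_nonneg, shellWeight, circleWeight,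
      mul_inv, mul_inv, ← mul_assoc, ← mul_assoc, ← mul_assoc c, mul_inv_cancel₀ h0.ne', one_mul]
    have := circleWeight_nonneg x₀ c
    unfold shellWeight
    positivity
  rw [← Set.Ioc_union_Ioi_eq_Ioi (show 1 ≤ 2 * x₀ by linarith)]
  refine IntegrableOn.union ?_ ?_
  · have h := (intervalIntegrable_iff_integrableOn_Ioc_of_le (by linarith)).1
      (intervalIntegrable_inv_sqrt_abs x₀ 1 (2 * x₀))
    refine h.mono' hmeas.aestronglyMeasurable ?_
    filter_upwards [ae_restrict_mem measurableSet_Ioc] with c hc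
    have hl := one_le_one_add_log hc.1.le
    rw [hval c hc.1]
    refine mul_le_of_le_one_left (by positivity) (mul_le_one₀ ?_ (by positivity) ?_)
    · exact inv_le_one_of_one_le₀ (one_le_pow₀ hl)
    · exact inv_le_one_of_one_le₀ (Real.one_le_sqrt.2 hc.1.le)
  · refine ((integrable_lineWeight.const_mul 16).integrableOn).mono' hmeas.aestronglyMeasurable ?_
    filter_upwards [ae_restrict_mem measurableSet_Ioi] with c hc
    have hc' : 2 * x₀ < c := hc
    have hc1 : 1 < c := by linarith
    have hl := one_le_one_add_log hc1.le
    have hl2 := one_le_one_add_log (one_le_one_add_abs c)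
    rw [hval c hc1, lineWeight]
    rw [abs_of_pos (show 0 < c by linarith)] at hl2 ⊢
    have e1 : c / 2 ≤ √c * √|c - x₀| := by
      rw [← Real.sqrt_mul (by linarith), abs_of_pos (by linarith)]
      refine Real.le_sqrt_of_sq_le ?_
      nlinarith
    have e2 : 1 + Real.log (1 + c) ≤ 2 * (1 + Real.log c) := by
      have h := Real.log_le_log (by linarith) (show 1 + c ≤ 2 * c by linarith)
      rw [Real.log_mul (by norm_num) (by linarith)] at h
      linarith [Real.log_nonneg hc1.le, Real.log_two_lt_d9]
    have e3 : (1 + Real.log (1 + c)) ^ 2 ≤ 4 * (1 + Real.log c) ^ 4 := by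
      calc (1 + Real.log (1 + c)) ^ 2 ≤ (2 * (1 + Real.log c)) ^ 2 := by gcongr
        _ = 4 * (1 + Real.log c) ^ 2 := by ring
        _ ≤ _ := by
          refine mul_le_mul_of_nonneg_left ?_ (by norm_num)
          exact pow_le_pow_right₀ hl (by norm_num)
    rw [mul_assoc, ← mul_inv, ← mul_inv, ← mul_inv, ← div_eq_mul_inv, inv_eq_one_div,
      div_le_div_iff₀ (by
        have : 0 < √c * √|c - x₀| := lt_of_lt_of_le (by linarith) e1
        positivity) (by positivity), one_mul]
    calc (1 + c) * (1 + Real.log (1 + c)) ^ 2 ≤ (2 * c) * (4 * (1 + Real.log c) ^ 4) := by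
          gcongr
          linarith
      _ = 16 * ((1 + Real.log c) ^ 4 * (c / 2)) := by ring
      _ ≤ _ := by gcongr

/-- The integral over a full circle, from the estimate on the two half circles. -/
theorem norm_integral_circle_le {G G' : ℝ → ℂ} {K c A B ε : ℝ} (hB : 0 < B) (hA : 0 ≤ A)
    (hε : 0 < ε) (σ : ℤˣ) (hc : 0 < c) (hne : c ≠ A / B) (hG : ∀ α, HasDerivAt G (G' α) α)
    (hK : ∀ α, ‖G α‖ ≤ K) (hK' : ∀ α, ‖G' α‖ ≤ K) :
    ‖∫ α in (0 : ℝ)..2 * Real.pi, G α * regKernel σ A B ε (c * Real.cos α)‖ ≤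
      2 * B⁻¹ * (Real.pi + 3 * Real.pi ^ 2 / 2 * √Real.pi) * (K * circleWeight (A / B) c) := by
  set z : ℂ := ((A / B : ℝ) : ℂ) + ((((σ : ℤ) : ℝ) * ε / B : ℝ) : ℂ) * I with hz
  have hre : z.re = A / B := by simp [hz, -ofReal_div]
  have him : z.im ≠ 0 := by
    have : z.im = ((σ : ℤ) : ℝ) * ε / B := by simp [hz, -ofReal_div]
    rw [this]
    rcases Int.units_eq_one_or σ with h | h <;> simp [h, hε.ne', hB.ne']
  have hB0 : (B : ℂ) ≠ 0 := ofReal_ne_zero.2 hB.ne'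
  have hker : ∀ x : ℝ, regKernel σ A B ε x = (B : ℂ)⁻¹ * (z - x)⁻¹ := by
    intro x
    rw [regKernel, ← mul_inv, hz]
    congr 1
    push_cast
    field_simp
    ring
  have hcontK : Continuous fun α : ℝ => regKernel σ A B ε (c * Real.cos α) :=
    (continuous_regKernel σ A B hε).comp (by fun_prop)
  have hcontG : Continuous G := continuous_iff_continuousAt.2 fun α => (hG α).continuousAt
  have hprod : Continuous fun α : ℝ => G α * regKernel σ A B ε (c * Real.cos α) :=
    hcontG.mul hcontK
  have half : ∀ F F' : ℝ → ℂ, (∀ α, HasDerivAt F (F' α) α) → (∀ α, ‖F α‖ ≤ K) →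
      (∀ α, ‖F' α‖ ≤ K) →
      ‖∫ α in (0 : ℝ)..Real.pi, F α * regKernel σ A B ε (c * Real.cos α)‖ ≤
        B⁻¹ * ((Real.pi + 3 * Real.pi ^ 2 / 2 * √Real.pi) * K * circleWeight (A / B) c) := by
    intro F F' hF h1 h2
    have h := norm_integral_mul_inv_sub_cos_le (z := z) (by rw [hre]; positivity) him hc
      (by rwa [hre]) (fun α _ => hF α) (fun α _ => h1 α) (fun α _ => h2 α)
    rw [hre] at h
    simp_rw [hker, mul_left_comm _ (B : ℂ)⁻¹]
    rw [intervalIntegral.integral_const_mul, norm_mul, norm_inv, norm_real,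
      Real.norm_of_nonneg hB.le]
    refine mul_le_mul_of_nonneg_left ?_ (by positivity)
    simpa only [ofReal_mul] using h
  rw [← intervalIntegral.integral_add_adjacent_intervals (b := Real.pi)
    (hprod.intervalIntegrable _ _) (hprod.intervalIntegrable _ _)]
  have hrefl := intervalIntegral.integral_comp_sub_left (a := 0) (b := Real.pi)
    (fun α : ℝ => G α * regKernel σ A B ε (c * Real.cos α)) (2 * Real.pi)
  rw [sub_zero, show 2 * Real.pi - Real.pi = Real.pi by ring] at hrefl
  rw [← hrefl]
  simp_rw [Real.cos_two_pi_sub]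
  have h1 := half G G' hG hK hK'
  have h2 := half (fun α => G (2 * Real.pi - α)) (fun α => -G' (2 * Real.pi - α))
    (fun α => by
      have h := (hG (2 * Real.pi - α)).scomp α ((hasDerivAt_id α).const_sub (2 * Real.pi))
      simpa [Function.comp_def] using h)
    (fun α => hK _) (fun α => by rw [norm_neg]; exact hK' _)
  refine (norm_add_le _ _).trans ((add_le_add h1 h2).trans (le_of_eq ?_))
  ring

/-- The regularized integrals are bounded, uniformly in the regularization, by the decay of the
function and of its derivative along the rotations of `a = z₁₁`. -/
theorem exists_norm_integral_regKernel_le {A B : ℝ} (hB : 0 < B) (hAB : B ≤ A) :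
    ∃ K : ℝ, 0 ≤ K ∧ ∀ (H H' : ℂ × ℝ → ℂ) (M : ℝ), AEStronglyMeasurable H unitMeasure →
      (∀ p : ℂ × ℝ, 1 < ‖p.1‖ → ‖H p‖ ≤ M * (‖p.1‖ * (1 + Real.log ‖p.1‖) ^ 4)⁻¹) →
      (∀ p : ℂ × ℝ, 1 < ‖p.1‖ → ‖H' p‖ ≤ M * (‖p.1‖ * (1 + Real.log ‖p.1‖) ^ 4)⁻¹) →
      (∀ c : ℝ, 1 < c → ∀ β α : ℝ, HasDerivAt (fun α : ℝ => H (c * exp (α * I), β))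
        (H' (c * exp (α * I), β)) α) →
      ∀ (σ : ℤˣ) (ε : ℝ), 0 < ε →
        ‖∫ p, H p * regKernel σ A B ε p.1.re ∂unitMeasure‖ ≤ K * M := by
  have hA : 0 < A := hB.trans_le hAB
  set C := 2 * B⁻¹ * (Real.pi + 3 * Real.pi ^ 2 / 2 * √Real.pi) with hC
  have hC0 : 0 ≤ C := by have := Real.pi_pos; positivity
  set ν := radialMeasure.prod (volume.restrict (Set.Ico 0 (2 * Real.pi))) with hν
  have hwi : Integrable (fun q : ℝ × ℝ => shellWeight (A / B) q.1) ν :=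
    (integrable_shellWeight (A / B) ((one_le_div hB).2 hAB)).comp_fst _
  have hae : ∀ᵐ q ∂ν, 1 < q.1 ∧ q.1 ≠ A / B :=
    Measure.quasiMeasurePreserving_fst.ae (ae_radialMeasure (A / B))
  refine ⟨C * ∫ q, shellWeight (A / B) q.1 ∂ν, ?_, ?_⟩
  · refine mul_nonneg hC0 (integral_nonneg_of_ae ?_)
    filter_upwards [hae] with q hq
    have := circleWeight_nonneg (A / B) q.1
    have := one_le_one_add_log hq.1.le
    have : 0 < q.1 := by linarith [hq.1]
    simp only [Pi.zero_apply, shellWeight]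
    positivity
  intro H H' M hH hM hM' hd σ ε hε
  have hi := integrable_mul_kernel (continuous_regKernel σ A B hε) (norm_regKernel_le hB hε σ) hH hM
  have hm : Measurable fun x : (ℝ × ℝ) × ℝ => ((x.1.1 : ℂ) * exp (x.2 * I), x.1.2) := by fun_prop
  rw [← map_polar_eq_unitMeasure] at hi ⊢
  rw [integral_map hm.aemeasurable hi.aestronglyMeasurable]
  have hi2 := (integrable_map_measure hi.aestronglyMeasurable hm.aemeasurable).1 hi
  dsimp only [Function.comp_def] at hi2 ⊢
  rw [integral_prod _ hi2]
  have hbound : Integrable (fun q : ℝ × ℝ => C * M * shellWeight (A / B) q.1) ν :=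
    hwi.const_mul (C * M)
  refine (norm_integral_le_of_norm_le hbound ?_).trans (le_of_eq ?_)
  · filter_upwards [hae] with q hq
    have hq0 : 0 < q.1 := by linarith [hq.1]
    have hn : ∀ α : ℝ, ‖(q.1 : ℂ) * exp (α * I)‖ = q.1 := fun α => by
      rw [norm_mul, norm_exp_ofReal_mul_I, norm_real, Real.norm_of_nonneg hq0.le, mul_one]
    have h := norm_integral_circle_le (G := fun α => H (q.1 * exp (α * I), q.2))
      (G' := fun α => H' (q.1 * exp (α * I), q.2)) hB hA.le hε σ hq0 hq.2
      (fun α => hd q.1 hq.1 q.2 α)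
      (fun α => (hM _ (by rw [hn]; exact hq.1)).trans_eq (by rw [hn]))
      (fun α => (hM' _ (by rw [hn]; exact hq.1)).trans_eq (by rw [hn]))
    rw [integral_Ico_eq_integral_Ioc, ← intervalIntegral.integral_of_le Real.two_pi_pos.le]
    have hcos : ∀ α : ℝ, ((q.1 : ℂ) * exp (α * I)).re = q.1 * Real.cos α := fun α => by
      rw [re_ofReal_mul, exp_ofReal_mul_I_re]
    simp only [hcos]
    refine h.trans (le_of_eq ?_)
    rw [shellWeight]
    ring
  · rw [integral_const_mul]
    ring

/-! ### Rotations of `z₁₁` as an action of the Lie algebra -/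

theorem z11_add (X Y : HR) : z11 (X + Y) = z11 X + z11 Y := by
  apply Complex.ext <;> simp [z11]
  ring

theorem z12_add (X Y : HR) : z12 (X + Y) = z12 X + z12 Y := by
  apply Complex.ext <;> simp [z12]

theorem zero_mul' (X : HR) : mul 0 X = 0 := by
  apply HR_ext <;> simp [z11_mul, z12_mul] <;> simp [z11, z12, Complex.ext_iff]

/-- The left component of the element of the Lie algebra that rotates the coordinate `z₁₁` of
`w⁻¹ X`; the right component is `rotRight`. -/
noncomputable def rotLeft (w : HR) : HR :=
  (-(1 / 2) : ℝ) • mul w (mul (ofPair I 0) (ofPair (conj (z11 w)) (-z12 w)))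

/-- The right component of the element of the Lie algebra that rotates `z₁₁`. -/
noncomputable def rotRight : HR := (1 / 2 : ℝ) • ofPair I 0

/-- The vector field of the pair `(rotLeft w, rotRight)` multiplies `z₁₁(Y)` by `i` and annihilates
`z₁₂(Y)`, where `X = R w Y`. -/
theorem mul_rotRight_sub_rotLeft_mul {w : HR} (hw : N w = 1) (R : ℝ) (Y : HR) :
    mul (R • mul w Y) rotRight - mul (rotLeft w) (R • mul w Y) =
      R • mul w (ofPair (I * z11 Y) 0) := by
  have h : z11 w * conj (z11 w) - z12 w * conj (z12 w) = 1 := by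
    rw [mul_conj, mul_conj, ← ofReal_sub, ← N_eq, hw, ofReal_one]
  apply HR_ext
  · simp only [rotLeft, rotRight, z11_sub, z11_mul, z12_mul, z11_smul, z12_smul, z11_ofPair,
      z12_ofPair, map_add, map_mul, map_neg, conj_conj, conj_ofReal, map_zero, conj_I]
    push_cast
    linear_combination (I / 2 * R * (z11 w * z11 Y - z12 w * conj (z12 Y))) * h
  · simp only [rotLeft, rotRight, z12_sub, z11_mul, z12_mul, z11_smul, z12_smul, z11_ofPair,
      z12_ofPair, map_add, map_mul, map_neg, conj_conj, conj_ofReal, map_zero, conj_I]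
    push_cast
    linear_combination (I / 2 * R * (z11 w * z12 Y - z12 w * conj (z11 Y))) * h

theorem unitPt_polar {c : ℝ} (hc : 0 ≤ c) (α β : ℝ) :
    unitPt (c * exp (α * I), β) = ofPair (c * exp (α * I)) (√(c ^ 2 - 1) * exp (β * I)) := by
  rw [unitPt, norm_mul, norm_exp_ofReal_mul_I, norm_real, Real.norm_of_nonneg hc, mul_one]

theorem hasDerivAt_translate {c : ℝ} (hc : 0 ≤ c) (R : ℝ) (w : HR) (α β : ℝ) :
    HasDerivAt (fun α : ℝ => R • mul w (unitPt (c * exp (α * I), β)))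
      (R • mul w (ofPair (I * (c * exp (α * I))) 0)) α := by
  set P := R • mul w (ofPair c 0)
  set Q := R • mul w (ofPair (c * I) 0)
  set S := R • mul w (ofPair 0 (√(c ^ 2 - 1) * exp (β * I)))
  have h1 : ∀ α : ℝ, R • mul w (unitPt (c * exp (α * I), β)) =
      Real.cos α • P + Real.sin α • Q + S := by
    intro α
    rw [unitPt_polar hc]
    apply HR_ext
    · simp only [P, Q, S, z11_add, z11_smul, z11_mul, z11_ofPair, z12_ofPair, exp_mul_I, ofReal_cos,
        ofReal_sin, map_zero]
      ring
    · simp only [P, Q, S, z12_add, z12_smul, z12_mul, z11_ofPair, z12_ofPair, exp_mul_I, ofReal_cos,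
        ofReal_sin, map_zero, map_add, map_mul, conj_ofReal, conj_I, ← cos_conj, ← sin_conj]
      ring
  have h2 : R • mul w (ofPair (I * (c * exp (α * I))) 0) = -Real.sin α • P + Real.cos α • Q := by
    apply HR_ext
    · simp only [P, Q, z11_add, z11_smul, z11_mul, z11_ofPair, z12_ofPair, exp_mul_I, ofReal_cos,
        ofReal_sin, map_zero, ofReal_neg]
      linear_combination R * z11 w * c * Complex.sin α * I_sq
    · simp only [P, Q, z12_add, z12_smul, z12_mul, z11_ofPair, z12_ofPair, exp_mul_I, ofReal_cos,
        ofReal_sin, map_add, map_mul, conj_ofReal, conj_I, ← cos_conj, ← sin_conj,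
        ofReal_neg]
      linear_combination R * z12 w * c * Complex.sin α * I_sq
  simp_rw [h1]
  rw [h2]
  exact (((Real.hasDerivAt_cos α).smul_const P).add
    ((Real.hasDerivAt_sin α).smul_const Q)).add_const S

theorem contDiffOn_lieAct (A B : HR) {f : HR → ℂ} (hf : ContDiffOn ℝ ∞ f HRplus)
    (hAB : ContDiff ℝ ∞ fun X => mul X B - mul A X) : ContDiffOn ℝ ∞ (lieAct A B f) HRplus :=
  (hf.fderiv_of_isOpen isOpen_HRplus (by simp)).clm_apply hAB.contDiffOn

theorem lieAct_zero_one (f : HR → ℂ) (X : HR) :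
    lieAct 0 (ofPair 1 0) f X = fderiv ℝ f X X := by
  rw [lieAct, mul_one', zero_mul', sub_zero]

/-- The operator `deg` in terms of the Lie algebra: the Euler field is the action of the unit
matrix. -/
theorem degOp_eq_add_lieAct (f : HR → ℂ) : degOp f = fun X => f X + lieAct 0 (ofPair 1 0) f X := by
  funext X
  rw [lieAct_zero_one, degOp]

/-- The derivative of `deg f` along the rotations of `z₁₁`. -/
theorem hasDerivAt_degOp_translate {f : HR → ℂ} (hf : ContDiffOn ℝ ∞ f HRplus) {R : ℝ} (hR : 0 < R)
    {w : HR} (hw : N w = 1) {c : ℝ} (hc : 1 < c) (α β : ℝ) :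
    HasDerivAt (fun α : ℝ => degOp f (R • mul w (unitPt (c * exp (α * I), β))))
      (wordAct [(rotLeft w, rotRight)] f (R • mul w (unitPt (c * exp (α * I), β))) +
        wordAct [(rotLeft w, rotRight), (0, ofPair 1 0)] f
          (R • mul w (unitPt (c * exp (α * I), β)))) α := by
  have hc0 : 0 ≤ c := by linarith
  have hmem : R • mul w (unitPt (c * exp (α * I), β)) ∈ HRplus := by
    refine smul_mul_unitPt_mem hR hw ?_
    rwa [norm_mul, norm_exp_ofReal_mul_I, norm_real, Real.norm_of_nonneg hc0, mul_one]
  have hg : ContDiffOn ℝ ∞ (lieAct 0 (ofPair 1 0) f) HRplus :=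
    contDiffOn_lieAct _ _ hf (by
      simp only [mul_one', zero_mul', sub_zero]
      exact contDiff_id)
  have h1 := (differentiableAt_of_contDiffOn hf hmem).hasFDerivAt.comp_hasDerivAt α
    (hasDerivAt_translate hc0 R w α β)
  have h2 := (differentiableAt_of_contDiffOn hg hmem).hasFDerivAt.comp_hasDerivAt α
    (hasDerivAt_translate hc0 R w α β)
  have hX : R • mul w (ofPair (I * (c * exp (α * I))) 0) =
      mul (R • mul w (unitPt (c * exp (α * I), β))) rotRight -
        mul (rotLeft w) (R • mul w (unitPt (c * exp (α * I), β))) := by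
    rw [mul_rotRight_sub_rotLeft_mul hw, z11_unitPt]
  rw [hX] at h1 h2
  rw [degOp_eq_add_lieAct]
  exact h1.add h2

/-! ### Control by the seminorms -/

/-- A bound on an extended-real supremum, read off pointwise. -/
theorem norm_wordAct_le {v : List (HR × HR)} {ρ δ : ℝ} (hδ : 0 ≤ δ) {f : HR → ℂ}
    (h : schwartzSeminorm v 4 ρ f ≤ ENNReal.ofReal δ) {X : HR}
    (hX : (ρ ^ 2)⁻¹ ≤ N X ∧ N X ≤ ρ ^ 2) :
    ‖wordAct v f X‖ * ‖X‖ * (1 + |Real.log ‖X‖|) ^ 4 ≤ δ := by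
  have h1 := (le_iSup₂ (f := fun (X : HR) (_ : X ∈ {X : HR | (ρ ^ 2)⁻¹ ≤ N X ∧ N X ≤ ρ ^ 2}) =>
    ENNReal.ofReal (‖wordAct v f X‖ * ‖X‖ * (1 + |Real.log ‖X‖|) ^ 4)) X hX).trans h
  exact (ENNReal.ofReal_le_ofReal_iff hδ).1 h1

/-- On a translate of a hyperboloid the weights in `X` and in `z₁₁` are comparable. -/
theorem exists_weight_le {R : ℝ} (hR : 0 < R) {w : HR} (hw : N w = 1) :
    ∃ C : ℝ, 0 ≤ C ∧ ∀ p : ℂ × ℝ, 1 < ‖p.1‖ → ‖p.1‖ * (1 + Real.log ‖p.1‖) ^ 4 ≤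
      C * (‖R • mul w (unitPt p)‖ * (1 + |Real.log ‖R • mul w (unitPt p)‖|) ^ 4) := by
  have hw0 := sub_pos.2 (norm_z12_lt_of_N hw)
  set c := min 1 (R * (‖z11 w‖ - ‖z12 w‖)) with hc
  have hc0 : 0 < c := lt_min one_pos (by positivity)
  have hlc : Real.log c ≤ 0 := Real.log_nonpos hc0.le (min_le_left _ _)
  refine ⟨c⁻¹ * (1 - Real.log c) ^ 4, by have : 0 ≤ 1 - Real.log c := by linarith
                                         positivity, fun p hp => ?_⟩
  have hp0 : 0 < ‖p.1‖ := by linarith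
  set X := R • mul w (unitPt p) with hX
  have h1 : c * ‖p.1‖ ≤ ‖X‖ := by
    have e1 : ‖z11 X‖ ≤ ‖X‖ := by
      refine le_of_sq_le_sq ?_ (norm_nonneg _)
      rw [norm_sq_eq]
      nlinarith [sq_nonneg ‖z12 X‖]
    refine le_trans ?_ e1
    rw [hX, z11_smul, norm_mul, norm_real, Real.norm_of_nonneg hR.le]
    calc c * ‖p.1‖ ≤ R * (‖z11 w‖ - ‖z12 w‖) * ‖p.1‖ := by
          gcongr
          exact min_le_right _ _
      _ ≤ _ := by
          rw [mul_assoc]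
          exact mul_le_mul_of_nonneg_left (le_norm_z11_mul w hp) hR.le
  have h2 : Real.log c + Real.log ‖p.1‖ ≤ Real.log ‖X‖ := by
    rw [← Real.log_mul hc0.ne' hp0.ne']
    exact Real.log_le_log (by positivity) h1
  have h3 : 1 + Real.log ‖p.1‖ ≤ (1 - Real.log c) * (1 + |Real.log ‖X‖|) := by
    nlinarith [le_abs_self (Real.log ‖X‖), abs_nonneg (Real.log ‖X‖)]
  have h4 := one_le_one_add_log hp.le
  calc ‖p.1‖ * (1 + Real.log ‖p.1‖) ^ 4
      ≤ (c⁻¹ * ‖X‖) * ((1 - Real.log c) * (1 + |Real.log ‖X‖|)) ^ 4 := by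
        gcongr
        rw [← div_eq_inv_mul, le_div_iff₀ hc0, mul_comm]
        exact h1
    _ = _ := by ring

/-- The regularized Poisson integrals at a point are bounded, uniformly in the regularization, by
four of the seminorms. -/
theorem exists_norm_poissonIntegral_le {R : ℝ} (hR : 0 < R) {W : HR} (hW : W ∈ HRplus) :
    ∃ (K ρ : ℝ) (S : Finset (List (HR × HR))), 0 ≤ K ∧ 1 < ρ ∧
      ∀ (f : HR → ℂ) (δ : ℝ), ContDiffOn ℝ ∞ f HRplus → 0 ≤ δ →
        (∀ v ∈ S, schwartzSeminorm v 4 ρ f ≤ ENNReal.ofReal δ) → ∀ (σ : ℤˣ) (ε : ℝ), 0 < ε →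
          Integrable (poissonIntegrand σ f W ε) (surfaceMeasure R) ∧
            ‖poissonIntegral σ R f W ε‖ ≤ K * δ := by
  classical
  obtain ⟨r, w, hr, hw, -, rfl⟩ := exists_unit_smul hW
  obtain ⟨C, hC, hCle⟩ := exists_weight_le hR hw
  obtain ⟨K, hK, hKle⟩ := exists_norm_integral_regKernel_le (A := R ^ 2 + r ^ 2) (B := 2 * R * r)
    (by positivity) (by nlinarith [sq_nonneg (R - r)])
  -- the shell with `ρ = 1 + R + R⁻¹` contains the hyperboloid, as `ρ⁻¹ ≤ R ≤ ρ`
  refine ⟨(2 * Real.pi ^ 2)⁻¹ * (R ^ 2 * (K * (2 * C))), 1 + R + R⁻¹,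
    {[], [(0, ofPair 1 0)], [(rotLeft w, rotRight)], [(rotLeft w, rotRight), (0, ofPair 1 0)]},
    by positivity, by have := inv_pos.2 hR; linarith, ?_⟩
  intro f δ hf hδ hS σ ε hε
  have hshell : ∀ X, N X = R ^ 2 → ((1 + R + R⁻¹) ^ 2)⁻¹ ≤ N X ∧ N X ≤ (1 + R + R⁻¹) ^ 2 := by
    intro X hX
    have := inv_pos.2 hR
    rw [hX]
    constructor
    · rw [← inv_pow]
      refine pow_le_pow_left₀ (by positivity) ?_ 2
      exact (inv_anti₀ this (by linarith)).trans_eq (inv_inv R)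
    · exact pow_le_pow_left₀ hR.le (by linarith) 2
  have hword : ∀ v, schwartzSeminorm v 4 (1 + R + R⁻¹) f ≤ ENNReal.ofReal δ → ∀ p : ℂ × ℝ,
      1 < ‖p.1‖ → ‖wordAct v f (R • mul w (unitPt p))‖ ≤
        C * δ * (‖p.1‖ * (1 + Real.log ‖p.1‖) ^ 4)⁻¹ := by
    intro v hv p hp
    have h4 := one_le_one_add_log hp.le
    have h1 := norm_wordAct_le hδ hv (hshell _ (N_smul_mul_unitPt hw hp))
    rw [← div_eq_mul_inv, le_div_iff₀ (by positivity)]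
    rw [mul_assoc] at h1
    calc _ ≤ ‖wordAct v f (R • mul w (unitPt p))‖ * (C * (‖R • mul w (unitPt p)‖ *
          (1 + |Real.log ‖R • mul w (unitPt p)‖|) ^ 4)) :=
          mul_le_mul_of_nonneg_left (hCle p hp) (norm_nonneg _)
      _ = C * (‖wordAct v f (R • mul w (unitPt p))‖ * (‖R • mul w (unitPt p)‖ *
          (1 + |Real.log ‖R • mul w (unitPt p)‖|) ^ 4)) := by ring
      _ ≤ C * δ := mul_le_mul_of_nonneg_left h1 hC
  have h2C : ∀ {x y : ℂ} {t : ℝ}, ‖x‖ ≤ C * δ * t → ‖y‖ ≤ C * δ * t → ‖x + y‖ ≤ 2 * C * δ * t := by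
    intro x y t hx hy
    refine (norm_add_le x y).trans ((add_le_add hx hy).trans (le_of_eq ?_))
    ring
  have hcont := continuousOn_degOp hf
  have hM : ∀ p : ℂ × ℝ, 1 < ‖p.1‖ → ‖degOp f (R • mul w (unitPt p))‖ ≤
      2 * C * δ * (‖p.1‖ * (1 + Real.log ‖p.1‖) ^ 4)⁻¹ := by
    intro p hp
    rw [degOp_eq_add_lieAct]
    exact h2C (hword [] (hS _ (by simp)) p hp) (hword [(0, ofPair 1 0)] (hS _ (by simp)) p hp)
  refine ⟨integrable_poissonIntegrand hR hr hw hcont σ hε hM, ?_⟩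
  have hb := hKle (fun p => degOp f (R • mul w (unitPt p)))
    (fun p => wordAct [(rotLeft w, rotRight)] f (R • mul w (unitPt p)) +
      wordAct [(rotLeft w, rotRight), (0, ofPair 1 0)] f (R • mul w (unitPt p))) (2 * C * δ)
    (aestronglyMeasurable_comp_unitPt hR hw hcont) hM
    (fun p hp => h2C (hword _ (hS _ (by simp)) p hp) (hword _ (hS _ (by simp)) p hp))
    (fun c hc β α => hasDerivAt_degOp_translate hf hR hw hc α β) σ ε hε
  rw [poissonIntegral_eq hR hw hcont σ hε, norm_mul, norm_mul]
  have e1 : ‖(2 * (Real.pi : ℂ) ^ 2)⁻¹‖ = (2 * Real.pi ^ 2)⁻¹ := by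
    simp [abs_of_pos Real.pi_pos]
  have e2 : ‖(R : ℂ) ^ 2‖ = R ^ 2 := by simp
  rw [e1, e2]
  calc _ ≤ (2 * Real.pi ^ 2)⁻¹ * (R ^ 2 * (K * (2 * C * δ))) := by gcongr
    _ = _ := by ring

/-! ### The discrete series component -/

/-- The functions whose two regularized Poisson integrals at `W` converge, with a common limit. -/
def HasPoissonLimit (R : ℝ) (W : HR) (f : HR → ℂ) : Prop :=
  ContDiffOn ℝ ∞ f HRplus ∧
    (∀ (σ : ℤˣ) (ε : ℝ), 0 < ε → Integrable (poissonIntegrand σ f W ε) (surfaceMeasure R)) ∧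
    ∃ c : ℂ, ∀ σ : ℤˣ, Tendsto (poissonIntegral σ R f W) (𝓝[>] 0) (𝓝 c)

theorem degOp_add_smul {f g : HR → ℂ} (hf : ContDiffOn ℝ ∞ f HRplus) (hg : ContDiffOn ℝ ∞ g HRplus)
    (c : ℂ) {X : HR} (hX : X ∈ HRplus) : degOp (f + c • g) X = degOp f X + c * degOp g X := by
  have h1 := differentiableAt_of_contDiffOn hf hX
  have h2 := differentiableAt_of_contDiffOn hg hX
  simp only [degOp]
  rw [fderiv_add h1 (h2.const_smul c), fderiv_const_smul h2]
  simp only [Pi.add_apply, Pi.smul_apply, add_apply,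
    smul_apply, smul_eq_mul]
  ring

theorem poissonIntegrand_add_smul {R : ℝ} (hR : 0 < R) {f g : HR → ℂ}
    (hf : ContDiffOn ℝ ∞ f HRplus) (hg : ContDiffOn ℝ ∞ g HRplus) (c : ℂ) (σ : ℤˣ) (W : HR) (ε : ℝ) :
    poissonIntegrand σ (f + c • g) W ε =ᵐ[surfaceMeasure R]
      fun X => poissonIntegrand σ f W ε X + c * poissonIntegrand σ g W ε X := by
  filter_upwards [ae_surfaceMeasure hR] with X hX
  have hmem : X ∈ HRplus := by
    change 0 < N X
    rw [hX]
    positivity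
  simp only [poissonIntegrand, degOp_add_smul hf hg c hmem]
  ring

theorem integrable_poissonIntegrand_add_smul {R : ℝ} (hR : 0 < R) {f g : HR → ℂ}
    (hf : ContDiffOn ℝ ∞ f HRplus) (hg : ContDiffOn ℝ ∞ g HRplus) (c : ℂ) {σ : ℤˣ} {W : HR} {ε : ℝ}
    (h1 : Integrable (poissonIntegrand σ f W ε) (surfaceMeasure R))
    (h2 : Integrable (poissonIntegrand σ g W ε) (surfaceMeasure R)) :
    Integrable (poissonIntegrand σ (f + c • g) W ε) (surfaceMeasure R) ∧
      poissonIntegral σ R (f + c • g) W ε =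
        poissonIntegral σ R f W ε + c * poissonIntegral σ R g W ε := by
  have h := poissonIntegrand_add_smul hR hf hg c σ W ε
  refine ⟨(h1.add (h2.const_mul c)).congr h.symm, ?_⟩
  rw [poissonIntegral, integral_congr_ae h, integral_add h1 (h2.const_mul c), integral_const_mul,
    poissonIntegral, poissonIntegral]
  ring

theorem HasPoissonLimit.add_smul {R : ℝ} (hR : 0 < R) {W : HR} {f g : HR → ℂ}
    (hf : HasPoissonLimit R W f) (hg : HasPoissonLimit R W g) (c : ℂ) :
    HasPoissonLimit R W (f + c • g) := by
  obtain ⟨sf, hfi, cf, hfl⟩ := hf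
  obtain ⟨sg, hgi, cg, hgl⟩ := hg
  refine ⟨sf.add (sg.const_smul c), fun σ ε hε => (integrable_poissonIntegrand_add_smul hR sf sg c
    (hfi σ ε hε) (hgi σ ε hε)).1, cf + c * cg, fun σ => ?_⟩
  refine ((hfl σ).add ((hgl σ).const_mul c)).congr' ?_
  filter_upwards [self_mem_nhdsWithin] with ε hε
  exact (integrable_poissonIntegrand_add_smul hR sf sg c (hfi σ ε hε) (hgi σ ε hε)).2.symm

theorem hasPoissonLimit_zero (R : ℝ) (W : HR) : HasPoissonLimit R W 0 := by
  have h : ∀ (σ : ℤˣ) (ε : ℝ), poissonIntegrand σ 0 W ε = 0 := by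
    intro σ ε
    funext X
    have : degOp (0 : HR → ℂ) X = 0 := by simp [degOp]
    simp [poissonIntegrand, this]
  refine ⟨contDiffOn_const, fun σ ε _ => ?_, 0, fun σ => ?_⟩
  · rw [h]
    exact integrable_zero _ _ _
  · have : poissonIntegral σ R 0 W = fun _ => 0 := by
      funext ε
      simp [poissonIntegral, h]
    rw [this]
    exact tendsto_const_nhds

/-- The limits on the generators do not depend on the sign, and the property is linear. -/
theorem hasPoissonLimit_of_mem_discreteSpan {R : ℝ} (hR : 0 < R) {W : HR} (hW : W ∈ HRplus)
    {g : HR → ℂ} (hg : g ∈ discreteSpan) : HasPoissonLimit R W g := by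
  induction hg using Submodule.span_induction with
  | mem f hf =>
    have hmem : ∀ X, N X = R ^ 2 → X ∈ HRplus := fun X hX => by
      change 0 < N X
      rw [hX]
      positivity
    obtain ⟨l2, n2, m2, h, rfl | rfl⟩ := hf
    · have hp := fun σ => poisson_matCoeff h hR hW σ (c := 1) (contDiffOn_matCoeff h) fun X hX => by
        rw [degOp_matCoeff h (hmem X hX), one_mul]
      exact ⟨contDiffOn_matCoeff h, fun σ => (hp σ).1, _, fun σ => (hp σ).2⟩
    · have hp := fun σ => poisson_matCoeff h hR hW σ (c := -((R ^ 2 : ℝ) : ℂ) ^ (-l2 - 1))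
        (contDiffOn_matCoeffInv h) fun X hX => by
          rw [degOp_matCoeffInv h (hmem X hX), hX]
          ring
      exact ⟨contDiffOn_matCoeffInv h, fun σ => (hp σ).1, _, fun σ => (hp σ).2⟩
  | zero => exact hasPoissonLimit_zero R W
  | add f g _ _ hf hg => simpa using hf.add_smul hR hg 1
  | smul c f _ hf => simpa using (hasPoissonLimit_zero R W).add_smul hR hf c

/-- Two functions that are both eventually close to common constants converge to a common limit. -/
theorem exists_common_limit {l : Filter ℝ} [l.NeBot] {u v : ℝ → ℂ}
    (h : ∀ η : ℝ, 0 < η → ∃ c : ℂ, (∀ᶠ ε in l, dist (u ε) c ≤ η) ∧ ∀ᶠ ε in l, dist (v ε) c ≤ η) :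
    ∃ c : ℂ, Tendsto u l (𝓝 c) ∧ Tendsto v l (𝓝 c) := by
  have hc : Cauchy (map u l) := by
    refine Metric.cauchy_iff.2 ⟨inferInstance, fun η hη => ?_⟩
    obtain ⟨c, h1, -⟩ := h (η / 3) (by positivity)
    refine ⟨Metric.closedBall c (η / 3), h1, fun x hx y hy => ?_⟩
    have := dist_triangle_right x y c
    rw [Metric.mem_closedBall] at hx hy
    linarith
  obtain ⟨c, hu⟩ := CompleteSpace.complete hc
  refine ⟨c, hu, Metric.tendsto_nhds.2 fun η hη => ?_⟩
  obtain ⟨c', h1, h2⟩ := h (η / 3) (by positivity)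
  have h3 : dist c c' ≤ η / 3 := le_of_tendsto (Tendsto.dist hu tendsto_const_nhds) h1
  filter_upwards [h2] with ε hε
  have := dist_triangle_right (v ε) c c'
  linarith

/-- The uniform bound by seminorms extends the convergence, and the equality of the two limits,
from the span to its closure. -/
theorem poisson_discreteSeriesComponent {R : ℝ} (hR : 0 < R) {φ : HR → ℂ}
    (hφ : φ ∈ discreteSeriesComponent) {W : HR} (hW : W ∈ HRplus) :
    PoissonConverges 1 R φ W ∧ PoissonConverges (-1) R φ W ∧
      poissonOp 1 R φ W = poissonOp (-1) R φ W := by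
  classical
  obtain ⟨K, ρ, S, hK, hρ, hS⟩ := exists_norm_poissonIntegral_le hR hW
  have hsm : ContDiffOn ℝ ∞ φ HRplus := hφ.1.1.1
  have happ : ∀ δ : ℝ, 0 < δ → ∃ g, HasPoissonLimit R W g ∧ ∀ (σ : ℤˣ) (ε : ℝ), 0 < ε →
      Integrable (poissonIntegrand σ φ W ε) (surfaceMeasure R) ∧
        ‖poissonIntegral σ R φ W ε - poissonIntegral σ R g W ε‖ ≤ K * δ := by
    intro δ hδ
    obtain ⟨g, hg, hgS⟩ := hφ.2 (S.image fun v => (v, 4, ρ)) (by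
      intro i hi
      obtain ⟨v, -, rfl⟩ := Finset.mem_image.1 hi
      exact hρ) (ENNReal.ofReal δ) (ENNReal.ofReal_pos.2 hδ)
    have hgl := hasPoissonLimit_of_mem_discreteSpan hR hW hg
    have hd : ContDiffOn ℝ ∞ (φ - g) HRplus := hsm.sub hgl.1
    refine ⟨g, hgl, fun σ ε hε => ?_⟩
    obtain ⟨h1, h2⟩ := hS (φ - g) δ hd hδ.le
      (fun v hv => (hgS _ (Finset.mem_image_of_mem _ hv)).le) σ ε hε
    have h3 := integrable_poissonIntegrand_add_smul hR hd hgl.1 1 h1 (hgl.2.1 σ ε hε)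
    rw [one_smul, sub_add_cancel, one_mul] at h3
    refine ⟨h3.1, ?_⟩
    rw [h3.2, add_sub_cancel_right]
    exact h2
  have hint : ∀ (σ : ℤˣ) (ε : ℝ), 0 < ε →
      Integrable (poissonIntegrand σ φ W ε) (surfaceMeasure R) := by
    obtain ⟨g, -, h⟩ := happ 1 one_pos
    exact fun σ ε hε => (h σ ε hε).1
  obtain ⟨c, h1, h2⟩ : ∃ c : ℂ, Tendsto (poissonIntegral 1 R φ W) (𝓝[>] 0) (𝓝 c) ∧
      Tendsto (poissonIntegral (-1) R φ W) (𝓝[>] 0) (𝓝 c) := by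
    refine exists_common_limit fun η hη => ?_
    obtain ⟨g, hg, h⟩ := happ (η / (2 * (K + 1))) (by positivity)
    obtain ⟨c, hc⟩ := hg.2.2
    have hle : K * (η / (2 * (K + 1))) ≤ η / 2 := by
      rw [mul_div_assoc', div_le_div_iff₀ (by positivity) two_pos]
      nlinarith
    have key : ∀ σ : ℤˣ, ∀ᶠ ε in 𝓝[>] 0, dist (poissonIntegral σ R φ W ε) c ≤ η := by
      intro σ
      filter_upwards [self_mem_nhdsWithin, Metric.tendsto_nhds.1 (hc σ) (η / 2) (by positivity)]
        with ε hε hd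
      have h3 := (h σ ε hε).2
      rw [← dist_eq_norm] at h3
      have := dist_triangle (poissonIntegral σ R φ W ε) (poissonIntegral σ R g W ε) c
      linarith
    exact ⟨c, key 1, key (-1)⟩
  exact ⟨⟨hint 1, c, h1⟩, ⟨hint (-1), c, h2⟩, (poissonOp_eq h1).trans (poissonOp_eq h2).symm⟩

end SplitQuat

theorem mainTheorem7 (R : ℝ) (hR : 0 < R) :
    (∀ φ ∈ discreteSeriesComponent, ∀ W ∈ HRplus,
      PoissonConverges 1 R φ W ∧ PoissonConverges (-1) R φ W ∧
        poissonOp 1 R φ W = poissonOp (-1) R φ W) ∧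
    (∀ l2 n2 m2 : ℤ, IsDiscreteIndex l2 n2 m2 → ∀ σ : ℤˣ, ∀ W ∈ HRplus,
      (PoissonConverges σ R (matCoeffInv l2 n2 m2) W ∧
        (N W ≤ R ^ 2 → poissonOp σ R (matCoeffInv l2 n2 m2) W =
          -((N W : ℂ) ^ (-l2 - 1) * matCoeff l2 n2 m2 W)) ∧
        (R ^ 2 ≤ N W → poissonOp σ R (matCoeffInv l2 n2 m2) W =
          -((R : ℂ) ^ (-2 * (l2 + 1)) * matCoeff l2 n2 m2 W))) ∧
      (PoissonConverges σ R (matCoeff l2 n2 m2) W ∧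
        (N W ≤ R ^ 2 → poissonOp σ R (matCoeff l2 n2 m2) W =
          (R : ℂ) ^ (2 * (l2 + 1)) * (N W : ℂ) ^ (-l2 - 1) * matCoeff l2 n2 m2 W) ∧
        (R ^ 2 ≤ N W → poissonOp σ R (matCoeff l2 n2 m2) W =
          matCoeff l2 n2 m2 W))) := by
  exact ⟨fun φ hφ W hW => poisson_discreteSeriesComponent hR hφ hW,
    fun l2 n2 m2 h σ W hW => poisson_matCoeff_values hR h σ hW⟩
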